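/- Let $\alpha\geqslant 1$ and $\beta$ be real numbers, let $1<c<\frac{12}{11}$, and put $\gamma=c^{-1}$. Let $\mathscr{N}_{\alpha,\beta}^{(c)}=\{\lfloor \alpha n^c+\beta\rfloor : n=1,2,3,\dots\}$. For a real number $x\geqslant 2$ and integers $a$ and $q\geqslant 1$ write $$\vartheta(x;q,a)=\sum_{\substack{p\leqslant x\\ p\equiv a\,(\mathrm{mod}\,q)}}\log p,\qquad \vartheta_{\alpha,\beta,c}(x;q,a)=\sum_{\substack{p\leqslant x,\ p\in\mathscr{N}_{\alpha,\beta}^{(c)}\\ p\equiv a\,(\mathrm{mod}\,q)}}\log p,$$ where $p$ runs over primes. Then for every $\varepsilon>0$ and all such $x$, $q$ and $a$ (in particular for all coprime $a$ and $q$), $$\vartheta_{\alpha,\beta,c}(x;q,a)=\alpha^{-\gamma}\gamma x^{\gamma-1}\vartheta(x;q,a)+\alpha^{-\gamma}\gamma(1-\gamma)\int_2^x u^{\gamma-2}\vartheta(u;q,a)\,\mathrm{d}u+O\big(x^{7\gamma/13+11/26+\varepsilon}\big),$$ where the implied constant depends only on $\alpha,\beta,c$ and $\varepsilon$; in particular it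 does not depend on $x$, $q$ or $a$. -/

import Mathlib

/-- The generalized Piatetski--Shapiro sequence `(⌊α n ^ c + β⌋)_{n ≥ 1}`, as a set of integers. -/
def genPiatetskiShapiro (α β c : ℝ) : Set ℤ :=
  {m : ℤ | ∃ n : ℕ, 1 ≤ n ∧ m = ⌊α * (n : ℝ) ^ c + β⌋}

/-- `ϑ(x; q, a)`: the sum of `log p` over the primes `p ≤ x` with `p ≡ a (mod q)`. -/
noncomputable def thetaAP (x : ℝ) (q : ℕ) (a : ℤ) : ℝ :=
  ∑ p ∈ (Finset.Icc 1 ⌊x⌋₊).filter (fun p : ℕ => p.Prime ∧ (p : ℤ) ≡ a [ZMOD (q : ℤ)]),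
    Real.log (p : ℝ)

open scoped Classical in
/-- `ϑ_{α,β,c}(x; q, a)`: the sum of `log p` over the primes `p ≤ x` with `p ≡ a (mod q)` that
belong to the generalized Piatetski--Shapiro sequence. -/
noncomputable def thetaPS (α β c x : ℝ) (q : ℕ) (a : ℤ) : ℝ :=
  ∑ p ∈ (Finset.Icc 1 ⌊x⌋₊).filter (fun p : ℕ => p.Prime ∧
      (p : ℤ) ∈ genPiatetskiShapiro α β c ∧ (p : ℤ) ≡ a [ZMOD (q : ℤ)]),
    Real.log (p : ℝ)

/-! Put `δ = (15 - 14γ)/26`, so that the error exponent `7γ/13 + 11/26` is `1 - δ`. For large `p`,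
the prime `p` lies in the sequence exactly when the interval from `u = ((p - β)/α)^γ` (included) to
`v = ((p + 1 - β)/α)^γ` (excluded) contains a positive integer. As `α ≥ 1` and `γ < 1`, this
interval has length at most 1, so the indicator is `v - u + ψ(-v) - ψ(-u)`, with `ψ` the sawtooth
(`indicator_eq_sawtooth`). The length is `α^(-γ) γ p^(γ-1) + O(1/p)`, and partial summation turns
this into the main terms (`sum_log_mul_rpow_eq`). What remains is to save `x^(δ-ε)` in the sum of
`log p · ψ(-((p - β)/α)^γ)` over a residue class. The other sawtooth sum is the same with `β - 1`
for `β`.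

The sawtooth is sandwiched between difference quotients, with step `x^(-δ)`, of its periodic
primitive `B₂({t})/2`, whose Fourier series converges absolutely. This leaves exponential sums with
frequencies `h ≥ 1`, for which a bound `x^(1-δ+ε) (1 + (h/x^δ)^(1/2))` suffices
(`abs_sum_sawtooth_le_of_forall`).

The residue class is detected by additive characters, which only adds a linear term `θ n` to the
phase (`norm_sum_residue_le`). All later estimates depend on second derivatives alone and do not see
`θ`; hence the uniformity in `q` and `a`.

The sums over primes become sums over `Λ`, at the cost of the prime powers, and Vaughan's identity
with both cuts at `U = x^(1/6)` splits these into bilinear sums. Type I sums have a smooth inner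
variable and yield to van der Corput's second derivative test. In the type II sums the shorter
variable is cut into blocks of length `Q`, about `x^(2δ)`; Cauchy–Schwarz leaves the correlations of
pairs of rows in a block, and the same test bounds these because the second derivative of a phase
difference has constant sign and known size (`norm_sum_dyadicExp_mul_conj_le`). The condition `γ >
11/12` is equivalent to `δ < 1/12`, which gives `Q ≤ U` and also makes the off-diagonal terms small
enough. -/

/-- The additive character `t ↦ exp (2 π i t)`. -/
noncomputable def unitExp (t : ℝ) : ℂ := Complex.exp ((2 * Real.pi * t : ℝ) * Complex.I)

theorem norm_unitExp (t : ℝ) : ‖unitExp t‖ = 1 := Complex.norm_exp_ofReal_mul_I _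

theorem unitExp_add (s t : ℝ) : unitExp (s + t) = unitExp s * unitExp t := by
  unfold unitExp
  rw [← Complex.exp_add]
  push_cast
  ring_nf

theorem unitExp_neg (t : ℝ) : unitExp (-t) = (starRingEnd ℂ) (unitExp t) := by
  unfold unitExp
  rw [← Complex.exp_conj, map_mul, Complex.conj_ofReal, Complex.conj_I]
  push_cast
  ring_nf

theorem unitExp_sub (s t : ℝ) : unitExp (s - t) = unitExp s * (starRingEnd ℂ) (unitExp t) := by
  rw [sub_eq_add_neg, unitExp_add, unitExp_neg]

theorem unitExp_int (k : ℤ) : unitExp k = 1 := by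
  unfold unitExp
  rw [Complex.exp_eq_one_iff]
  exact ⟨k, by push_cast; ring⟩

theorem unitExp_sub_int (t : ℝ) (k : ℤ) : unitExp (t - k) = unitExp t := by
  rw [unitExp_sub, unitExp_int]
  simp

theorem unitExp_re (t : ℝ) : (unitExp t).re = Real.cos (2 * Real.pi * t) :=
  Complex.exp_ofReal_mul_I_re _

theorem unitExp_im (t : ℝ) : (unitExp t).im = Real.sin (2 * Real.pi * t) :=
  Complex.exp_ofReal_mul_I_im _

/-! ### The Kusmin–Landau inequality -/

/-- The inverse of `1 - unitExp t` is `(1 + i cot (π t)) / 2`. -/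
theorem one_sub_unitExp_mul (t : ℝ) (ht : Real.sin (Real.pi * t) ≠ 0) :
    (1 - unitExp t) * (1 / 2 + (Real.cot (Real.pi * t) / 2 : ℝ) * Complex.I) = 1 := by
  have h2 : 2 * Real.pi * t = 2 * (Real.pi * t) := by ring
  have hs : Real.sin (Real.pi * t) ^ 2 + Real.cos (Real.pi * t) ^ 2 = 1 :=
    Real.sin_sq_add_cos_sq _
  apply Complex.ext
  · simp only [Complex.mul_re, Complex.sub_re, Complex.one_re, unitExp_re, Complex.add_re,
      Complex.sub_im, Complex.one_im, unitExp_im, Complex.add_im, Complex.mul_im,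
      Complex.ofReal_re, Complex.ofReal_im, Complex.I_re, Complex.I_im, h2, Real.cos_two_mul,
      Real.sin_two_mul, Real.cot_eq_cos_div_sin]
    norm_num
    field_simp
    ring
  · simp only [Complex.mul_re, Complex.sub_re, Complex.one_re, unitExp_re, Complex.add_re,
      Complex.sub_im, Complex.one_im, unitExp_im, Complex.add_im, Complex.mul_im,
      Complex.ofReal_re, Complex.ofReal_im, Complex.I_re, Complex.I_im, h2, Real.cos_two_mul,
      Real.sin_two_mul, Real.cot_eq_cos_div_sin]
    norm_num
    field_simp
    linear_combination (-2 * Real.cos (Real.pi * t)) * hs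

theorem two_mul_le_sin_pi_mul {Δ t : ℝ} (h1 : Δ ≤ t) (h2 : t ≤ 1 - Δ) (h0 : 0 < Δ) :
    2 * Δ ≤ Real.sin (Real.pi * t) := by
  have hpi := Real.pi_pos
  rcases le_total t (1 / 2) with h | h
  · have := Real.mul_le_sin (x := Real.pi * t) (by nlinarith) (by nlinarith)
    have e : 2 / Real.pi * (Real.pi * t) = 2 * t := by field_simp
    linarith
  · have := Real.mul_le_sin (x := Real.pi * (1 - t)) (by nlinarith) (by nlinarith)
    have e : 2 / Real.pi * (Real.pi * (1 - t)) = 2 * (1 - t) := by field_simp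
    have e2 : Real.sin (Real.pi * (1 - t)) = Real.sin (Real.pi * t) := by
      rw [mul_sub, mul_one, Real.sin_pi_sub]
    linarith

/-- The addition formula turns `sin (b - a) ≥ 0` into this after division by `sin a * sin b`. -/
theorem cot_le_cot_of_le {a b : ℝ} (ha : 0 < a) (hab : a ≤ b) (hb : b < Real.pi) :
    Real.cot b ≤ Real.cot a := by
  have h1 := Real.sin_pos_of_pos_of_lt_pi ha (by linarith)
  have h2 := Real.sin_pos_of_pos_of_lt_pi (by linarith) hb
  have h3 := Real.sin_nonneg_of_nonneg_of_le_pi (x := b - a) (by linarith) (by linarith)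
  rw [Real.cot_eq_cos_div_sin, Real.cot_eq_cos_div_sin, div_le_div_iff₀ h2 h1]
  rw [Real.sin_sub] at h3
  linarith

theorem abs_cot_pi_mul_le {Δ t : ℝ} (h1 : Δ ≤ t) (h2 : t ≤ 1 - Δ) (h0 : 0 < Δ) :
    |Real.cot (Real.pi * t)| ≤ 1 / (2 * Δ) := by
  have hs := two_mul_le_sin_pi_mul h1 h2 h0
  rw [Real.cot_eq_cos_div_sin, abs_div, abs_of_pos (a := Real.sin _) (by linarith)]
  exact div_le_div₀ zero_le_one (Real.abs_cos_le_one _) (by linarith) hs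

/-- The Kusmin--Landau inequality, for a sequence whose differences are monotone and lie in
`[Δ, 1 - Δ]`. -/
theorem kusmin_landau_aux (f : ℕ → ℝ) (a b : ℕ) {Δ : ℝ} (h0 : 0 < Δ)
    (hmono : ∀ n, a ≤ n → n + 1 < b → f (n + 1) - f n ≤ f (n + 2) - f (n + 1))
    (hlow : ∀ n, a ≤ n → n < b → Δ ≤ f (n + 1) - f n)
    (hup : ∀ n, a ≤ n → n < b → f (n + 1) - f n ≤ 1 - Δ) :
    ‖∑ n ∈ Finset.Ico a b, unitExp (f n)‖ ≤ 2 / Δ := by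
  set d : ℕ → ℝ := fun n => f (n + 1) - f n with hd
  set c : ℕ → ℂ := fun n => 1 / 2 + (Real.cot (Real.pi * d n) / 2 : ℝ) * Complex.I with hc
  have hpi := Real.pi_pos
  have hsin : ∀ n, a ≤ n → n < b → Real.sin (Real.pi * d n) ≠ 0 := fun n h1 h2 =>
    (lt_of_lt_of_le (by linarith) (two_mul_le_sin_pi_mul (hlow n h1 h2) (hup n h1 h2) h0)).ne'
  -- Each term is a multiple of a difference of consecutive terms, so the sum telescopes up to the
  -- variation of `c`.
  have hterm : ∀ n, a ≤ n → n < b →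
      unitExp (f n) = c n * (unitExp (f n) - unitExp (f (n + 1))) := by
    intro n h1 h2
    have h3 := one_sub_unitExp_mul (d n) (hsin n h1 h2)
    have h4 : unitExp (f (n + 1)) = unitExp (f n) * unitExp (d n) := by
      rw [← unitExp_add]; congr 1; simp [hd]
    rw [h4]
    linear_combination (-unitExp (f n)) * h3
  have hcn : ∀ n, a ≤ n → n < b → ‖c n‖ ≤ 1 / 2 + 1 / (4 * Δ) := by
    intro n h1 h2
    have h3 := abs_cot_pi_mul_le (hlow n h1 h2) (hup n h1 h2) h0
    refine (norm_add_le _ _).trans (add_le_add (by norm_num) ?_)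
    rw [norm_mul, Complex.norm_I, mul_one, Complex.norm_real, Real.norm_eq_abs, abs_div,
      abs_two]
    calc _ ≤ 1 / (2 * Δ) / 2 := by gcongr
      _ = _ := by field_simp; norm_num
  -- summation by parts, by induction on the upper end
  have key : ∀ m, a ≤ m → m < b →
      ‖∑ n ∈ Finset.Ico a (m + 1), unitExp (f n) + c m * unitExp (f (m + 1))‖ ≤
        ‖c a‖ + (Real.cot (Real.pi * d a) - Real.cot (Real.pi * d m)) / 2 := by
    intro m ham
    induction m, ham using Nat.le_induction with
    | base =>
      intro h
      rw [Nat.Ico_succ_singleton, Finset.sum_singleton]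
      have : unitExp (f a) + c a * unitExp (f (a + 1)) = c a * unitExp (f a) := by
        linear_combination hterm a le_rfl h
      rw [this, norm_mul, norm_unitExp]
      simp
    | succ m ham ih =>
      intro h
      have ih := ih (by omega)
      rw [Finset.sum_Ico_succ_top (by omega)]
      have e : ∑ n ∈ Finset.Ico a (m + 1), unitExp (f n) + unitExp (f (m + 1)) +
          c (m + 1) * unitExp (f (m + 1 + 1)) =
          (∑ n ∈ Finset.Ico a (m + 1), unitExp (f n) + c m * unitExp (f (m + 1))) +
            (c (m + 1) - c m) * unitExp (f (m + 1)) := by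
        linear_combination hterm (m + 1) (by omega) h
      have hle : Real.cot (Real.pi * d (m + 1)) ≤ Real.cot (Real.pi * d m) := by
        have l1 := hlow m ham (by omega)
        have l2 := hup (m + 1) (by omega) h
        refine cot_le_cot_of_le (by nlinarith) ?_ (by nlinarith)
        exact mul_le_mul_of_nonneg_left (hmono m ham h) hpi.le
      -- The `c n` lie on a vertical line and move monotonically along it, so their total variation
      -- is just the difference of the end values.
      have hcc : ‖c (m + 1) - c m‖ =
          (Real.cot (Real.pi * d m) - Real.cot (Real.pi * d (m + 1))) / 2 := by
        have : c (m + 1) - c m =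
            ((Real.cot (Real.pi * d (m + 1)) - Real.cot (Real.pi * d m)) / 2 : ℝ) *
              Complex.I := by
          simp only [hc]; push_cast; ring
        rw [this, norm_mul, Complex.norm_I, mul_one, Complex.norm_real, Real.norm_eq_abs,
          abs_of_nonpos (by linarith)]
        ring
      rw [e]
      refine (norm_add_le _ _).trans ?_
      rw [norm_mul, norm_unitExp, mul_one, hcc]
      linarith
  rcases le_or_gt b a with h | h
  · rw [Finset.Ico_eq_empty (by omega)]
    simp only [Finset.sum_empty, norm_zero]
    positivity
  · obtain ⟨m, rfl⟩ : ∃ m, b = m + 1 := ⟨b - 1, by omega⟩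
    have h1 := key m (by omega) (by omega)
    have h2 := hcn m (by omega) (by omega)
    have h3 := hcn a (by omega) (by omega)
    have h4 := abs_le.1 (abs_cot_pi_mul_le (hlow a le_rfl h) (hup a le_rfl h) h0)
    have h5 := abs_le.1 (abs_cot_pi_mul_le (hlow m (by omega) (by omega))
      (hup m (by omega) (by omega)) h0)
    -- The two end coefficients and the variation add up to at most `1 + 1/Δ`; since `[Δ, 1 - Δ]` is
    -- nonempty, the `1` is absorbed.
    have hΔ : Δ ≤ 1 / 2 := by linarith [hlow a le_rfl h, hup a le_rfl h]
    have h6 : ‖∑ n ∈ Finset.Ico a (m + 1), unitExp (f n)‖ ≤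
        ‖∑ n ∈ Finset.Ico a (m + 1), unitExp (f n) + c m * unitExp (f (m + 1))‖ + ‖c m‖ := by
      have := norm_sub_le (∑ n ∈ Finset.Ico a (m + 1), unitExp (f n) +
        c m * unitExp (f (m + 1))) (c m * unitExp (f (m + 1)))
      rwa [add_sub_cancel_right, norm_mul, norm_unitExp, mul_one] at this
    have h7 : 1 / (2 * Δ) = (1 / Δ) / 2 := by field_simp
    have h8 : 1 / (4 * Δ) = (1 / Δ) / 4 := by field_simp
    have h9 : 2 ≤ 1 / Δ := by rw [le_div_iff₀ h0]; linarith
    have h10 : 2 / Δ = 2 * (1 / Δ) := by ring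
    rw [h7] at h4 h5
    rw [h8] at h2 h3
    linarith [h4.2, h5.1]

/-- The Kusmin--Landau inequality. -/
theorem kusmin_landau (f : ℕ → ℝ) (a b : ℕ) (k : ℤ) {Δ : ℝ} (h0 : 0 < Δ)
    (hmono : ∀ n, a ≤ n → n + 1 < b → f (n + 1) - f n ≤ f (n + 2) - f (n + 1))
    (hlow : ∀ n, a ≤ n → n < b → k + Δ ≤ f (n + 1) - f n)
    (hup : ∀ n, a ≤ n → n < b → f (n + 1) - f n ≤ k + 1 - Δ) :
    ‖∑ n ∈ Finset.Ico a b, unitExp (f n)‖ ≤ 2 / Δ := by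
  -- Subtracting `k n` leaves every `unitExp` unchanged and moves the differences into `[Δ, 1 - Δ]`.
  have := kusmin_landau_aux (fun n => f n - k * n) a b h0
    (fun n h1 h2 => by have := hmono n h1 h2; push_cast; linarith)
    (fun n h1 h2 => by have := hlow n h1 h2; push_cast; linarith)
    (fun n h1 h2 => by have := hup n h1 h2; push_cast; linarith)
  refine le_trans (le_of_eq ?_) this
  congr 1
  refine Finset.sum_congr rfl fun n _ => ?_
  have := unitExp_sub_int (f n) (k * n)
  push_cast at this
  exact this.symm

/-! ### Van der Corput's second derivative test -/

/-- The indices where a monotone sequence takes values in a given interval form such a set; this is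
how the ranges for the Kusmin–Landau inequality arise. -/
theorem Finset.exists_eq_Ico_of_ordConnected (s : Finset ℕ)
    (h : ∀ x ∈ s, ∀ y ∈ s, ∀ z, x ≤ z → z ≤ y → z ∈ s) : ∃ p q, s = Finset.Ico p q := by
  rcases s.eq_empty_or_nonempty with rfl | hs
  · exact ⟨0, 0, by simp⟩
  · refine ⟨s.min' hs, s.max' hs + 1, ?_⟩
    ext z
    rw [Finset.mem_Ico, Nat.lt_succ_iff]
    exact ⟨fun hz => ⟨s.min'_le z hz, s.le_max' z hz⟩,
      fun hz => h _ (s.min'_mem hs) _ (s.max'_mem hs) z hz.1 hz.2⟩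

/-- A set of integers on which a `lam`-expanding sequence takes values in an interval of
length `R` has at most `R / lam + 1` elements. -/
theorem card_le_of_expanding (s : Finset ℕ) (d : ℕ → ℝ) {lam u R : ℝ} (hlam : 0 < lam)
    (hR : 0 ≤ R) (hexp : ∀ m ∈ s, ∀ n ∈ s, m ≤ n → lam * ((n : ℝ) - m) ≤ d n - d m)
    (hu : ∀ n ∈ s, u ≤ d n) (hv : ∀ n ∈ s, d n ≤ u + R) : (s.card : ℝ) ≤ R / lam + 1 := by
  rcases s.eq_empty_or_nonempty with rfl | hs
  · simp only [Finset.card_empty, Nat.cast_zero]; positivity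
  · have hsub : s ⊆ Finset.Ico (s.min' hs) (s.max' hs + 1) := fun z hz => by
      rw [Finset.mem_Ico, Nat.lt_succ_iff]; exact ⟨s.min'_le z hz, s.le_max' z hz⟩
    have hle : s.min' hs ≤ s.max' hs := s.min'_le _ (s.max'_mem hs)
    have hc := Finset.card_le_card hsub
    rw [Nat.card_Ico] at hc
    have hc' : (s.card : ℝ) ≤ (s.max' hs : ℝ) + 1 - s.min' hs := by
      have : s.card + s.min' hs ≤ s.max' hs + 1 := by omega
      have : (s.card : ℝ) + s.min' hs ≤ s.max' hs + 1 := by exact_mod_cast this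
      linarith
    have h1 := hexp _ (s.min'_mem hs) _ (s.max'_mem hs) hle
    have h2 := hu _ (s.min'_mem hs)
    have h3 := hv _ (s.max'_mem hs)
    have : (s.max' hs : ℝ) - s.min' hs ≤ R / lam := by
      rw [le_div_iff₀ hlam]; linarith
    linarith

theorem norm_sum_unitExp_le_card {ι : Type*} (s : Finset ι) (f : ι → ℝ) :
    ‖∑ n ∈ s, unitExp (f n)‖ ≤ s.card := by
  refine (norm_sum_le _ _).trans ?_
  simp [norm_unitExp]

/-- Van der Corput's second derivative test for a sequence, in terms of second differences. -/
theorem vanDerCorput_seq (f : ℕ → ℝ) (a b : ℕ) {lam M : ℝ} (hab : a ≤ b) (hlam : 0 < lam)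
    (hM : 1 ≤ M)
    (hlow : ∀ n, a ≤ n → n + 2 < b → lam ≤ f (n + 2) - 2 * f (n + 1) + f n)
    (hup : ∀ n, a ≤ n → n + 2 < b → f (n + 2) - 2 * f (n + 1) + f n ≤ M * lam) :
    ‖∑ n ∈ Finset.Ico a b, unitExp (f n)‖ ≤ 9 * (M * lam * ((b : ℝ) - a) + 2) / √lam := by
  have hsq := Real.sqrt_pos.2 hlam
  have hss := Real.mul_self_sqrt hlam.le
  have hba : (0 : ℝ) ≤ (b : ℝ) - a := by
    have : (a : ℝ) ≤ b := by exact_mod_cast hab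
    linarith
  -- For large `lam` the trivial bound is already good enough.
  rcases lt_or_ge (1 / 4) lam with hbig | hsmall
  · refine (norm_sum_unitExp_le_card _ _).trans ?_
    rw [Nat.card_Ico, Nat.cast_sub hab, le_div_iff₀ hsq]
    have h1 : √lam ≤ 2 * lam := by nlinarith
    calc ((b : ℝ) - a) * √lam ≤ (b - a) * (2 * lam) := by gcongr
      _ = 1 * (2 * lam * (b - a)) := by ring
      _ ≤ M * (2 * lam * (b - a)) := by gcongr
      _ ≤ _ := by
        have : 0 ≤ M * lam * ((b : ℝ) - a) := by positivity
        linarith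
  rcases Nat.lt_or_ge b (a + 2) with hshort | hlong
  · refine (norm_sum_unitExp_le_card _ _).trans ?_
    rw [Nat.card_Ico, le_div_iff₀ hsq]
    have h1 : ((b - a : ℕ) : ℝ) ≤ 1 := by exact_mod_cast (by omega)
    have h2 : √lam ≤ 1 := by nlinarith
    have : 0 ≤ M * lam * ((b : ℝ) - a) := by positivity
    nlinarith
  -- The difference that starts at the last index involves a value of `f` outside the range, so that
  -- term is set apart and estimated by 1.
  obtain ⟨e, rfl⟩ : ∃ e, b = e + 1 := ⟨b - 1, by omega⟩
  -- The choice balances the Kusmin–Landau bound `2 / Δ` against the `Δ / lam + 1` indices whose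
  -- difference is within `Δ` of one given end.
  set Δ := √lam with hΔ
  have hΔ2 : Δ ≤ 1 / 2 := by nlinarith
  set d : ℕ → ℝ := fun n => f (n + 1) - f n with hd
  have hstep : ∀ n, a ≤ n → n + 1 < e → lam ≤ d (n + 1) - d n ∧ d (n + 1) - d n ≤ M * lam :=
    fun n h1 h2 => by
      have h3 := hlow n h1 (by omega)
      have h4 := hup n h1 (by omega)
      simp only [hd]
      constructor <;> linarith
  have hdiff : ∀ m n, a ≤ m → m ≤ n → n < e →
      lam * ((n : ℝ) - m) ≤ d n - d m ∧ d n - d m ≤ M * lam * ((n : ℝ) - m) := by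
    intro m n hm hmn
    induction n, hmn using Nat.le_induction with
    | base => intro _; simp
    | succ n hn ih =>
      intro h
      have h1 := ih (by omega)
      have h2 := hstep n (by omega) h
      push_cast
      constructor <;> linarith [h1.1, h1.2, h2.1, h2.2]
  have hdmono : ∀ m n, a ≤ m → m ≤ n → n < e → d m ≤ d n := fun m n hm hmn hn => by
    have h1 := (hdiff m n hm hmn hn).1
    have h2 : (0 : ℝ) ≤ (n : ℝ) - m := by
      have : (m : ℝ) ≤ n := by exact_mod_cast hmn
      linarith
    nlinarith [mul_nonneg hlam.le h2]
  set S := Finset.Ico a e with hS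
  have hmemS : ∀ n, n ∈ S ↔ a ≤ n ∧ n < e := fun n => Finset.mem_Ico
  -- The indices are grouped by the integer part of the difference. In one group, the two ends near
  -- an integer are counted by expansion, and the middle is an interval to which Kusmin–Landau
  -- applies.
  have hfib : ∀ k : ℤ, ‖∑ n ∈ S with ⌊d n⌋ = k, unitExp (f n)‖ ≤ 6 / Δ := by
    intro k
    set s := S.filter (fun n => ⌊d n⌋ = k) with hs
    have hexp : ∀ t : Finset ℕ, t ⊆ s → ∀ m ∈ t, ∀ n ∈ t, m ≤ n →
        lam * ((n : ℝ) - m) ≤ d n - d m := fun t ht m hm n hn hmn => by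
      have h1 := (hmemS m).1 (Finset.mem_filter.1 (ht hm)).1
      have h2 := (hmemS n).1 (Finset.mem_filter.1 (ht hn)).1
      exact (hdiff m n h1.1 hmn h2.2).1
    have hk : ∀ n ∈ s, (k : ℝ) ≤ d n ∧ d n ≤ k + 1 := fun n hn => by
      have := Int.floor_eq_iff.1 (Finset.mem_filter.1 hn).2
      exact ⟨this.1, this.2.le⟩
    have hone : 1 ≤ 1 / Δ / 2 := by
      rw [le_div_iff₀ (by norm_num), le_div_iff₀ hsq]; linarith
    have hdl : Δ / lam = 1 / Δ := by rw [← hss]; field_simp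
    have hshort : ∀ (P : ℕ → Prop) [DecidablePred P] (u : ℝ),
        (∀ n ∈ s, P n → u ≤ d n ∧ d n ≤ u + Δ) →
        ‖∑ n ∈ s with P n, unitExp (f n)‖ ≤ 1 / Δ + 1 := by
      intro P _ u hP
      refine (norm_sum_unitExp_le_card _ _).trans ?_
      rw [← hdl]
      exact card_le_of_expanding _ d (u := u) hlam hsq.le
        (hexp _ (Finset.filter_subset _ _))
        (fun n hn => (hP n (Finset.mem_filter.1 hn).1 (Finset.mem_filter.1 hn).2).1)
        (fun n hn => (hP n (Finset.mem_filter.1 hn).1 (Finset.mem_filter.1 hn).2).2)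
    have hmid : ‖∑ n ∈ (s.filter (fun n => ¬ d n < k + Δ)).filter
        (fun n => ¬ k + 1 - Δ < d n), unitExp (f n)‖ ≤ 2 / Δ := by
      set t := (s.filter (fun n => ¬ d n < k + Δ)).filter (fun n => ¬ k + 1 - Δ < d n) with ht
      have hmt : ∀ n, n ∈ t ↔ (a ≤ n ∧ n < e) ∧ (k + Δ ≤ d n ∧ d n ≤ k + 1 - Δ) := by
        intro n
        simp only [ht, hs, Finset.mem_filter, hmemS, not_lt]
        constructor
        · rintro ⟨⟨⟨h1, h2⟩, h3⟩, h4⟩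
          exact ⟨h1, h3, h4⟩
        · rintro ⟨h1, h3, h4⟩
          refine ⟨⟨⟨h1, Int.floor_eq_iff.2 ⟨by linarith, by linarith⟩⟩, h3⟩, h4⟩
      obtain ⟨p, q, hpq⟩ := t.exists_eq_Ico_of_ordConnected (fun x hx y hy z hxz hzy => by
        rw [hmt] at hx hy ⊢
        refine ⟨⟨by omega, by omega⟩, ?_, ?_⟩
        · exact hx.2.1.trans (hdmono x z hx.1.1 hxz (by omega))
        · exact (hdmono z y (by omega) hzy hy.1.2).trans hy.2.2)
      rw [hpq]
      have hin : ∀ n, p ≤ n → n < q → (a ≤ n ∧ n < e) ∧ (k + Δ ≤ d n ∧ d n ≤ k + 1 - Δ) :=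
        fun n h1 h2 => (hmt n).1 (hpq ▸ Finset.mem_Ico.2 ⟨h1, h2⟩)
      refine kusmin_landau f p q k hsq (fun n h1 h2 => ?_) (fun n h1 h2 => (hin n h1 h2).2.1)
        (fun n h1 h2 => (hin n h1 h2).2.2)
      have h3 := (hin n h1 (by omega)).1
      have h4 := (hin (n + 1) (by omega) h2).1
      exact hdmono n (n + 1) h3.1 (by omega) h4.2
    rw [← Finset.sum_filter_add_sum_filter_not s (fun n => d n < k + Δ),
      ← Finset.sum_filter_add_sum_filter_not (s.filter (fun n => ¬ d n < k + Δ))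
        (fun n => k + 1 - Δ < d n)]
    have h1 := hshort (fun n => d n < k + Δ) k (fun n hn h => ⟨(hk n hn).1, h.le⟩)
    have h2 : ‖∑ n ∈ (s.filter (fun n => ¬ d n < k + Δ)).filter
        (fun n => k + 1 - Δ < d n), unitExp (f n)‖ ≤ 1 / Δ + 1 := by
      rw [Finset.filter_filter]
      refine hshort _ (k + 1 - Δ) (fun n hn h => ⟨h.2.le, ?_⟩)
      linarith [(hk n hn).2]
    refine (norm_add_le _ _).trans ((add_le_add h1 ((norm_add_le _ _).trans
      (add_le_add h2 hmid))).trans ?_)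
    have e2 : 2 / Δ = 2 * (1 / Δ) := by ring
    have e6 : 6 / Δ = 6 * (1 / Δ) := by ring
    rw [e2, e6]
    linarith
  have hmaps : ∀ n ∈ S, ⌊d n⌋ ∈ Finset.Icc ⌊d a⌋ ⌊d (e - 1)⌋ := fun n hn => by
    have := (hmemS n).1 hn
    rw [Finset.mem_Icc]
    exact ⟨Int.floor_mono (hdmono a n le_rfl this.1 this.2),
      Int.floor_mono (hdmono n (e - 1) this.1 (by omega) (by omega))⟩
  -- The differences vary by at most `M * lam` times the length of the range, which bounds the
  -- number of groups.
  have hcard : ((Finset.Icc ⌊d a⌋ ⌊d (e - 1)⌋).card : ℝ) ≤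
      M * lam * ((e + 1 : ℕ) - (a : ℝ)) + 2 := by
    have h1 := (hdiff a (e - 1) le_rfl (by omega) (by omega)).2
    have h2 := Int.floor_le (d (e - 1))
    have h3 := Int.lt_floor_add_one (d a)
    have h4 : ⌊d a⌋ ≤ ⌊d (e - 1)⌋ := Int.floor_mono (hdmono a (e - 1) le_rfl (by omega) (by omega))
    have h5 : ((Finset.Icc ⌊d a⌋ ⌊d (e - 1)⌋).card : ℝ) = ⌊d (e - 1)⌋ + 1 - ⌊d a⌋ := by
      have : ((Finset.Icc ⌊d a⌋ ⌊d (e - 1)⌋).card : ℤ) = ⌊d (e - 1)⌋ + 1 - ⌊d a⌋ := by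
        rw [Int.card_Icc]; omega
      exact_mod_cast this
    have h6 : ((e - 1 : ℕ) : ℝ) = (e : ℝ) - 1 := by
      rw [Nat.cast_sub (by omega)]; simp
    rw [h6] at h1
    have h7 : M * lam * ((e : ℝ) - 1 - a) ≤ M * lam * ((e + 1 : ℕ) - (a : ℝ)) := by
      push_cast
      have : 0 ≤ M * lam := by positivity
      gcongr
      linarith
    linarith
  have hmain : ‖∑ n ∈ S, unitExp (f n)‖ ≤
      (M * lam * ((e + 1 : ℕ) - (a : ℝ)) + 2) * (6 / Δ) := by
    rw [← Finset.sum_fiberwise_of_maps_to hmaps]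
    refine (norm_sum_le_of_le _ (fun k _ => hfib k)).trans ?_
    rw [Finset.sum_const, nsmul_eq_mul]
    gcongr
  rw [Finset.sum_Ico_succ_top (by omega)]
  refine (norm_add_le _ _).trans ?_
  rw [norm_unitExp]
  have hX : 0 ≤ M * lam * ((e + 1 : ℕ) - (a : ℝ)) := by positivity
  have e1 : 9 * (M * lam * ((e + 1 : ℕ) - (a : ℝ)) + 2) / Δ =
      (M * lam * ((e + 1 : ℕ) - (a : ℝ)) + 2) * (6 / Δ) +
      3 * (M * lam * ((e + 1 : ℕ) - (a : ℝ)) + 2) / Δ := by ring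
  rw [e1]
  refine add_le_add hmain ?_
  rw [le_div_iff₀ hsq]
  nlinarith

/-- Van der Corput's second derivative test. -/
theorem vanDerCorput_secondDeriv (f f' f'' : ℝ → ℝ) (A B : ℕ) {lam M N : ℝ} (hlam : 0 < lam)
    (hM : 1 ≤ M) (hf : ∀ y ∈ Set.Icc (A + 1 : ℝ) B, HasDerivAt f (f' y) y)
    (hf' : ∀ y ∈ Set.Icc (A + 1 : ℝ) B, HasDerivAt f' (f'' y) y)
    (hlow : ∀ y ∈ Set.Icc (A + 1 : ℝ) B, lam ≤ f'' y)
    (hup : ∀ y ∈ Set.Icc (A + 1 : ℝ) B, f'' y ≤ M * lam) (hN0 : 0 ≤ N)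
    (hN : (B : ℝ) - A ≤ N) :
    ‖∑ n ∈ Finset.Ioc A B, unitExp (f n)‖ ≤ 9 * M * (N * √lam) + 18 / √lam := by
  have hsq := Real.sqrt_pos.2 hlam
  rcases Nat.lt_or_ge B A with h | h
  · rw [Finset.Ioc_eq_empty (by omega)]
    simp only [Finset.sum_empty, norm_zero]
    positivity
  -- Two applications of the mean value theorem: first to `y ↦ f (y + 1) - f y`, then to `f'`.
  have hsecond : ∀ n : ℕ, A + 1 ≤ n → n + 2 < B + 1 → ∃ η ∈ Set.Icc (A + 1 : ℝ) B,
      f (n + 2 : ℕ) - 2 * f (n + 1 : ℕ) + f (n : ℕ) = f'' η := by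
    intro n h1 h2
    have hn1 : (A + 1 : ℝ) ≤ n := by exact_mod_cast h1
    have hn2 : (n : ℝ) + 2 ≤ B := by exact_mod_cast (by omega : n + 2 ≤ B)
    have hd1 : ∀ y ∈ Set.Icc (n : ℝ) (n + 1),
        HasDerivAt (fun y => f (y + 1) - f y) (f' (y + 1) - f' y) y := fun y hy => by
      have e1 := (hf (y + 1) ⟨by linarith [hy.1], by linarith [hy.2]⟩).comp_add_const y 1
      exact e1.sub (hf y ⟨by linarith [hy.1], by linarith [hy.2]⟩)
    obtain ⟨ξ, hξ, hξe⟩ := exists_hasDerivAt_eq_slope (fun y => f (y + 1) - f y)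
      (fun y => f' (y + 1) - f' y) (a := (n : ℝ)) (b := n + 1) (by linarith)
      (fun y hy => (hd1 y hy).continuousAt.continuousWithinAt)
      (fun y hy => hd1 y ⟨hy.1.le, hy.2.le⟩)
    obtain ⟨η, hη, hηe⟩ := exists_hasDerivAt_eq_slope f' f'' (a := ξ) (b := ξ + 1) (by linarith)
      (fun y hy => (hf' y ⟨by linarith [hy.1, hξ.1], by linarith [hy.2, hξ.2]⟩).continuousAt.continuousWithinAt)
      (fun y hy => hf' y ⟨by linarith [hy.1, hξ.1], by linarith [hy.2, hξ.2]⟩)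
    refine ⟨η, ⟨by linarith [hη.1, hξ.1], by linarith [hη.2, hξ.2]⟩, ?_⟩
    have e1 : (ξ + 1) - ξ = 1 := by ring
    have e2 : ((n : ℝ) + 1) - n = 1 := by ring
    rw [hηe, e1, div_one, hξe, e2, div_one]
    push_cast
    rw [show (n : ℝ) + 1 + 1 = n + 2 by ring]
    ring
  have hI : Finset.Ioc A B = Finset.Ico (A + 1) (B + 1) := by
    ext n; simp only [Finset.mem_Ioc, Finset.mem_Ico]; omega
  rw [hI]
  refine (vanDerCorput_seq (fun n => f n) (A + 1) (B + 1) (by omega) hlam hM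
    (fun n h1 h2 => ?_) (fun n h1 h2 => ?_)).trans ?_
  · obtain ⟨η, hη, he⟩ := hsecond n h1 h2
    simp only [he]
    exact hlow η hη
  · obtain ⟨η, hη, he⟩ := hsecond n h1 h2
    simp only [he]
    exact hup η hη
  · have hs := Real.mul_self_sqrt hlam.le
    have e1 : ((B + 1 : ℕ) : ℝ) - (A + 1 : ℕ) = B - A := by push_cast; ring
    rw [e1, div_le_iff₀ hsq]
    have e2 : (9 * M * (N * √lam) + 18 / √lam) * √lam = 9 * (M * lam * N + 2) := by
      rw [add_mul, div_mul_cancel₀ _ hsq.ne']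
      linear_combination 9 * M * N * hs
    rw [e2]
    gcongr

/-! ### Sawtooth sums and exponential sums -/

/-- The sawtooth function `t - ⌊t⌋ - 1 / 2`. -/
noncomputable def sawtooth (t : ℝ) : ℝ := Int.fract t - 1 / 2

/-- The periodic antiderivative `B₂({t}) / 2` of the sawtooth function. -/
noncomputable def sawtoothPrim (t : ℝ) : ℝ := (Int.fract t ^ 2 - Int.fract t + 1 / 6) / 2

theorem abs_sawtooth_le (t : ℝ) : |sawtooth t| ≤ 1 / 2 := by
  have h1 := Int.fract_nonneg t
  have h2 := (Int.fract_lt_one t).le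
  rw [sawtooth, abs_le]
  constructor <;> linarith

theorem fract_add_cases {Δ : ℝ} (h0 : 0 < Δ) (h1 : Δ ≤ 1) (t : ℝ) :
    Int.fract (t + Δ) = Int.fract t + Δ ∨
      (Int.fract (t + Δ) = Int.fract t + Δ - 1 ∧ 0 ≤ Int.fract t + Δ - 1) := by
  have e := Int.floor_add_fract t
  have a := Int.fract_nonneg t
  have b := Int.fract_lt_one t
  rcases lt_or_ge (Int.fract t + Δ) 1 with h | h
  · left
    rw [Int.fract_eq_iff]
    exact ⟨by linarith, h, ⌊t⌋, by linarith⟩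
  · right
    refine ⟨?_, by linarith⟩
    rw [Int.fract_eq_iff]
    exact ⟨by linarith, by linarith, ⌊t⌋ + 1, by push_cast; linarith⟩

/-- The primitive has derivative `sawtooth`, which grows with slope 1 and jumps only downwards, so
on `[t, t + Δ]` it is at most `sawtooth t` plus the distance from `t`. The next lower bound is the
same fact on `[t - Δ, t]`. -/
theorem sawtoothPrim_diff_le {Δ : ℝ} (h0 : 0 < Δ) (h1 : Δ ≤ 1) (t : ℝ) :
    sawtoothPrim (t + Δ) - sawtoothPrim t ≤ Δ * (sawtooth t + Δ / 2) := by
  unfold sawtoothPrim sawtooth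
  rcases fract_add_cases h0 h1 t with h | ⟨h, h'⟩ <;> rw [h] <;> nlinarith

theorem le_sawtoothPrim_diff {Δ : ℝ} (h0 : 0 < Δ) (h1 : Δ ≤ 1) (t : ℝ) :
    Δ * (sawtooth t - Δ / 2) ≤ sawtoothPrim t - sawtoothPrim (t - Δ) := by
  have a := Int.fract_lt_one t
  have b := Int.fract_nonneg t
  have c := Int.fract_lt_one (t - Δ)
  unfold sawtoothPrim sawtooth
  rcases fract_add_cases h0 h1 (t - Δ) with h | ⟨h, h'⟩ <;> rw [sub_add_cancel] at h
  · have : Int.fract (t - Δ) = Int.fract t - Δ := by linarith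
    rw [this]; nlinarith
  · have : Int.fract (t - Δ) = Int.fract t - Δ + 1 := by linarith
    rw [this] at c ⊢; nlinarith

/-- Passing to the primitive is what makes the Fourier series absolutely convergent, so it can be
summed termwise against any weights. -/
theorem hasSum_sawtoothPrim (t : ℝ) :
    HasSum (fun n : ℕ => 1 / (2 * Real.pi ^ 2) * (1 / (n : ℝ) ^ 2 * (unitExp (n * t)).re))
      (sawtoothPrim t) := by
  have h := hasSum_one_div_nat_pow_mul_cos (k := 1) one_ne_zero (x := Int.fract t)
    ⟨Int.fract_nonneg t, (Int.fract_lt_one t).le⟩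
  have h2 := h.mul_left (1 / (2 * Real.pi ^ 2))
  convert! h2 using 1
  · funext n
    rw [unitExp_re]
    congr 2
    rw [show 2 * Real.pi * (n * t) = 2 * Real.pi * n * Int.fract t + (n * ⌊t⌋ : ℤ) * (2 * Real.pi) by
      push_cast
      linear_combination (-(2 * Real.pi * n)) * Int.floor_add_fract t]
    rw [Real.cos_add_int_mul_two_pi]
  · have hb : (Polynomial.map (algebraMap ℚ ℝ) (Polynomial.bernoulli (2 * 1))).eval (Int.fract t) =
        Int.fract t ^ 2 - Int.fract t + 1 / 6 := by
      rw [Polynomial.bernoulli_def]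
      simp [Finset.sum_range_succ, bernoulli]
      ring
    rw [hb, sawtoothPrim]
    have := Real.pi_pos
    simp
    field_simp

theorem norm_unitExp_sub_one_le (t : ℝ) : ‖unitExp t - 1‖ ≤ 2 * Real.pi * |t| := by
  have := Real.norm_exp_I_mul_ofReal_sub_one_le (x := 2 * Real.pi * t)
  rw [mul_comm Complex.I] at this
  refine this.trans ?_
  rw [Real.norm_eq_abs, abs_mul, abs_of_pos (by positivity)]

theorem norm_unitExp_sub_one_le_two (t : ℝ) : ‖unitExp t - 1‖ ≤ 2 := by
  refine (norm_sub_le _ _).trans ?_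
  rw [norm_unitExp]; norm_num

/-- A weighted sum of values of the periodic primitive, differenced with step `Δ`, in terms of
exponential sums bounded by `S`. -/
theorem abs_sum_sawtoothPrim_diff_le {ι : Type*} (s : Finset ι) (w : ι → ℝ) (f : ι → ℝ)
    {Δ : ℝ} (h0 : 0 < Δ) (S : ℕ → ℝ)
    (hS : ∀ h : ℕ, 1 ≤ h → ‖∑ i ∈ s, (w i : ℂ) * unitExp (h * f i)‖ ≤ S h)
    (hsum : Summable (fun h : ℕ => min (Δ / h) (1 / (h : ℝ) ^ 2) * S h)) :
    |∑ i ∈ s, w i * (sawtoothPrim (f i + Δ) - sawtoothPrim (f i))| ≤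
      ∑' h : ℕ, min (Δ / h) (1 / (h : ℝ) ^ 2) * S h := by
  have hpi := Real.pi_gt_three
  have h1 : HasSum (fun h : ℕ => ∑ i ∈ s, w i *
      (1 / (2 * Real.pi ^ 2) * (1 / (h : ℝ) ^ 2 * (unitExp (h * (f i + Δ))).re) -
        1 / (2 * Real.pi ^ 2) * (1 / (h : ℝ) ^ 2 * (unitExp (h * f i)).re)))
      (∑ i ∈ s, w i * (sawtoothPrim (f i + Δ) - sawtoothPrim (f i))) :=
    hasSum_sum fun i _ => ((hasSum_sawtoothPrim _).sub (hasSum_sawtoothPrim _)).mul_left _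
  have h2 : ∀ h : ℕ, ∑ i ∈ s, w i *
      (1 / (2 * Real.pi ^ 2) * (1 / (h : ℝ) ^ 2 * (unitExp (h * (f i + Δ))).re) -
        1 / (2 * Real.pi ^ 2) * (1 / (h : ℝ) ^ 2 * (unitExp (h * f i)).re)) =
      1 / (2 * Real.pi ^ 2) * (1 / (h : ℝ) ^ 2) *
        ((unitExp (h * Δ) - 1) * ∑ i ∈ s, (w i : ℂ) * unitExp (h * f i)).re := by
    intro h
    rw [Finset.mul_sum, Complex.re_sum, Finset.mul_sum]
    refine Finset.sum_congr rfl fun i _ => ?_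
    have : (unitExp (h * Δ) - 1) * ((w i : ℂ) * unitExp (h * f i)) =
        (w i : ℂ) * (unitExp (h * (f i + Δ)) - unitExp (h * f i)) := by
      rw [mul_add, unitExp_add]; ring
    rw [this, Complex.re_ofReal_mul, Complex.sub_re]
    ring
  simp_rw [h2] at h1
  have h3 : ∀ h : ℕ, ‖1 / (2 * Real.pi ^ 2) * (1 / (h : ℝ) ^ 2) *
        ((unitExp (h * Δ) - 1) * ∑ i ∈ s, (w i : ℂ) * unitExp (h * f i)).re‖ ≤
      min (Δ / h) (1 / (h : ℝ) ^ 2) * S h := by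
    intro h
    -- The frequency 0 drops out through `1 / 0 = 0`, in agreement with the zero mean of the
    -- primitive.
    rcases Nat.eq_zero_or_pos h with rfl | hpos
    · simp
    have hh : (0 : ℝ) < h := by exact_mod_cast hpos
    set Z := ∑ i ∈ s, (w i : ℂ) * unitExp (h * f i) with hZ
    have hZS := hS h hpos
    have hre : |((unitExp (h * Δ) - 1) * Z).re| ≤ ‖unitExp (h * Δ) - 1‖ * ‖Z‖ := by
      rw [← norm_mul]; exact Complex.abs_re_le_norm _
    rw [Real.norm_eq_abs, abs_mul, abs_of_nonneg (by positivity)]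
    calc _ ≤ 1 / (2 * Real.pi ^ 2) * (1 / (h : ℝ) ^ 2) * (‖unitExp (h * Δ) - 1‖ * ‖Z‖) := by
          gcongr
      _ = (1 / (2 * Real.pi ^ 2) * (1 / (h : ℝ) ^ 2) * ‖unitExp (h * Δ) - 1‖) * ‖Z‖ := by ring
      _ ≤ min (Δ / h) (1 / (h : ℝ) ^ 2) * S h := by
        -- The two entries of the minimum come from the two bounds for `unitExp (h * Δ) - 1`: linear
        -- for small `h * Δ`, and 2 always.
        refine mul_le_mul (le_min ?_ ?_) hZS (norm_nonneg _) (by positivity)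
        · have a1 := norm_unitExp_sub_one_le (h * Δ)
          rw [abs_of_pos (by positivity)] at a1
          calc _ ≤ 1 / (2 * Real.pi ^ 2) * (1 / (h : ℝ) ^ 2) * (2 * Real.pi * (h * Δ)) := by gcongr
            _ = (1 / Real.pi) * (Δ / h) := by field_simp
            _ ≤ 1 * (Δ / h) := by
              gcongr
              rw [div_le_one (by positivity)]; linarith
            _ = _ := one_mul _
        · have a1 := norm_unitExp_sub_one_le_two (h * Δ)
          calc _ ≤ 1 / (2 * Real.pi ^ 2) * (1 / (h : ℝ) ^ 2) * 2 := by gcongr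
            _ = (1 / Real.pi ^ 2) * (1 / (h : ℝ) ^ 2) := by field_simp
            _ ≤ 1 * (1 / (h : ℝ) ^ 2) := by
              gcongr
              rw [div_le_one (by positivity)]; nlinarith
            _ = _ := one_mul _
  rw [← h1.tsum_eq, ← Real.norm_eq_abs]
  exact tsum_of_norm_bounded hsum.hasSum h3

/-- Bound for a weighted sum of sawtooth values by exponential sums. -/
theorem abs_sum_sawtooth_le {ι : Type*} (s : Finset ι) (w : ι → ℝ) (f : ι → ℝ)
    (hw : ∀ i ∈ s, 0 ≤ w i) {Δ : ℝ} (h0 : 0 < Δ) (hΔ : Δ ≤ 1) (S : ℕ → ℝ)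
    (hS : ∀ h : ℕ, 1 ≤ h → ‖∑ i ∈ s, (w i : ℂ) * unitExp (h * f i)‖ ≤ S h)
    (hsum : Summable (fun h : ℕ => min (Δ / h) (1 / (h : ℝ) ^ 2) * S h)) :
    |∑ i ∈ s, w i * sawtooth (f i)| ≤
      Δ / 2 * ∑ i ∈ s, w i + Δ⁻¹ * ∑' h : ℕ, min (Δ / h) (1 / (h : ℝ) ^ 2) * S h := by
  -- Shifting the argument by `Δ` only multiplies the exponential sum by a number of modulus 1.
  have hS' : ∀ h : ℕ, 1 ≤ h → ‖∑ i ∈ s, (w i : ℂ) * unitExp (h * (f i - Δ))‖ ≤ S h := by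
    intro h hh
    have : ∑ i ∈ s, (w i : ℂ) * unitExp (h * (f i - Δ)) =
        (∑ i ∈ s, (w i : ℂ) * unitExp (h * f i)) * unitExp (-(h * Δ)) := by
      rw [Finset.sum_mul]
      refine Finset.sum_congr rfl fun i _ => ?_
      rw [mul_assoc, ← unitExp_add]; congr 2; ring
    rw [this, norm_mul, norm_unitExp, mul_one]
    exact hS h hh
  have h1 := (abs_le.1 (abs_sum_sawtoothPrim_diff_le s w f h0 S hS hsum)).1
  have h2 := (abs_le.1 (abs_sum_sawtoothPrim_diff_le s w (fun i => f i - Δ) h0 S hS' hsum)).2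
  simp only [sub_add_cancel] at h2
  set T := ∑' h : ℕ, min (Δ / h) (1 / (h : ℝ) ^ 2) * S h
  have h3 : ∑ i ∈ s, w i * (sawtoothPrim (f i + Δ) - sawtoothPrim (f i)) ≤
      Δ * (∑ i ∈ s, w i * sawtooth (f i) + Δ / 2 * ∑ i ∈ s, w i) := by
    rw [Finset.mul_sum, ← Finset.sum_add_distrib, Finset.mul_sum]
    refine Finset.sum_le_sum fun i hi => ?_
    have := mul_le_mul_of_nonneg_left (sawtoothPrim_diff_le h0 hΔ (f i)) (hw i hi)
    linarith
  have h4 : Δ * (∑ i ∈ s, w i * sawtooth (f i) - Δ / 2 * ∑ i ∈ s, w i) ≤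
      ∑ i ∈ s, w i * (sawtoothPrim (f i) - sawtoothPrim (f i - Δ)) := by
    rw [Finset.mul_sum, ← Finset.sum_sub_distrib, Finset.mul_sum]
    refine Finset.sum_le_sum fun i hi => ?_
    have := mul_le_mul_of_nonneg_left (le_sawtoothPrim_diff h0 hΔ (f i)) (hw i hi)
    linarith
  have e : Δ * (Δ⁻¹ * T) = T := by field_simp
  rw [abs_le]
  constructor
  · refine le_of_mul_le_mul_left ?_ h0
    nlinarith
  · refine le_of_mul_le_mul_left ?_ h0
    nlinarith

/-- The sawtooth bound when the exponential sums are at most `R (1 + (h / H) ^ (1/2))`. -/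
theorem abs_sum_sawtooth_le_of_forall {ε : ℝ} (hε : 0 < ε) (hε2 : ε ≤ 1 / 2) :
    ∃ C : ℝ, 0 < C ∧ ∀ {ι : Type} (s : Finset ι) (w : ι → ℝ) (f : ι → ℝ) (H R : ℝ),
      (∀ i ∈ s, 0 ≤ w i) → 1 ≤ H → 0 ≤ R →
      (∀ h : ℕ, 1 ≤ h → ‖∑ i ∈ s, (w i : ℂ) * unitExp (h * f i)‖ ≤
        R * (1 + ((h : ℝ) / H) ^ (1 / 2 : ℝ))) →
      |∑ i ∈ s, w i * sawtooth (f i)| ≤ H⁻¹ * ∑ i ∈ s, w i + C * R * H ^ ε := by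
  have hsm : Summable (fun h : ℕ => 1 / (h : ℝ) ^ (1 + ε)) :=
    Real.summable_one_div_nat_rpow.2 (by linarith)
  have hnn : 0 ≤ ∑' h : ℕ, 1 / (h : ℝ) ^ (1 + ε) := tsum_nonneg fun h => by positivity
  refine ⟨2 * (∑' h : ℕ, 1 / (h : ℝ) ^ (1 + ε)) + 1, by positivity, ?_⟩
  intro ι s w f H R hw hH hR hS
  have hH0 : 0 < H := by linarith
  have hkey : ∀ h : ℕ, min (H⁻¹ / h) (1 / (h : ℝ) ^ 2) * (R * (1 + ((h : ℝ) / H) ^ (1 / 2 : ℝ))) ≤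
      H⁻¹ * (2 * R * H ^ ε) * (1 / (h : ℝ) ^ (1 + ε)) := by
    intro h
    rcases Nat.eq_zero_or_pos h with rfl | hpos
    · simp only [Nat.cast_zero, div_zero, ne_eq, OfNat.ofNat_ne_zero, not_false_eq_true, zero_pow,
        min_self, zero_mul]
      positivity
    have hh : (0 : ℝ) < h := by exact_mod_cast hpos
    set r : ℝ := h / H with hr
    have hr0 : 0 < r := by positivity
    have e1 : min (H⁻¹ / h) (1 / (h : ℝ) ^ 2) = H⁻¹ * (1 / h) * min 1 (1 / r) := by
      rw [mul_min_of_nonneg _ _ (by positivity)]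
      congr 1
      · ring
      · rw [hr]; field_simp
    have e2 : H⁻¹ * (2 * R * H ^ ε) * (1 / (h : ℝ) ^ (1 + ε)) =
        H⁻¹ * (1 / h) * R * (2 * r ^ (-ε)) := by
      rw [hr, Real.div_rpow hh.le hH0.le, Real.rpow_add hh, Real.rpow_one, Real.rpow_neg hh.le,
        Real.rpow_neg hH0.le]
      field_simp
    -- For `r ≥ 1` the left side decays like `r ^ (-1/2)`, hence the restriction `ε ≤ 1 / 2`. The
    -- spare power `r ^ (-ε)` makes the series over `h` converge, at the price of `H ^ ε`.
    have e3 : min 1 (1 / r) * (1 + r ^ (1 / 2 : ℝ)) ≤ 2 * r ^ (-ε) := by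
      rcases le_total r 1 with h1 | h1
      · calc min 1 (1 / r) * (1 + r ^ (1 / 2 : ℝ)) ≤ 1 * (1 + 1) := by
              gcongr
              · exact min_le_left _ _
              · exact Real.rpow_le_one hr0.le h1 (by norm_num)
          _ ≤ _ := by
            have := Real.one_le_rpow_of_pos_of_le_one_of_nonpos hr0 h1 (z := -ε) (by linarith)
            linarith
      · calc min 1 (1 / r) * (1 + r ^ (1 / 2 : ℝ)) ≤
              r⁻¹ * (r ^ (1 / 2 : ℝ) + r ^ (1 / 2 : ℝ)) := by
              gcongr
              · rw [← one_div]; exact min_le_right _ _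
              · exact Real.one_le_rpow h1 (by norm_num)
          _ = 2 * r ^ (-1 + 1 / 2 : ℝ) := by
            rw [Real.rpow_add hr0, Real.rpow_neg_one]; ring
          _ ≤ _ := by
            gcongr
            linarith
    rw [e1, e2]
    calc _ = H⁻¹ * (1 / h) * R * (min 1 (1 / r) * (1 + r ^ (1 / 2 : ℝ))) := by ring
      _ ≤ _ := by gcongr
  have hsum2 := hsm.mul_left (H⁻¹ * (2 * R * H ^ ε))
  have hsum : Summable (fun h : ℕ => min (H⁻¹ / h) (1 / (h : ℝ) ^ 2) *
      (R * (1 + ((h : ℝ) / H) ^ (1 / 2 : ℝ)))) :=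
    Summable.of_nonneg_of_le (fun h => by positivity) hkey hsum2
  -- The smoothing step is `H⁻¹`: the two entries of the minimum then cross at `h = H`.
  have h1 := abs_sum_sawtooth_le s w f hw (inv_pos.2 hH0) (inv_le_one_of_one_le₀ hH) _ hS hsum
  have h2 := hsum.tsum_le_tsum hkey hsum2
  rw [tsum_mul_left] at h2
  set Z := ∑' h : ℕ, 1 / (h : ℝ) ^ (1 + ε)
  have hW : 0 ≤ ∑ i ∈ s, w i := Finset.sum_nonneg hw
  refine h1.trans (add_le_add ?_ ?_)
  · gcongr
    have := inv_pos.2 hH0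
    linarith
  · rw [inv_inv]
    calc _ ≤ H * (H⁻¹ * (2 * R * H ^ ε) * Z) := by gcongr
      _ = 2 * Z * R * H ^ ε := by field_simp
      _ ≤ _ := by
        gcongr
        linarith

/-! ### The divisor bound and Vaughan's identity -/

/-- Compare `∏ (a + 1)` with `∏ p ^ (a ε)` prime by prime. If `p ≥ 2 ^ (1/ε)` the factor on the left
is already the smaller one, since `a + 1 ≤ 2 ^ a`; each of the boundedly many smaller primes costs
at most a constant `c`. -/
theorem exists_card_divisors_le_rpow {ε : ℝ} (hε : 0 < ε) :
    ∃ C : ℝ, 1 ≤ C ∧ ∀ n : ℕ, n ≠ 0 → (n.divisors.card : ℝ) ≤ C * (n : ℝ) ^ ε := by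
  have hl2 := Real.log_pos one_lt_two
  set c : ℝ := 1 + 1 / (ε * Real.log 2) with hc
  have hc1 : 1 ≤ c := by
    have : 0 ≤ 1 / (ε * Real.log 2) := by positivity
    linarith
  set K : ℕ := ⌈(2 : ℝ) ^ (1 / ε)⌉₊ with hK
  refine ⟨c ^ K, one_le_pow₀ hc1, fun n hn => ?_⟩
  have hp : ∀ p ∈ n.primeFactors, ((n.factorization p + 1 : ℕ) : ℝ) ≤
      (if p < K then c else 1) * ((p : ℝ) ^ n.factorization p) ^ ε := by
    intro p hp
    have hpp := Nat.prime_of_mem_primeFactors hp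
    set a := n.factorization p
    have hp2 : (2 : ℝ) ≤ p := by exact_mod_cast hpp.two_le
    have hcomm : ((p : ℝ) ^ a) ^ ε = ((p : ℝ) ^ ε) ^ a := by
      rw [← Real.rpow_natCast, ← Real.rpow_natCast, ← Real.rpow_mul (by linarith),
        ← Real.rpow_mul (by linarith), mul_comm]
    push_cast
    split_ifs with h
    · have h1 : 1 + a * (ε * Real.log 2) ≤ ((p : ℝ) ^ a) ^ ε := by
        calc 1 + a * (ε * Real.log 2) ≤ Real.exp (a * (ε * Real.log 2)) := by
              linarith [Real.add_one_le_exp (a * (ε * Real.log 2))]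
          _ = ((2 : ℝ) ^ a) ^ ε := by
            rw [← Real.rpow_natCast, ← Real.rpow_mul (by norm_num),
              Real.rpow_def_of_pos (by norm_num)]
            ring_nf
          _ ≤ _ := by gcongr
      calc (a : ℝ) + 1 ≤ c * (1 + a * (ε * Real.log 2)) := by
            have e : c * (1 + a * (ε * Real.log 2)) =
                1 + 1 / (ε * Real.log 2) + a * (ε * Real.log 2) + a := by
              rw [hc]; field_simp; ring
            have : 0 ≤ 1 / (ε * Real.log 2) + a * (ε * Real.log 2) := by positivity
            linarith
        _ ≤ _ := by gcongr
    · rw [one_mul, hcomm]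
      have h1 : (2 : ℝ) ≤ (p : ℝ) ^ ε := by
        have h2 : (2 : ℝ) ^ (1 / ε) ≤ p :=
          (Nat.le_ceil _).trans (by exact_mod_cast (not_lt.1 h))
        calc (2 : ℝ) = ((2 : ℝ) ^ (1 / ε)) ^ ε := by
              rw [← Real.rpow_mul (by norm_num), one_div_mul_cancel hε.ne', Real.rpow_one]
          _ ≤ _ := by gcongr
      calc (a : ℝ) + 1 ≤ (2 : ℝ) ^ a := by
            exact_mod_cast Nat.lt_two_pow_self
        _ ≤ _ := by gcongr
  have hprod : ∏ p ∈ n.primeFactors, (if p < K then c else 1 : ℝ) ≤ c ^ K := by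
    rw [Finset.prod_ite, Finset.prod_const, Finset.prod_const_one, mul_one]
    refine pow_le_pow_right₀ hc1 ?_
    refine (Finset.card_le_card (t := Finset.range K) fun p hp => ?_).trans_eq
      (Finset.card_range K)
    exact Finset.mem_range.2 (Finset.mem_filter.1 hp).2
  have hn' : (n : ℝ) ^ ε = ∏ p ∈ n.primeFactors, ((p : ℝ) ^ n.factorization p) ^ ε := by
    rw [Real.finsetProd_rpow _ _ (fun p _ => by positivity)]
    congr 1
    conv_lhs => rw [← Nat.prod_factorization_pow_eq_self hn]
    rw [Finsupp.prod, Nat.support_factorization]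
    push_cast
    rfl
  rw [Nat.card_divisors hn, Nat.cast_prod, hn']
  refine (Finset.prod_le_prod (fun p _ => by positivity) hp).trans ?_
  rw [Finset.prod_mul_distrib]
  gcongr

section Vaughan

open ArithmeticFunction ArithmeticFunction.Moebius ArithmeticFunction.zeta

/-- The restriction of an arithmetic function to arguments at most `U`. -/
noncomputable def truncLE (f : ArithmeticFunction ℝ) (U : ℝ) : ArithmeticFunction ℝ :=
  ⟨fun n => if (n : ℝ) ≤ U then f n else 0, by simp⟩

theorem truncLE_apply (f : ArithmeticFunction ℝ) (U : ℝ) (n : ℕ) :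
    truncLE f U n = if (n : ℝ) ≤ U then f n else 0 := rfl

theorem sub_truncLE_apply (f : ArithmeticFunction ℝ) (U : ℝ) (n : ℕ) :
    (f - truncLE f U) n = if (n : ℝ) ≤ U then 0 else f n := by
  rw [sub_eq_add_neg, ArithmeticFunction.add_apply, ArithmeticFunction.neg_apply, truncLE_apply]
  split_ifs <;> simp

/-- The Möbius function with real values. -/
noncomputable abbrev moebiusReal : ArithmeticFunction ℝ := ((μ : ArithmeticFunction ℤ) : ArithmeticFunction ℝ)

/-- The constant function `1` with real values. -/
noncomputable abbrev zetaReal : ArithmeticFunction ℝ := ((ζ : ArithmeticFunction ℕ) : ArithmeticFunction ℝ)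

/-- Vaughan's identity. -/
theorem vaughan_identity (U V : ℝ) :
    Λ = truncLE Λ U + truncLE moebiusReal V * log
      - truncLE moebiusReal V * truncLE Λ U * zetaReal
      + (Λ - truncLE Λ U) * ((moebiusReal - truncLE moebiusReal V) * zetaReal) := by
  have h1 : Λ * zetaReal = log := vonMangoldt_mul_zeta
  have h2 : moebiusReal * zetaReal = 1 := coe_moebius_mul_coe_zeta
  rw [← h1]
  -- With `log = Λ * ζ`, every term containing the truncated Möbius function cancels; what is left
  -- is `(Λ - truncLE Λ U) * (μ * ζ - 1) = 0`.
  linear_combination (truncLE Λ U - Λ) * h2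

theorem abs_moebiusReal_le_one (n : ℕ) : |moebiusReal n| ≤ 1 := by
  have := abs_moebius_le_one (n := n)
  simp only [moebiusReal, intCoe_apply]
  exact_mod_cast this

theorem abs_truncLE_moebius_le_one (V : ℝ) (n : ℕ) : |truncLE moebiusReal V n| ≤ 1 := by
  rw [truncLE_apply]
  split_ifs
  · exact abs_moebiusReal_le_one n
  · simp

/-- The Möbius factor has modulus at most 1, and `Λ * ζ = log`. -/
theorem abs_moebius_mul_vonMangoldt_le (U V : ℝ) (d : ℕ) :
    |(truncLE moebiusReal V * truncLE Λ U) d| ≤ Real.log d := by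
  rw [ArithmeticFunction.mul_apply]
  refine (Finset.abs_sum_le_sum_abs _ _).trans ?_
  rw [← vonMangoldt_sum, ← Nat.sum_divisorsAntidiagonal' (f := fun _ j => Λ j)]
  refine Finset.sum_le_sum fun p _ => ?_
  rw [abs_mul]
  have h1 := abs_truncLE_moebius_le_one V p.1
  have h2 : |truncLE Λ U p.2| ≤ Λ p.2 := by
    rw [truncLE_apply]
    have := vonMangoldt_nonneg (n := p.2)
    split_ifs
    · rw [abs_of_nonneg this]
    · simp [this]
  calc _ ≤ 1 * Λ p.2 := by gcongr
    _ = _ := one_mul _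

theorem moebius_mul_vonMangoldt_eq_zero {U V : ℝ} {d : ℕ}
    (hd : V * U < d) : (truncLE moebiusReal V * truncLE Λ U) d = 0 := by
  rw [ArithmeticFunction.mul_apply]
  refine Finset.sum_eq_zero fun p hp => ?_
  rw [Nat.mem_divisorsAntidiagonal] at hp
  rw [truncLE_apply, truncLE_apply]
  split_ifs with h1 h2
  · exfalso
    have : (d : ℝ) = p.1 * p.2 := by rw [← hp.1]; push_cast; rfl
    have h3 : (p.1 : ℝ) * p.2 ≤ V * U := by gcongr; exact (Nat.cast_nonneg _).trans h1
    linarith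
  all_goals simp

theorem abs_moebius_tail_mul_zeta_le (V : ℝ) (m : ℕ) :
    |((moebiusReal - truncLE moebiusReal V) * zetaReal) m| ≤ m.divisors.card := by
  rw [mul_comm, zetaReal, coe_zeta_mul_apply]
  refine (Finset.abs_sum_le_sum_abs _ _).trans ?_
  rw [Finset.card_eq_sum_ones, Nat.cast_sum]
  refine Finset.sum_le_sum fun i _ => ?_
  rw [sub_truncLE_apply]
  split_ifs
  · simp
  · simpa using abs_moebiusReal_le_one i

/-- All divisors of such an `m` lie below the cut. This keeps the second variable of the type II
sums away from small values. -/
theorem moebius_tail_mul_zeta_eq_zero {V : ℝ} {m : ℕ} (hm : (m : ℝ) ≤ V) :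
    ((moebiusReal - truncLE moebiusReal V) * zetaReal) m = 0 := by
  rw [mul_comm, zetaReal, coe_zeta_mul_apply]
  refine Finset.sum_eq_zero fun i hi => ?_
  rw [sub_truncLE_apply, if_pos]
  have : i ≤ m := Nat.divisor_le hi
  have : (i : ℝ) ≤ m := by exact_mod_cast this
  linarith

/-- A sum of a Dirichlet convolution against a weight supported on `[1, N]`, as a double sum. -/
theorem sum_mul_weight_eq (A B : ArithmeticFunction ℝ) (N : ℕ) (F : ℕ → ℂ)
    (hF : ∀ n, N < n → F n = 0) :
    ∑ n ∈ Finset.Ioc 0 N, ((A * B) n : ℂ) * F n =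
      ∑ l ∈ Finset.Ioc 0 N, ∑ m ∈ Finset.Ioc 0 N, (A l : ℂ) * (B m : ℂ) * F (l * m) := by
  rw [← Finset.sum_product']
  have h1 : ∀ n ∈ Finset.Ioc 0 N, ((A * B) n : ℂ) * F n =
      ∑ x ∈ Finset.Ioc 0 N ×ˢ Finset.Ioc 0 N with x.1 * x.2 = n,
        (A x.1 : ℂ) * (B x.2 : ℂ) * F (x.1 * x.2) := by
    intro n hn
    rw [Finset.mem_Ioc] at hn
    rw [ArithmeticFunction.mul_apply, Nat.divisorsAntidiagonal_eq_prod_filter_of_le hn.1.ne' hn.2]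
    push_cast
    rw [Finset.sum_mul]
    refine Finset.sum_congr rfl fun x hx => ?_
    rw [(Finset.mem_filter.1 hx).2]
  rw [Finset.sum_congr rfl h1]
  simp_rw [Finset.sum_filter]
  rw [Finset.sum_comm]
  refine Finset.sum_congr rfl fun x hx => ?_
  rw [Finset.mem_product, Finset.mem_Ioc, Finset.mem_Ioc] at hx
  rw [Finset.sum_ite_eq]
  split_ifs with h
  · rfl
  · rw [hF, mul_zero]
    rw [Finset.mem_Ioc, not_and_or] at h
    rcases h with h | h
    · exact absurd (Nat.mul_pos hx.1.1 hx.2.1) h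
    · omega

end Vaughan

/-! ### The phase and type I sums -/

/-- The phase `θ u - κ (u - β) ^ γ`. -/
noncomputable def psPhase (κ β γ θ u : ℝ) : ℝ := θ * u - κ * (u - β) ^ γ

theorem hasDerivAt_psPhase (κ β γ θ : ℝ) {u : ℝ} (hu : β < u) :
    HasDerivAt (psPhase κ β γ θ) (θ - κ * (γ * (u - β) ^ (γ - 1))) u := by
  have h1 : HasDerivAt (fun u : ℝ => (u - β) ^ γ) (1 * γ * (u - β) ^ (γ - 1)) u :=
    ((hasDerivAt_id u).sub_const β).rpow_const (Or.inl (sub_pos.2 hu).ne')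
  have h2 := ((hasDerivAt_id u).const_mul θ).sub (h1.const_mul κ)
  convert! h2 using 1
  ring

theorem hasDerivAt_psPhase_deriv (κ β γ θ : ℝ) {u : ℝ} (hu : β < u) :
    HasDerivAt (fun u => θ - κ * (γ * (u - β) ^ (γ - 1)))
      (κ * (γ * (1 - γ)) * (u - β) ^ (γ - 2)) u := by
  have h1 : HasDerivAt (fun u : ℝ => (u - β) ^ (γ - 1))
      (1 * (γ - 1) * (u - β) ^ (γ - 1 - 1)) u :=
    ((hasDerivAt_id u).sub_const β).rpow_const (Or.inl (sub_pos.2 hu).ne')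
  have h2 := ((h1.const_mul γ).const_mul κ).const_sub θ
  convert! h2 using 1
  rw [show γ - 1 - 1 = γ - 2 by ring]
  ring

/-- The exponential `unitExp (G n)` cut off to `x / 2 < n ≤ x`. -/
noncomputable def dyadicExp (G : ℝ → ℝ) (x : ℝ) (n : ℕ) : ℂ :=
  if x / 2 < n ∧ (n : ℝ) ≤ x then unitExp (G n) else 0

theorem norm_dyadicExp_le (G : ℝ → ℝ) (x : ℝ) (n : ℕ) : ‖dyadicExp G x n‖ ≤ 1 := by
  unfold dyadicExp
  split_ifs
  · rw [norm_unitExp]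
  · simp

theorem dyadicExp_eq_zero (G : ℝ → ℝ) {x : ℝ} {n : ℕ} (h : x < n) : dyadicExp G x n = 0 := by
  unfold dyadicExp
  rw [if_neg]
  exact fun h' => absurd h'.2 (not_le.2 h)

/-- Partial summation with a monotone weight. -/
theorem norm_sum_monotone_mul_le (w : ℕ → ℝ) (z : ℕ → ℂ) (hw : Monotone w) (hw0 : 0 ≤ w 0)
    (A B : ℕ) {R : ℝ} (hR : ∀ C, C ≤ B → ‖∑ n ∈ Finset.Ioc A C, z n‖ ≤ R) :
    ‖∑ n ∈ Finset.Ioc A B, (w n : ℂ) * z n‖ ≤ 2 * w B * R := by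
  have hR0 : 0 ≤ R := (norm_nonneg _).trans (hR B le_rfl)
  rcases Nat.lt_or_ge B A with h | h
  · rw [Finset.Ioc_eq_empty (by omega)]
    rw [Finset.sum_empty, norm_zero]
    have := hw0.trans (hw (Nat.zero_le B))
    positivity
  have hA : 0 ≤ w A := hw0.trans (hw (Nat.zero_le A))
  -- Abel summation: the increments of `w` are nonnegative, so the error telescopes to `R * (w C - w
  -- A)`.
  have key : ∀ C, A ≤ C → C ≤ B →
      ‖∑ n ∈ Finset.Ioc A C, (w n : ℂ) * z n - w C * ∑ n ∈ Finset.Ioc A C, z n‖ ≤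
        R * (w C - w A) := by
    intro C hC
    induction C, hC using Nat.le_induction with
    | base => intro _; simp
    | succ C hC ih =>
      intro hCB
      have ih := ih (by omega)
      rw [Finset.sum_Ioc_succ_top (by omega), Finset.sum_Ioc_succ_top (by omega)]
      have e : ∑ n ∈ Finset.Ioc A C, (w n : ℂ) * z n + w (C + 1) * z (C + 1) -
          w (C + 1) * (∑ n ∈ Finset.Ioc A C, z n + z (C + 1)) =
          (∑ n ∈ Finset.Ioc A C, (w n : ℂ) * z n - w C * ∑ n ∈ Finset.Ioc A C, z n) -
          ((w (C + 1) - w C : ℝ) : ℂ) * ∑ n ∈ Finset.Ioc A C, z n := by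
        push_cast; ring
      rw [e]
      refine (norm_sub_le _ _).trans ?_
      have h1 : 0 ≤ w (C + 1) - w C := sub_nonneg.2 (hw (Nat.le_succ C))
      rw [norm_mul, Complex.norm_real, Real.norm_eq_abs, abs_of_nonneg h1]
      have h2 := mul_le_mul_of_nonneg_left (hR C (by omega)) h1
      linarith
  have h1 := key B h le_rfl
  have hB : 0 ≤ w B := hA.trans (hw h)
  have h2 : ‖(w B : ℂ) * ∑ n ∈ Finset.Ioc A B, z n‖ ≤ w B * R := by
    rw [norm_mul, Complex.norm_real, Real.norm_eq_abs, abs_of_nonneg hB]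
    exact mul_le_mul_of_nonneg_left (hR B le_rfl) hB
  have h3 := norm_sub_norm_le (∑ n ∈ Finset.Ioc A B, (w n : ℂ) * z n)
    (w B * ∑ n ∈ Finset.Ioc A B, z n)
  nlinarith [mul_nonneg hR0 hA]

/-- The condition `8 * |β| ≤ x` keeps `u - β` between `x / 4` and `2 * x`, so the shift by `β` costs
only constants. -/
theorem rpow_dyadic_bounds {γ β x u : ℝ} (hγ0 : 0 < γ) (hγ1 : γ < 1) (hx : 0 < x)
    (hβ : 8 * |β| ≤ x) (hu1 : x / 2 ≤ u) (hu2 : u ≤ x) :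
    x ^ (γ - 2) / 4 ≤ (u - β) ^ (γ - 2) ∧ (u - β) ^ (γ - 2) ≤ 16 * x ^ (γ - 2) := by
  have hb := abs_le.1 (show |β| ≤ x / 8 by linarith)
  have e2 : (2 : ℝ) ^ (γ - 2) ≥ 1 / 4 := by
    calc (1 / 4 : ℝ) = 2 ^ (-2 : ℝ) := by norm_num [Real.rpow_neg]
      _ ≤ _ := Real.rpow_le_rpow_of_exponent_le (by norm_num) (by linarith)
  have e4 : (1 / 4 : ℝ) ^ (γ - 2) ≤ 16 := by
    calc (1 / 4 : ℝ) ^ (γ - 2) ≤ (1 / 4 : ℝ) ^ (-2 : ℝ) :=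
          Real.rpow_le_rpow_of_exponent_ge (by norm_num) (by norm_num) (by linarith)
      _ = 16 := by rw [Real.rpow_neg (by norm_num)]; norm_num
  have hxp : 0 < x ^ (γ - 2) := by positivity
  constructor
  · calc x ^ (γ - 2) / 4 ≤ 2 ^ (γ - 2) * x ^ (γ - 2) := by nlinarith
      _ = (2 * x) ^ (γ - 2) := (Real.mul_rpow (by norm_num) hx.le).symm
      _ ≤ _ := Real.rpow_le_rpow_of_nonpos (by linarith) (by linarith) (by linarith)
  · calc (u - β) ^ (γ - 2) ≤ (1 / 4 * x) ^ (γ - 2) :=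
          Real.rpow_le_rpow_of_nonpos (by linarith) (by linarith) (by linarith)
      _ = (1 / 4) ^ (γ - 2) * x ^ (γ - 2) := Real.mul_rpow (by norm_num) hx.le
      _ ≤ _ := by gcongr

/-- The exponential sum over one progression `d ∣ n`. -/
theorem norm_sum_unitExp_psPhase_le {γ β κ θ x : ℝ} (hγ0 : 0 < γ) (hγ1 : γ < 1) (hκ : 0 < κ)
    (hx : 0 < x) (hβ : 8 * |β| ≤ x) (d : ℕ) (hd : 1 ≤ d) (A B : ℕ)
    (hAB : ∀ l : ℕ, A < l → l ≤ B → x / 2 < d * l ∧ (d : ℝ) * l ≤ x) :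
    ‖∑ l ∈ Finset.Ioc A B, unitExp (psPhase κ β γ θ (d * l))‖ ≤
      600 / √(γ * (1 - γ)) * (√κ * x ^ (γ / 2) + x ^ (1 - γ / 2) / √κ) := by
  have hc0 : 0 < γ * (1 - γ) := mul_pos hγ0 (by linarith)
  have hc1 : γ * (1 - γ) ≤ 1 := by nlinarith
  set c := γ * (1 - γ) with hc
  have hsc := Real.sqrt_pos.2 hc0
  have hsc1 : √c ≤ 1 := Real.sqrt_le_one.2 hc1
  have hsκ := Real.sqrt_pos.2 hκ
  rcases Nat.lt_or_ge A B with hlt | hge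
  swap
  · rw [Finset.Ioc_eq_empty (by omega)]
    simp only [Finset.sum_empty, norm_zero]
    positivity
  have hd0 : (0 : ℝ) < d := by exact_mod_cast hd
  have hd1 : (1 : ℝ) ≤ d := by exact_mod_cast hd
  have hb := abs_le.1 (show |β| ≤ x / 8 by linarith)
  have hend1 := (hAB (A + 1) (by omega) (by omega)).1
  have hend2 := (hAB B hlt le_rfl).2
  push_cast at hend1
  have hu : ∀ y ∈ Set.Icc (A + 1 : ℝ) B, x / 2 ≤ d * y ∧ d * y ≤ x := fun y hy =>
    ⟨by nlinarith [hy.1], by nlinarith [hy.2]⟩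
  set lam := κ * c * (d : ℝ) ^ 2 * x ^ (γ - 2) / 4 with hlam
  have hlam0 : 0 < lam := by positivity
  have hN : (B : ℝ) - A ≤ x / d := by
    rw [le_div_iff₀ hd0]
    have : (0 : ℝ) ≤ A := Nat.cast_nonneg A
    nlinarith
  have hsx : √(x ^ (γ - 2)) = x ^ (γ / 2) / x := by
    rw [Real.sqrt_eq_rpow, ← Real.rpow_mul hx.le, show (γ - 2) * (1 / 2) = γ / 2 - 1 by ring,
      Real.rpow_sub_one hx.ne']
  have hsl : √lam = √κ * √c * d * (x ^ (γ / 2) / x) / 2 := by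
    rw [hlam, Real.sqrt_div' _ (by norm_num), Real.sqrt_mul (by positivity), hsx,
      Real.sqrt_mul (by positivity), Real.sqrt_mul hκ.le, Real.sqrt_sq hd0.le,
      show (4 : ℝ) = 2 ^ 2 by norm_num, Real.sqrt_sq (by norm_num)]
  have hxg : 0 < x ^ (γ / 2) := by positivity
  -- The linear term `θ` has disappeared from the second derivative. The ratio `64 = 16 * 4` is that
  -- of the two bounds in `rpow_dyadic_bounds`.
  have key := vanDerCorput_secondDeriv (fun y => psPhase κ β γ θ (d * y))
    (fun y => d * (θ - κ * (γ * (d * y - β) ^ (γ - 1))))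
    (fun y => (d : ℝ) ^ 2 * (κ * c * (d * y - β) ^ (γ - 2))) A B (M := 64) (N := x / d)
    hlam0 (by norm_num)
    (fun y hy => by
      have h1 := (hasDerivAt_psPhase κ β γ θ (u := d * y) (by linarith [(hu y hy).1])).comp y
        ((hasDerivAt_id y).const_mul (d : ℝ))
      convert! h1 using 1
      ring)
    (fun y hy => by
      have h1 := ((hasDerivAt_psPhase_deriv κ β γ θ (u := d * y)
        (by linarith [(hu y hy).1])).comp y ((hasDerivAt_id y).const_mul (d : ℝ))).const_mul (d : ℝ)
      convert! h1 using 1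
      ring)
    (fun y hy => by
      have h1 := (rpow_dyadic_bounds hγ0 hγ1 hx hβ (hu y hy).1 (hu y hy).2).1
      calc lam = (d : ℝ) ^ 2 * (κ * c * (x ^ (γ - 2) / 4)) := by rw [hlam]; ring
        _ ≤ _ := by gcongr)
    (fun y hy => by
      have h1 := (rpow_dyadic_bounds hγ0 hγ1 hx hβ (hu y hy).1 (hu y hy).2).2
      calc (d : ℝ) ^ 2 * (κ * c * (d * y - β) ^ (γ - 2)) ≤
          (d : ℝ) ^ 2 * (κ * c * (16 * x ^ (γ - 2))) := by gcongr
        _ = _ := by rw [hlam]; ring)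
    (by positivity) hN
  refine key.trans ?_
  have e1 : x / d * √lam = √κ * √c * x ^ (γ / 2) / 2 := by
    rw [hsl]; field_simp
  have e2 : 18 / √lam = 36 / (√c * d) * (x ^ (1 - γ / 2) / √κ) := by
    rw [hsl, Real.rpow_sub hx, Real.rpow_one]; field_simp; norm_num
  rw [e1, e2, mul_add]
  refine add_le_add ?_ ?_
  · calc 9 * 64 * (√κ * √c * x ^ (γ / 2) / 2) = (288 * √c) * (√κ * x ^ (γ / 2)) := by ring
      _ ≤ _ := by
        gcongr
        rw [le_div_iff₀ hsc]
        nlinarith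
  · gcongr
    · norm_num
    · nlinarith

theorem sum_Ioc_ite_eq {A B N : ℕ} (P : ℕ → Prop) [DecidablePred P] (g : ℕ → ℂ)
    (h : ∀ m, (0 < m ∧ m ≤ N ∧ P m) ↔ (A < m ∧ m ≤ B)) :
    ∑ m ∈ Finset.Ioc 0 N, (if P m then g m else 0) = ∑ m ∈ Finset.Ioc A B, g m := by
  rw [← Finset.sum_filter]
  refine Finset.sum_congr ?_ fun _ _ => rfl
  ext m
  rw [Finset.mem_filter, Finset.mem_Ioc, Finset.mem_Ioc, ← h m, and_assoc]

/-- Type I sums. -/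
theorem norm_typeI_le {γ β κ θ x : ℝ} (hγ0 : 0 < γ) (hγ1 : γ < 1) (hκ : 0 < κ)
    (hx : 0 < x) (hβ : 8 * |β| ≤ x) (c : ℕ → ℝ) (w : ℕ → ℝ) (hw : Monotone w) (hw0 : 0 ≤ w 0)
    {D L W : ℝ} (hD : 0 ≤ D) (hL : 0 ≤ L) (hcD : ∀ d : ℕ, D < d → c d = 0)
    (hcL : ∀ d ∈ Finset.Ioc 0 ⌊x⌋₊, |c d| ≤ L) (hW : w ⌊x⌋₊ ≤ W) :
    ‖∑ d ∈ Finset.Ioc 0 ⌊x⌋₊, ∑ m ∈ Finset.Ioc 0 ⌊x⌋₊,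
        (c d : ℂ) * (w m : ℂ) * dyadicExp (psPhase κ β γ θ) x (d * m)‖ ≤
      D * L * W * (1200 / √(γ * (1 - γ)) * (√κ * x ^ (γ / 2) + x ^ (1 - γ / 2) / √κ)) := by
  have hc0 : 0 < γ * (1 - γ) := mul_pos hγ0 (by linarith)
  have hsc := Real.sqrt_pos.2 hc0
  have hsκ := Real.sqrt_pos.2 hκ
  set R := 600 / √(γ * (1 - γ)) * (√κ * x ^ (γ / 2) + x ^ (1 - γ / 2) / √κ) with hR
  have hR0 : 0 ≤ R := by positivity
  have hW0 : 0 ≤ W := (hw0.trans (hw (Nat.zero_le _))).trans hW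
  have hinner : ∀ d ∈ Finset.Ioc 0 ⌊x⌋₊, ‖∑ m ∈ Finset.Ioc 0 ⌊x⌋₊,
      (w m : ℂ) * dyadicExp (psPhase κ β γ θ) x (d * m)‖ ≤ 2 * W * R := by
    intro d hd
    rw [Finset.mem_Ioc] at hd
    have hd0 : (0 : ℝ) < d := by exact_mod_cast hd.1
    have hd1 : (1 : ℝ) ≤ d := by exact_mod_cast hd.1
    have hiff : ∀ m : ℕ, (⌊x / (2 * d)⌋₊ < m ∧ m ≤ ⌊x / d⌋₊) ↔
        (x / 2 < d * m ∧ (d : ℝ) * m ≤ x) := fun m => by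
      rw [Nat.floor_lt (by positivity), Nat.le_floor_iff (by positivity),
        div_lt_iff₀ (by positivity), le_div_iff₀ hd0, div_lt_iff₀ (by norm_num)]
      constructor <;> rintro ⟨h1, h2⟩ <;> constructor <;> linarith
    have e : ∑ m ∈ Finset.Ioc 0 ⌊x⌋₊, (w m : ℂ) * dyadicExp (psPhase κ β γ θ) x (d * m) =
        ∑ m ∈ Finset.Ioc ⌊x / (2 * d)⌋₊ ⌊x / d⌋₊,
          (w m : ℂ) * unitExp (psPhase κ β γ θ (d * m)) := by
      unfold dyadicExp
      simp_rw [mul_ite, mul_zero]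
      push_cast
      refine sum_Ioc_ite_eq _ _ fun m => ?_
      rw [hiff m]
      constructor
      · exact fun h => h.2.2
      · refine fun h => ⟨?_, ?_, h⟩
        · rcases Nat.eq_zero_or_pos m with rfl | hm
          · simp at h; linarith
          · exact hm
        · rw [Nat.le_floor_iff hx.le]
          have : (0 : ℝ) ≤ m := Nat.cast_nonneg m
          nlinarith [h.2]
    rw [e]
    refine (norm_sum_monotone_mul_le w _ hw hw0 _ _ (R := R) fun C hC => ?_).trans ?_
    · exact norm_sum_unitExp_psPhase_le hγ0 hγ1 hκ hx hβ d hd.1 _ _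
        fun l h1 h2 => (hiff l).1 ⟨h1, h2.trans hC⟩
    · gcongr
      refine (hw ?_).trans hW
      exact Nat.floor_mono (div_le_self hx.le hd1)
  have hterm : ∀ d ∈ Finset.Ioc 0 ⌊x⌋₊, ‖∑ m ∈ Finset.Ioc 0 ⌊x⌋₊,
      (c d : ℂ) * (w m : ℂ) * dyadicExp (psPhase κ β γ θ) x (d * m)‖ ≤
      if (d : ℝ) ≤ D then L * (2 * W * R) else 0 := by
    intro d hd
    simp_rw [mul_assoc]
    rw [← Finset.mul_sum, norm_mul, Complex.norm_real, Real.norm_eq_abs]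
    split_ifs with h
    · exact mul_le_mul (hcL d hd) (by simpa only [mul_assoc] using hinner d hd)
        (norm_nonneg _) hL
    · rw [hcD d (not_le.1 h)]; simp
  refine (norm_sum_le_of_le _ hterm).trans ?_
  rw [← Finset.sum_filter, Finset.sum_const, nsmul_eq_mul]
  -- Only `d ≤ D` contribute, and the bound for one progression is uniform in `d`.
  have hcard : (((Finset.Ioc 0 ⌊x⌋₊).filter (fun d : ℕ => (d : ℝ) ≤ D)).card : ℝ) ≤ D := by
    have : (Finset.Ioc 0 ⌊x⌋₊).filter (fun d : ℕ => (d : ℝ) ≤ D) ⊆ Finset.Ioc 0 ⌊D⌋₊ := by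
      intro d hd
      rw [Finset.mem_filter, Finset.mem_Ioc] at hd
      rw [Finset.mem_Ioc]
      exact ⟨hd.1.1, Nat.le_floor hd.2⟩
    have h1 := Finset.card_le_card this
    rw [Nat.card_Ioc, Nat.sub_zero] at h1
    calc _ ≤ (⌊D⌋₊ : ℝ) := by exact_mod_cast h1
      _ ≤ D := Nat.floor_le hD
  calc _ ≤ D * (L * (2 * W * R)) := by gcongr
    _ = _ := by rw [hR]; ring

/-! ### Type II sums -/

/-- With `Ψ u = u ^ 2 * (u - β) ^ (γ - 2)`, the second derivative in `y` of `psPhase` at `l * y` is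
`κ γ (1 - γ) Ψ (l * y) / y ^ 2`. For two rows the difference of these is controlled by the mean
value theorem for `Ψ`. -/
theorem hasDerivAt_sq_mul_rpow {β γ u : ℝ} (hu : β < u) :
    HasDerivAt (fun u : ℝ => u ^ 2 * (u - β) ^ (γ - 2))
      (u * (u - β) ^ (γ - 3) * (γ * u - 2 * β)) u := by
  have h0 : 0 < u - β := sub_pos.2 hu
  have h1 : HasDerivAt (fun u : ℝ => (u - β) ^ (γ - 2))
      (1 * (γ - 2) * (u - β) ^ (γ - 2 - 1)) u :=
    ((hasDerivAt_id u).sub_const β).rpow_const (Or.inl h0.ne')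
  have h2 := (hasDerivAt_pow 2 u).mul h1
  convert! h2 using 1
  have e : (u - β) ^ (γ - 2) = (u - β) ^ (γ - 3) * (u - β) := by
    rw [← Real.rpow_add_one h0.ne']; ring_nf
  rw [e, show γ - 2 - 1 = γ - 3 by ring]
  push_cast
  ring

/-- Here `|β| ≤ u / 4`, so for `γ` close to 1 the factor `γ * u - 2 * β` is positive and comparable
to `u`; the derivative therefore has one sign and size `x ^ (γ - 1)`. -/
theorem sq_mul_rpow_deriv_bounds {β γ x u : ℝ} (hγ0 : 11 / 12 ≤ γ) (hγ1 : γ < 1) (hx : 0 < x)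
    (hβ : 8 * |β| ≤ x) (hu1 : x / 2 ≤ u) (hu2 : u ≤ x) :
    x ^ (γ - 1) / 32 ≤ u * (u - β) ^ (γ - 3) * (γ * u - 2 * β) ∧
      u * (u - β) ^ (γ - 3) * (γ * u - 2 * β) ≤ 24 * x ^ (γ - 1) := by
  have hu0 : 0 < u := by linarith
  have hb := abs_le.1 (show |β| ≤ x / 8 by linarith)
  have e2 : (2 : ℝ) ^ (γ - 3) ≥ 1 / 8 := by
    calc (1 / 8 : ℝ) = 2 ^ (-3 : ℝ) := by norm_num [Real.rpow_neg]
      _ ≤ _ := Real.rpow_le_rpow_of_exponent_le (by norm_num) (by linarith)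
  have e4 : (1 / 2 : ℝ) ^ (γ - 3) ≤ 8 := by
    calc (1 / 2 : ℝ) ^ (γ - 3) ≤ (1 / 2 : ℝ) ^ (-3 : ℝ) :=
          Real.rpow_le_rpow_of_exponent_ge (by norm_num) (by norm_num) (by linarith)
      _ = 8 := by rw [Real.rpow_neg (by norm_num)]; norm_num
  have hup : 0 < u ^ (γ - 3) := by positivity
  have l1 : u ^ (γ - 3) / 8 ≤ (u - β) ^ (γ - 3) := by
    calc u ^ (γ - 3) / 8 ≤ 2 ^ (γ - 3) * u ^ (γ - 3) := by nlinarith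
      _ = (2 * u) ^ (γ - 3) := (Real.mul_rpow (by norm_num) hu0.le).symm
      _ ≤ _ := Real.rpow_le_rpow_of_nonpos (by linarith) (by linarith) (by linarith)
  have l2 : (u - β) ^ (γ - 3) ≤ 8 * u ^ (γ - 3) := by
    calc (u - β) ^ (γ - 3) ≤ (1 / 2 * u) ^ (γ - 3) :=
          Real.rpow_le_rpow_of_nonpos (by linarith) (by linarith) (by linarith)
      _ = (1 / 2) ^ (γ - 3) * u ^ (γ - 3) := Real.mul_rpow (by norm_num) hu0.le
      _ ≤ _ := by gcongr
  have eu : u * u ^ (γ - 3) * u = u ^ (γ - 1) := by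
    rw [mul_comm u (u ^ (γ - 3)), ← Real.rpow_add_one hu0.ne', ← Real.rpow_add_one hu0.ne']
    ring_nf
  have x1 : x ^ (γ - 1) ≤ u ^ (γ - 1) :=
    Real.rpow_le_rpow_of_nonpos hu0 hu2 (by linarith)
  have x2 : u ^ (γ - 1) ≤ 2 * x ^ (γ - 1) := by
    calc u ^ (γ - 1) ≤ (1 / 2 * x) ^ (γ - 1) :=
          Real.rpow_le_rpow_of_nonpos (by linarith) (by linarith) (by linarith)
      _ = (1 / 2) ^ (γ - 1) * x ^ (γ - 1) := Real.mul_rpow (by norm_num) hx.le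
      _ ≤ _ := by
        gcongr
        calc (1 / 2 : ℝ) ^ (γ - 1) ≤ (1 / 2 : ℝ) ^ (-1 : ℝ) :=
              Real.rpow_le_rpow_of_exponent_ge (by norm_num) (by norm_num) (by linarith)
          _ = 2 := by rw [Real.rpow_neg_one]; norm_num
  have m1 : u / 4 ≤ γ * u - 2 * β := by nlinarith
  have m2 : γ * u - 2 * β ≤ 3 / 2 * u := by nlinarith
  constructor
  · calc x ^ (γ - 1) / 32 ≤ u ^ (γ - 1) / 32 := by gcongr
      _ = u * (u ^ (γ - 3) / 8) * (u / 4) := by rw [← eu]; ring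
      _ ≤ _ := mul_le_mul (mul_le_mul_of_nonneg_left l1 hu0.le) m1 (by positivity)
        (mul_nonneg hu0.le (le_trans (by positivity) l1))
  · calc _ ≤ u * (8 * u ^ (γ - 3)) * (3 / 2 * u) := by
          have hv : 0 ≤ (u - β) ^ (γ - 3) := le_trans (by positivity) l1
          exact mul_le_mul (mul_le_mul_of_nonneg_left l2 hu0.le) m2 (by linarith) (by positivity)
      _ = 12 * u ^ (γ - 1) := by rw [← eu]; ring
      _ ≤ _ := by linarith

set_option maxHeartbeats 1000000 in
/-- The correlation of two rows of the type II sum. -/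
theorem norm_sum_dyadicExp_mul_conj_le {γ β κ θ x : ℝ} (hγ0 : 11 / 12 ≤ γ) (hγ1 : γ < 1)
    (hκ : 0 < κ) (hx : 0 < x) (hβ : 8 * |β| ≤ x) {t Q l₁ l₂ N : ℕ} (ht : 1 ≤ t) (h1 : t ≤ l₁)
    (h12 : l₁ < l₂) (h2 : l₂ ≤ 2 * t) (hQ : l₂ ≤ l₁ + Q) (hN : x / t < N + 1) :
    ‖∑ m ∈ Finset.Ioc 0 N, dyadicExp (psPhase κ β γ θ) x (l₂ * m) *
        (starRingEnd ℂ) (dyadicExp (psPhase κ β γ θ) x (l₁ * m))‖ ≤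
      30000 / √(γ * (1 - γ)) * (√κ * √Q * x ^ (γ / 2) + x ^ (1 - γ / 2) / √κ) / √t := by
  have hc0 : 0 < γ * (1 - γ) := mul_pos (by linarith) (by linarith)
  have hc1 : γ * (1 - γ) ≤ 1 := by nlinarith
  set c := γ * (1 - γ) with hc
  have hsc := Real.sqrt_pos.2 hc0
  have hsc1 : √c ≤ 1 := Real.sqrt_le_one.2 hc1
  have hsκ := Real.sqrt_pos.2 hκ
  have ht0 : (0 : ℝ) < t := by exact_mod_cast ht
  have hst := Real.sqrt_pos.2 ht0
  have hl1 : (t : ℝ) ≤ l₁ := by exact_mod_cast h1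
  have hl12 : (l₁ : ℝ) < l₂ := by exact_mod_cast h12
  have hl2 : (l₂ : ℝ) ≤ 2 * t := by exact_mod_cast h2
  have hl10 : (0 : ℝ) < l₁ := by linarith
  have hl20 : (0 : ℝ) < l₂ := by linarith
  have hD1 : (1 : ℝ) ≤ (l₂ : ℝ) - l₁ := by
    have : (l₁ : ℝ) + 1 ≤ l₂ := by exact_mod_cast h12
    linarith
  have hDQ : (l₂ : ℝ) - l₁ ≤ Q := by
    have : (l₂ : ℝ) ≤ l₁ + Q := by exact_mod_cast hQ
    linarith
  set D : ℝ := (l₂ : ℝ) - l₁ with hD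
  have hb := abs_le.1 (show |β| ≤ x / 8 by linarith)
  set A := ⌊x / (2 * l₁)⌋₊ with hA
  set B := ⌊x / l₂⌋₊ with hB
  have hiff : ∀ m : ℕ, (A < m ∧ m ≤ B) ↔ (x / (2 * l₁) < m ∧ (m : ℝ) ≤ x / l₂) := fun m => by
    rw [hA, hB, Nat.floor_lt (by positivity), Nat.le_floor_iff (by positivity)]
  have e : ∑ m ∈ Finset.Ioc 0 N, dyadicExp (psPhase κ β γ θ) x (l₂ * m) *
        (starRingEnd ℂ) (dyadicExp (psPhase κ β γ θ) x (l₁ * m)) =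
      ∑ m ∈ Finset.Ioc A B,
        unitExp (psPhase κ β γ θ (l₂ * m) - psPhase κ β γ θ (l₁ * m)) := by
    -- Both cut-offs hold exactly for `x / (2 * l₁) < m ≤ x / l₂`, the other two conditions being
    -- implied by `l₁ < l₂`.
    rw [← sum_Ioc_ite_eq (A := A) (B := B) (N := N) (fun m : ℕ => (x / 2 < l₂ * m ∧ (l₂ : ℝ) * m ≤ x) ∧
      (x / 2 < l₁ * m ∧ (l₁ : ℝ) * m ≤ x))]
    · refine Finset.sum_congr rfl fun m _ => ?_
      unfold dyadicExp
      push_cast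
      rw [unitExp_sub]
      by_cases p1 : x / 2 < (l₂ : ℝ) * m ∧ (l₂ : ℝ) * m ≤ x
      · by_cases p2 : x / 2 < (l₁ : ℝ) * m ∧ (l₁ : ℝ) * m ≤ x
        · rw [if_pos p1, if_pos p2, if_pos ⟨p1, p2⟩]
        · rw [if_pos p1, if_neg p2, if_neg (fun h => p2 h.2)]; simp
      · rw [if_neg p1, zero_mul, if_neg (fun h => p1 h.1)]
    · intro m
      rw [hiff]
      have hm : (0 : ℝ) ≤ m := Nat.cast_nonneg m
      rw [div_lt_iff₀ (c := 2 * (l₁ : ℝ)) (by positivity), le_div_iff₀ hl20]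
      constructor
      · rintro ⟨_, _, ⟨_, q2⟩, q3, _⟩
        exact ⟨by linarith, by linarith⟩
      · rintro ⟨q1, q2⟩
        have q3 : x / 2 < l₁ * m := by linarith
        have q4 : (l₁ : ℝ) * m ≤ l₂ * m := by gcongr
        refine ⟨?_, ?_, ⟨by linarith, by linarith⟩, q3, by linarith⟩
        · rcases Nat.eq_zero_or_pos m with rfl | hm
          · simp at q1; linarith
          · exact hm
        · have q5 : (m : ℝ) ≤ x / t := by
            rw [le_div_iff₀ ht0]; nlinarith
          have : (m : ℝ) < N + 1 := by linarith
          exact Nat.lt_succ_iff.1 (by exact_mod_cast this)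
  rw [e]
  rcases Nat.lt_or_ge A B with hlt | hge
  swap
  · rw [Finset.Ioc_eq_empty (by omega)]
    simp only [Finset.sum_empty, norm_zero]
    positivity
  have hend1 := ((hiff (A + 1)).1 ⟨by omega, by omega⟩).1
  have hend2 := ((hiff B).1 ⟨hlt, le_rfl⟩).2
  push_cast at hend1
  rw [div_lt_iff₀ (by positivity)] at hend1
  rw [le_div_iff₀ hl20] at hend2
  have hy : ∀ y ∈ Set.Icc (A + 1 : ℝ) B, 0 < y ∧ x / 2 ≤ l₁ * y ∧ l₂ * y ≤ x := fun y hy => by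
    have hy0 : 0 < y := by
      have : (0 : ℝ) ≤ A := Nat.cast_nonneg A
      linarith [hy.1]
    refine ⟨hy0, ?_, ?_⟩
    · nlinarith [hy.1]
    · nlinarith [hy.2]
  have hu1 : ∀ y ∈ Set.Icc (A + 1 : ℝ) B, β < l₁ * y := fun y h => by linarith [(hy y h).2.1]
  have hle : ∀ y ∈ Set.Icc (A + 1 : ℝ) B, (l₁ : ℝ) * y < l₂ * y := fun y h => by
    have := (hy y h).1
    gcongr
  have hu2 : ∀ y ∈ Set.Icc (A + 1 : ℝ) B, β < l₂ * y := fun y h => by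
    linarith [hle y h, hu1 y h]
  set f'' : ℝ → ℝ := fun y => (l₂ : ℝ) ^ 2 * (κ * c * (l₂ * y - β) ^ (γ - 2)) -
    (l₁ : ℝ) ^ 2 * (κ * c * (l₁ * y - β) ^ (γ - 2)) with hf''
  -- The mean value theorem for `Ψ` between `l₁ * y` and `l₂ * y` gives second derivative of order
  -- `κ γ (1 - γ) D x ^ (γ - 1) / y`, and `y` is of order `x / t`.
  set lam := κ * c * D * t * (x ^ (γ - 1) / x) / 32 with hlam
  have hlam0 : 0 < lam := by positivity
  have hbd : ∀ y ∈ Set.Icc (A + 1 : ℝ) B, lam ≤ f'' y ∧ f'' y ≤ 3072 * lam := by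
    intro y hyy
    obtain ⟨hy0, hyl, hyu⟩ := hy y hyy
    have hlt' := hle y hyy
    obtain ⟨ξ, hξ, hξe⟩ := exists_hasDerivAt_eq_slope (fun u : ℝ => u ^ 2 * (u - β) ^ (γ - 2))
      (fun u => u * (u - β) ^ (γ - 3) * (γ * u - 2 * β)) hlt'
      (fun u hu => (hasDerivAt_sq_mul_rpow
        (by linarith [hu.1])).continuousAt.continuousWithinAt)
      (fun u hu => hasDerivAt_sq_mul_rpow (by linarith [hu.1]))
    have hΨ := sq_mul_rpow_deriv_bounds hγ0 hγ1 hx hβ (u := ξ) (by linarith [hξ.1])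
      (by linarith [hξ.2])
    have hyt : (t : ℝ) * y ≤ l₁ * y := by gcongr
    have hyt2 : (l₂ : ℝ) * y ≤ 2 * t * y := by gcongr
    have hDy : (l₂ : ℝ) * y - l₁ * y = D * y := by rw [hD]; ring
    have hDp : 0 < D * y := by positivity
    simp only [hDy] at hξe
    rw [eq_div_iff hDp.ne'] at hξe
    set ψ := ξ * (ξ - β) ^ (γ - 3) * (γ * ξ - 2 * β) with hψ
    have hfe : f'' y = κ * c * D * (ψ / y) := by
      rw [← mul_div_assoc, eq_div_iff hy0.ne']
      refine mul_right_cancel₀ hy0.ne' ?_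
      simp only [hf'']
      linear_combination (-(κ * c)) * hξe
    have hxg : 0 < x ^ (γ - 1) := by positivity
    have hψ0 : 0 < ψ := lt_of_lt_of_le (by positivity) hΨ.1
    rw [hfe]
    constructor
    · calc lam = κ * c * D * ((x ^ (γ - 1) / 32) / (x / t)) := by
            rw [hlam]; field_simp
        _ ≤ _ := by
          gcongr
          · exact hΨ.1
          · rw [le_div_iff₀ ht0]; linarith
    · calc κ * c * D * (ψ / y) ≤ κ * c * D * ((24 * x ^ (γ - 1)) / (x / (4 * t))) := by
            gcongr
            · exact hΨ.2
            · rw [div_le_iff₀ (by positivity)]; linarith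
        _ = 3072 * lam := by rw [hlam]; field_simp; norm_num
  have hBN : (B : ℝ) - A ≤ x / t := by
    rw [le_div_iff₀ ht0]
    have hA0 : (0 : ℝ) ≤ A := Nat.cast_nonneg A
    have hB0 : (0 : ℝ) ≤ B := Nat.cast_nonneg B
    have hBt : (B : ℝ) * t ≤ B * l₂ := by gcongr; linarith
    nlinarith [mul_nonneg hA0 ht0.le]
  have key := vanDerCorput_secondDeriv
    (fun y => psPhase κ β γ θ (l₂ * y) - psPhase κ β γ θ (l₁ * y))
    (fun y => l₂ * (θ - κ * (γ * (l₂ * y - β) ^ (γ - 1))) -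
      l₁ * (θ - κ * (γ * (l₁ * y - β) ^ (γ - 1)))) f'' A B (M := 3072) (N := x / t)
    hlam0 (by norm_num)
    (fun y hyy => by
      have a1 := (hasDerivAt_psPhase κ β γ θ (hu2 y hyy)).comp y
        ((hasDerivAt_id y).const_mul (l₂ : ℝ))
      have a2 := (hasDerivAt_psPhase κ β γ θ (hu1 y hyy)).comp y
        ((hasDerivAt_id y).const_mul (l₁ : ℝ))
      convert! a1.sub a2 using 1
      ring)
    (fun y hyy => by
      have a1 := ((hasDerivAt_psPhase_deriv κ β γ θ (hu2 y hyy)).comp y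
        ((hasDerivAt_id y).const_mul (l₂ : ℝ))).const_mul (l₂ : ℝ)
      have a2 := ((hasDerivAt_psPhase_deriv κ β γ θ (hu1 y hyy)).comp y
        ((hasDerivAt_id y).const_mul (l₁ : ℝ))).const_mul (l₁ : ℝ)
      convert! a1.sub a2 using 1
      simp only [hf'', hc]
      ring)
    (fun y hyy => (hbd y hyy).1) (fun y hyy => (hbd y hyy).2) (by positivity) hBN
  refine key.trans ?_
  have hsx : √(x ^ (γ - 1) / x) = x ^ (γ / 2) / x := by
    rw [← Real.rpow_sub_one hx.ne', Real.sqrt_eq_rpow, ← Real.rpow_mul hx.le,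
      show (γ - 1 - 1) * (1 / 2) = γ / 2 - 1 by ring, Real.rpow_sub_one hx.ne']
  have hxg : 0 < x ^ (γ / 2) := by positivity
  have hsD : 1 ≤ √D := Real.one_le_sqrt.2 hD1
  have hsDQ : √D ≤ √Q := Real.sqrt_le_sqrt hDQ
  have h32 : √(32 : ℝ) ≤ 6 := by
    rw [Real.sqrt_le_iff]; norm_num
  have h32' : 1 ≤ √(32 : ℝ) := Real.one_le_sqrt.2 (by norm_num)
  have htt := Real.mul_self_sqrt ht0.le
  have hsl : √lam = √κ * √c * √D * √t * (x ^ (γ / 2) / x) / √32 := by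
    rw [hlam, Real.sqrt_div' _ (by norm_num), Real.sqrt_mul (by positivity), hsx,
      Real.sqrt_mul (by positivity), Real.sqrt_mul (by positivity), Real.sqrt_mul hκ.le]
  have e1 : x / t * √lam = √κ * √c * √D * x ^ (γ / 2) / √t / √32 := by
    rw [hsl]
    nth_rewrite 1 [← htt]
    field_simp
  have e2 : 18 / √lam = 18 * √32 / (√c * √D) * (x ^ (1 - γ / 2) / √κ) / √t := by
    rw [hsl, Real.rpow_sub hx, Real.rpow_one]; field_simp
  rw [e1, e2, mul_add, add_div]
  refine add_le_add ?_ ?_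
  · calc 9 * 3072 * (√κ * √c * √D * x ^ (γ / 2) / √t / √32) =
          (27648 * √c / √32) * (√κ * √D * x ^ (γ / 2)) / √t := by ring
      _ ≤ (30000 / √c) * (√κ * √Q * x ^ (γ / 2)) / √t := by
        have h4 : 27648 * √c / √32 ≤ 30000 / √c := by
          rw [div_le_div_iff₀ (by positivity) hsc, mul_assoc]
          have : √c * √c ≤ 1 := mul_le_one₀ hsc1 hsc.le hsc1
          linarith
        gcongr
  · have h4 : 18 * √32 / (√c * √D) ≤ 30000 / √c := by
      rw [div_le_div_iff₀ (by positivity) hsc]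
      have h5 : √c * 1 ≤ √c * √D := by gcongr
      have h6 : 18 * √32 * √c ≤ 18 * 6 * √c := by gcongr
      linarith
    gcongr

/-- Duality step: a bilinear sum is controlled by the correlations of its rows. -/
theorem norm_bilinear_sq_le (s : Finset ℕ) (N : ℕ) (a b : ℕ → ℂ) (F : ℕ → ℕ → ℂ)
    {A B P R q : ℝ} (hA : ∀ l ∈ s, ‖a l‖ ≤ A) (hB : ∀ m ∈ Finset.Ioc 0 N, ‖b m‖ ≤ B)
    (hA0 : 0 ≤ A) (hcard : (s.card : ℝ) ≤ q) (hP : 0 ≤ P) (hR : 0 ≤ R)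
    (hdiag : ∀ l ∈ s, ‖∑ m ∈ Finset.Ioc 0 N, F l m * (starRingEnd ℂ) (F l m)‖ ≤ R)
    (hoff : ∀ l ∈ s, ∀ l' ∈ s, l ≠ l' →
      ‖∑ m ∈ Finset.Ioc 0 N, F l m * (starRingEnd ℂ) (F l' m)‖ ≤ P) :
    ‖∑ l ∈ s, ∑ m ∈ Finset.Ioc 0 N, a l * b m * F l m‖ ^ 2 ≤
      A ^ 2 * B ^ 2 * (N * (q * R + q ^ 2 * P)) := by
  have hq : 0 ≤ q := (Nat.cast_nonneg _).trans hcard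
  set T : ℕ → ℂ := fun m => ∑ l ∈ s, a l * F l m with hT
  have h1 : ∑ l ∈ s, ∑ m ∈ Finset.Ioc 0 N, a l * b m * F l m =
      ∑ m ∈ Finset.Ioc 0 N, b m * T m := by
    rw [Finset.sum_comm]
    refine Finset.sum_congr rfl fun m _ => ?_
    rw [hT, Finset.mul_sum]
    exact Finset.sum_congr rfl fun l _ => by ring
  have h2 : ‖∑ m ∈ Finset.Ioc 0 N, b m * T m‖ ≤ B * ∑ m ∈ Finset.Ioc 0 N, ‖T m‖ := by
    rw [Finset.mul_sum]
    refine norm_sum_le_of_le _ fun m hm => ?_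
    rw [norm_mul]
    gcongr
    exact hB m hm
  have h3 : (∑ m ∈ Finset.Ioc 0 N, ‖T m‖) ^ 2 ≤ N * ∑ m ∈ Finset.Ioc 0 N, ‖T m‖ ^ 2 := by
    have := sq_sum_le_card_mul_sum_sq (s := Finset.Ioc 0 N) (f := fun m => ‖T m‖)
    rwa [Nat.card_Ioc, Nat.sub_zero] at this
  -- Opening the square and summing over `m` first leaves the correlations of rows.
  have h4 : ((∑ m ∈ Finset.Ioc 0 N, ‖T m‖ ^ 2 : ℝ) : ℂ) =
      ∑ l ∈ s, ∑ l' ∈ s, a l * (starRingEnd ℂ) (a l') *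
        ∑ m ∈ Finset.Ioc 0 N, F l m * (starRingEnd ℂ) (F l' m) := by
    push_cast
    have : ∀ m, ((‖T m‖ : ℂ)) ^ 2 = ∑ l ∈ s, ∑ l' ∈ s, a l * (starRingEnd ℂ) (a l') *
        (F l m * (starRingEnd ℂ) (F l' m)) := by
      intro m
      rw [← Complex.mul_conj', hT, map_sum, Finset.sum_mul_sum]
      refine Finset.sum_congr rfl fun l _ => Finset.sum_congr rfl fun l' _ => ?_
      rw [map_mul]; ring
    simp_rw [this]
    rw [Finset.sum_comm]
    refine Finset.sum_congr rfl fun l _ => ?_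
    rw [Finset.sum_comm]
    refine Finset.sum_congr rfl fun l' _ => ?_
    rw [Finset.mul_sum]
  have h5 : ∑ m ∈ Finset.Ioc 0 N, ‖T m‖ ^ 2 ≤ A ^ 2 * (q * R + q ^ 2 * P) := by
    have e : ∑ m ∈ Finset.Ioc 0 N, ‖T m‖ ^ 2 =
        ‖((∑ m ∈ Finset.Ioc 0 N, ‖T m‖ ^ 2 : ℝ) : ℂ)‖ := by
      rw [Complex.norm_real, Real.norm_eq_abs, abs_of_nonneg (by positivity)]
    rw [e, h4]
    have h6 : ∀ l ∈ s, ‖∑ l' ∈ s, a l * (starRingEnd ℂ) (a l') *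
        ∑ m ∈ Finset.Ioc 0 N, F l m * (starRingEnd ℂ) (F l' m)‖ ≤ A ^ 2 * (R + q * P) := by
      intro l hl
      have h7 : ∀ l' ∈ s, ‖a l * (starRingEnd ℂ) (a l') *
          ∑ m ∈ Finset.Ioc 0 N, F l m * (starRingEnd ℂ) (F l' m)‖ ≤
          A ^ 2 * ((if l' = l then R else 0) + P) := by
        intro l' hl'
        rw [norm_mul, norm_mul, RCLike.norm_conj, sq]
        have h8 := hA l hl
        have h9 := hA l' hl'
        gcongr
        split_ifs with h
        · subst h
          linarith [hdiag l' hl]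
        · linarith [hoff l hl l' hl' (Ne.symm h)]
      refine (norm_sum_le_of_le _ h7).trans ?_
      rw [← Finset.mul_sum, Finset.sum_add_distrib, Finset.sum_ite_eq', if_pos hl,
        Finset.sum_const, nsmul_eq_mul]
      gcongr
    refine (norm_sum_le_of_le _ h6).trans ?_
    rw [Finset.sum_const, nsmul_eq_mul]
    calc _ ≤ q * (A ^ 2 * (R + q * P)) := by gcongr
      _ = _ := by ring
  rw [h1]
  calc _ ≤ (B * ∑ m ∈ Finset.Ioc 0 N, ‖T m‖) ^ 2 := by gcongr
    _ = B ^ 2 * (∑ m ∈ Finset.Ioc 0 N, ‖T m‖) ^ 2 := by ring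
    _ ≤ B ^ 2 * (N * (A ^ 2 * (q * R + q ^ 2 * P))) := by gcongr; exact h3.trans (by gcongr)
    _ = _ := by ring

/-- One block of a type II sum. -/
theorem norm_typeII_block_le {γ β κ θ x T : ℝ} (hγ0 : 11 / 12 ≤ γ) (hγ1 : γ < 1)
    (hκ : 0 < κ) (hx : 1 ≤ x) (hβ : 8 * |β| ≤ x) {Q j : ℕ} (hQ : 1 ≤ Q) (hj : 1 ≤ j)
    (hT : ((j * Q : ℕ) : ℝ) ≤ T) (a b : ℕ → ℂ) {A B : ℝ} (hA0 : 0 ≤ A) (hB0 : 0 ≤ B)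
    (hA : ∀ l ∈ Finset.Ioc 0 ⌊x⌋₊, ‖a l‖ ≤ A) (hB : ∀ m ∈ Finset.Ioc 0 ⌊x⌋₊, ‖b m‖ ≤ B) :
    ‖∑ l ∈ Finset.Ioc 0 ⌊x⌋₊ with l / Q = j, ∑ m ∈ Finset.Ioc 0 ⌊x⌋₊,
        a l * b m * dyadicExp (psPhase κ β γ θ) x (l * m)‖ ≤
      A * B * √(x ^ 2 / Q + x * (30000 / √(γ * (1 - γ)) *
        (√κ * √Q * x ^ (γ / 2) + x ^ (1 - γ / 2) / √κ)) * √T) / j := by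
  have hx0 : 0 < x := by linarith
  have hc0 : 0 < γ * (1 - γ) := mul_pos (by linarith) (by linarith)
  have hsc := Real.sqrt_pos.2 hc0
  have hsκ := Real.sqrt_pos.2 hκ
  set P₀ := 30000 / √(γ * (1 - γ)) * (√κ * √Q * x ^ (γ / 2) + x ^ (1 - γ / 2) / √κ) with hP₀
  have hP₀0 : 0 ≤ P₀ := by positivity
  set t := j * Q with ht
  have ht1 : 1 ≤ t := Nat.mul_pos hj hQ
  have ht0 : (0 : ℝ) < t := by exact_mod_cast ht1
  have hj0 : (0 : ℝ) < j := by exact_mod_cast hj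
  have hQ0 : (0 : ℝ) < Q := by exact_mod_cast hQ
  have hst := Real.sqrt_pos.2 ht0
  set s := (Finset.Ioc 0 ⌊x⌋₊).filter (fun l => l / Q = j) with hs
  set N := ⌊x / t⌋₊ with hN
  have hNx : (N : ℝ) ≤ x / t := Nat.floor_le (by positivity)
  have hNN : N ≤ ⌊x⌋₊ := Nat.floor_mono (div_le_self hx0.le (by exact_mod_cast ht1))
  have hmem : ∀ l ∈ s, l ∈ Finset.Ioc 0 ⌊x⌋₊ ∧ t ≤ l ∧ l < t + Q := fun l hl => by
    rw [hs, Finset.mem_filter] at hl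
    have h1 := (Nat.div_eq_iff (by omega : 0 < Q)).1 hl.2
    refine ⟨hl.1, ?_, ?_⟩
    · rw [ht]; omega
    · rw [ht]; omega
  have hQt : Q ≤ t := Nat.le_mul_of_pos_left Q hj
  have hcard : (s.card : ℝ) ≤ Q := by
    have : s ⊆ Finset.Ico t (t + Q) := fun l hl => Finset.mem_Ico.2 (hmem l hl).2
    have h1 := Finset.card_le_card this
    rw [Nat.card_Ico, Nat.add_sub_cancel_left] at h1
    exact_mod_cast h1
  have hrestrict : ∑ l ∈ s, ∑ m ∈ Finset.Ioc 0 ⌊x⌋₊,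
        a l * b m * dyadicExp (psPhase κ β γ θ) x (l * m) =
      ∑ l ∈ s, ∑ m ∈ Finset.Ioc 0 N,
        a l * b m * dyadicExp (psPhase κ β γ θ) x (l * m) := by
    refine Finset.sum_congr rfl fun l hl => ?_
    refine (Finset.sum_subset (Finset.Ioc_subset_Ioc_right hNN) fun m hm hm' => ?_).symm
    rw [Finset.mem_Ioc] at hm hm'
    have h1 : N < m := by omega
    rw [hN, Nat.floor_lt (by positivity), div_lt_iff₀ ht0] at h1
    rw [dyadicExp_eq_zero, mul_zero]
    push_cast
    have h2 : (t : ℝ) ≤ l := by exact_mod_cast (hmem l hl).2.1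
    have h3 : (0 : ℝ) ≤ m := Nat.cast_nonneg m
    nlinarith
  have hoff1 : ∀ l ∈ s, ∀ l' ∈ s, l < l' → ‖∑ m ∈ Finset.Ioc 0 N,
      dyadicExp (psPhase κ β γ θ) x (l' * m) *
        (starRingEnd ℂ) (dyadicExp (psPhase κ β γ θ) x (l * m))‖ ≤ P₀ / √t := by
    intro l hl l' hl' hll
    have h1 := hmem l hl
    have h2 := hmem l' hl'
    exact norm_sum_dyadicExp_mul_conj_le hγ0 hγ1 hκ hx0 hβ ht1 h1.2.1 hll (by omega) (by omega)
      (Nat.lt_floor_add_one _)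
  have key := norm_bilinear_sq_le s N a b
    (fun l m => dyadicExp (psPhase κ β γ θ) x (l * m)) (P := P₀ / √t) (R := x / t)
    (fun l hl => hA l (hmem l hl).1)
    (fun m hm => hB m (Finset.Ioc_subset_Ioc_right hNN hm)) hA0 hcard (by positivity)
    (by positivity)
    (fun l _ => by
      refine (norm_sum_le_of_le (f := fun m => dyadicExp (psPhase κ β γ θ) x (l * m) *
        (starRingEnd ℂ) (dyadicExp (psPhase κ β γ θ) x (l * m))) (n := fun _ => 1) _
        fun m _ => ?_).trans ?_
      · rw [norm_mul, RCLike.norm_conj]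
        exact mul_le_one₀ (norm_dyadicExp_le _ _ _) (norm_nonneg _) (norm_dyadicExp_le _ _ _)
      · simpa using hNx)
    (fun l hl l' hl' hne => by
      rcases lt_or_gt_of_ne hne with h | h
      · have h1 := hoff1 l hl l' hl' h
        rw [← RCLike.norm_conj, map_sum]
        simpa [mul_comm] using h1
      · exact hoff1 l' hl' l hl h)
  rw [hrestrict]
  refine abs_le_of_sq_le_sq' (key.trans ?_) (by positivity) |>.2
  rw [div_pow, mul_pow, mul_pow, Real.sq_sqrt (by positivity)]
  have htT : √(t : ℝ) ≤ √T := Real.sqrt_le_sqrt hT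
  have htt := Real.mul_self_sqrt ht0.le
  -- Writing `1 / √t` as `√t / t` and using `t ≤ T` makes both contributions decay like `1 / t`;
  -- together with `N ≤ x / t` this yields the exact factor `1 / j` after the square root.
  have e1 : P₀ / √t = P₀ * √t / t := by
    rw [div_eq_div_iff hst.ne' ht0.ne']
    linear_combination (-P₀) * htt
  calc A ^ 2 * B ^ 2 * (N * (Q * (x / t) + Q ^ 2 * (P₀ / √t))) ≤
      A ^ 2 * B ^ 2 * (x / t * (Q * (x / t) + Q ^ 2 * (P₀ * √T / t))) := by
        rw [e1]; gcongr
    _ = _ := by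
      rw [ht]; push_cast; field_simp

/-- Type II sums. -/
theorem norm_typeII_le {γ β κ θ x T : ℝ} (hγ0 : 11 / 12 ≤ γ) (hγ1 : γ < 1)
    (hκ : 0 < κ) (hx : 1 ≤ x) (hβ : 8 * |β| ≤ x) {Q : ℕ} (hQ : 1 ≤ Q)
    (a b : ℕ → ℂ) {A B : ℝ} (hA0 : 0 ≤ A) (hB0 : 0 ≤ B)
    (hA : ∀ l ∈ Finset.Ioc 0 ⌊x⌋₊, ‖a l‖ ≤ A) (hB : ∀ m ∈ Finset.Ioc 0 ⌊x⌋₊, ‖b m‖ ≤ B)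
    (haQ : ∀ l : ℕ, l < Q → a l = 0) (haT : ∀ l : ℕ, T < l → a l = 0) :
    ‖∑ l ∈ Finset.Ioc 0 ⌊x⌋₊, ∑ m ∈ Finset.Ioc 0 ⌊x⌋₊,
        a l * b m * dyadicExp (psPhase κ β γ θ) x (l * m)‖ ≤
      A * B * (1 + Real.log x) * √(x ^ 2 / Q + x * (30000 / √(γ * (1 - γ)) *
        (√κ * √Q * x ^ (γ / 2) + x ^ (1 - γ / 2) / √κ)) * √T) := by
  have hx0 : 0 < x := by linarith
  have hc0 : 0 < γ * (1 - γ) := mul_pos (by linarith) (by linarith)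
  set Z := √(x ^ 2 / Q + x * (30000 / √(γ * (1 - γ)) *
        (√κ * √Q * x ^ (γ / 2) + x ^ (1 - γ / 2) / √κ)) * √T) with hZ
  have hZ0 : 0 ≤ Z := Real.sqrt_nonneg _
  have hmaps : ∀ l ∈ Finset.Ioc 0 ⌊x⌋₊, l / Q ∈ Finset.range (⌊x⌋₊ + 1) := fun l hl => by
    rw [Finset.mem_range, Nat.lt_succ_iff]
    exact (Nat.div_le_self _ _).trans (Finset.mem_Ioc.1 hl).2
  have hblock : ∀ j ∈ Finset.range (⌊x⌋₊ + 1),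
      ‖∑ l ∈ Finset.Ioc 0 ⌊x⌋₊ with l / Q = j, ∑ m ∈ Finset.Ioc 0 ⌊x⌋₊,
        a l * b m * dyadicExp (psPhase κ β γ θ) x (l * m)‖ ≤ A * B * Z * ((j : ℝ))⁻¹ := by
    intro j _
    have hzero : (∀ l ∈ (Finset.Ioc 0 ⌊x⌋₊).filter (fun l => l / Q = j), a l = 0) →
        ‖∑ l ∈ Finset.Ioc 0 ⌊x⌋₊ with l / Q = j, ∑ m ∈ Finset.Ioc 0 ⌊x⌋₊,
        a l * b m * dyadicExp (psPhase κ β γ θ) x (l * m)‖ ≤ A * B * Z * ((j : ℝ))⁻¹ := by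
      intro h
      rw [Finset.sum_eq_zero fun l hl => ?_]
      · rw [norm_zero]; positivity
      · rw [h l hl]; simp
    rcases Nat.eq_zero_or_pos j with rfl | hj
    -- The block `j = 0` consists of `l < Q`, where the coefficients vanish; there, division by `j`
    -- would be meaningless.
    · refine hzero fun l hl => haQ l ?_
      exact (Nat.div_eq_zero_iff_lt (by omega)).1 (Finset.mem_filter.1 hl).2
    · rcases le_or_gt ((j * Q : ℕ) : ℝ) T with hT | hT
      · have := norm_typeII_block_le (θ := θ) hγ0 hγ1 hκ hx hβ hQ hj hT a b hA0 hB0 hA hB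
        rwa [div_eq_mul_inv] at this
      · refine hzero fun l hl => haT l (hT.trans_le ?_)
        have := (Finset.mem_filter.1 hl).2
        have h1 : j * Q ≤ l := by rw [← this]; exact Nat.div_mul_le_self l Q
        exact_mod_cast h1
  rw [← Finset.sum_fiberwise_of_maps_to hmaps]
  refine (norm_sum_le_of_le _ hblock).trans ?_
  rw [← Finset.mul_sum]
  -- Summing `1 / j` over the blocks costs only a logarithm.
  have hharm : ∑ j ∈ Finset.range (⌊x⌋₊ + 1), ((j : ℝ))⁻¹ ≤ 1 + Real.log x := by
    rw [Finset.sum_range_succ']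
    have h1 := harmonic_le_one_add_log ⌊x⌋₊
    rw [harmonic] at h1
    push_cast at h1 ⊢
    have h2 : Real.log ⌊x⌋₊ ≤ Real.log x := by
      refine Real.log_le_log ?_ (Nat.floor_le hx0.le)
      exact_mod_cast Nat.floor_pos.2 hx
    simp only [inv_zero, add_zero]
    linarith
  calc _ ≤ A * B * Z * (1 + Real.log x) := by gcongr
    _ = _ := by ring

/-! ### Exponential sums over the von Mangoldt function -/

section Vaughan

open ArithmeticFunction

theorem one_add_log_le_rpow {x ε : ℝ} (hx : 1 ≤ x) (hε : 0 < ε) :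
    1 + Real.log x ≤ (1 + 1 / ε) * x ^ ε := by
  have h1 := Real.log_le_rpow_div (by linarith : 0 ≤ x) hε
  have h2 := Real.one_le_rpow hx hε.le
  calc 1 + Real.log x ≤ x ^ ε + x ^ ε / ε := by linarith
    _ = _ := by ring

theorem log_natCast_le_log {x : ℝ} {n : ℕ} (hn : n ∈ Finset.Ioc 0 ⌊x⌋₊) :
    Real.log n ≤ Real.log x := by
  rw [Finset.mem_Ioc] at hn
  refine Real.log_le_log (by exact_mod_cast hn.1) ?_
  exact (Nat.le_floor_iff' (by omega)).1 hn.2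

/-- Type I sums, for a Dirichlet convolution. -/
theorem norm_sum_convolution_typeI_le {γ β κ θ x : ℝ} (hγ0 : 0 < γ) (hγ1 : γ < 1) (hκ : 0 < κ)
    (hx : 0 < x) (hβ : 8 * |β| ≤ x) (c w : ArithmeticFunction ℝ) (hw : Monotone w)
    {D L W : ℝ} (hD : 0 ≤ D) (hL : 0 ≤ L) (hcD : ∀ d : ℕ, D < d → c d = 0)
    (hcL : ∀ d ∈ Finset.Ioc 0 ⌊x⌋₊, |c d| ≤ L) (hW : w ⌊x⌋₊ ≤ W) :
    ‖∑ n ∈ Finset.Ioc 0 ⌊x⌋₊, (((c * w) n : ℝ) : ℂ) * dyadicExp (psPhase κ β γ θ) x n‖ ≤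
      D * L * W * (1200 / √(γ * (1 - γ)) * (√κ * x ^ (γ / 2) + x ^ (1 - γ / 2) / √κ)) := by
  rw [sum_mul_weight_eq _ _ _ _ fun n hn => dyadicExp_eq_zero _ ((Nat.floor_lt hx.le).1 hn)]
  exact norm_typeI_le hγ0 hγ1 hκ hx hβ (fun d => c d) (fun m => w m) hw (by simp) hD hL hcD hcL hW

/-- Exponential sums over the von Mangoldt function, in terms of type I and type II bounds. -/
theorem norm_sum_vonMangoldt_le {γ β κ θ x Bd U : ℝ} (hγ0 : 11 / 12 ≤ γ) (hγ1 : γ < 1)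
    (hκ : 0 < κ) (hx : 1 ≤ x) (hβ : 8 * |β| ≤ x) {Q : ℕ} (hQ : 1 ≤ Q) (hQU : (Q : ℝ) ≤ U)
    (hBd : ∀ m ∈ Finset.Ioc 0 ⌊x⌋₊, (m.divisors.card : ℝ) ≤ Bd) (hBd0 : 0 ≤ Bd) :
    ‖∑ n ∈ Finset.Ioc 0 ⌊x⌋₊, ((Λ n : ℝ) : ℂ) * dyadicExp (psPhase κ β γ θ) x n‖ ≤
      U * (1 + Real.log x) +
      (U + U ^ 2) * (1 + Real.log x) *
        (1200 / √(γ * (1 - γ)) * (√κ * x ^ (γ / 2) + x ^ (1 - γ / 2) / √κ)) +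
      2 * (Bd * (1 + Real.log x) ^ 2 * √(x ^ 2 / Q + x * (30000 / √(γ * (1 - γ)) *
        (√κ * √Q * x ^ (γ / 2) + x ^ (1 - γ / 2) / √κ)) * √√x)) := by
  have hx0 : 0 < x := by linarith
  have hlog : 0 ≤ Real.log x := Real.log_nonneg hx
  have hU1 : 1 ≤ U := le_trans (by exact_mod_cast hQ) hQU
  have hU0 : 0 ≤ U := by linarith
  set N := ⌊x⌋₊ with hN
  set F := dyadicExp (psPhase κ β γ θ) x with hF
  have hF0 : ∀ n : ℕ, N < n → F n = 0 := fun n hn =>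
    dyadicExp_eq_zero _ ((Nat.floor_lt hx0.le).1 hn)
  set Z := √(x ^ 2 / Q + x * (30000 / √(γ * (1 - γ)) *
        (√κ * √Q * x ^ (γ / 2) + x ^ (1 - γ / 2) / √κ)) * √√x) with hZ
  have hZ0 : 0 ≤ Z := Real.sqrt_nonneg _
  set R := 1200 / √(γ * (1 - γ)) * (√κ * x ^ (γ / 2) + x ^ (1 - γ / 2) / √κ) with hR
  have hc0 : 0 < γ * (1 - γ) := mul_pos (by linarith) (by linarith)
  have hR0 : 0 ≤ R := by positivity
  set Λ₂ := Λ - truncLE Λ U with hΛ₂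
  set b := (moebiusReal - truncLE moebiusReal U) * zetaReal with hb
  have hΛ₂le : ∀ n ∈ Finset.Ioc 0 N, |Λ₂ n| ≤ 1 + Real.log x := fun n hn => by
    rw [hΛ₂, sub_truncLE_apply]
    split_ifs
    · rw [abs_zero]; positivity
    · rw [abs_of_nonneg vonMangoldt_nonneg]
      linarith [vonMangoldt_le_log (n := n), log_natCast_le_log hn]
  have hΛ₂0 : ∀ n : ℕ, (n : ℝ) ≤ U → Λ₂ n = 0 := fun n hn => by
    rw [hΛ₂, sub_truncLE_apply, if_pos hn]
  have hble : ∀ m ∈ Finset.Ioc 0 N, |b m| ≤ Bd := fun m hm =>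
    (abs_moebius_tail_mul_zeta_le U m).trans (hBd m hm)
  have hb0 : ∀ m : ℕ, (m : ℝ) ≤ U → b m = 0 := fun m hm => moebius_tail_mul_zeta_eq_zero hm
  -- the four parts of the identity of Vaughan
  have hsplit : ∑ n ∈ Finset.Ioc 0 N, ((Λ n : ℝ) : ℂ) * F n =
      ∑ n ∈ Finset.Ioc 0 N, ((truncLE Λ U n : ℝ) : ℂ) * F n +
      ∑ n ∈ Finset.Ioc 0 N, (((truncLE moebiusReal U * log) n : ℝ) : ℂ) * F n -
      ∑ n ∈ Finset.Ioc 0 N,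
        (((truncLE moebiusReal U * truncLE Λ U * zetaReal) n : ℝ) : ℂ) * F n +
      ∑ n ∈ Finset.Ioc 0 N, (((Λ₂ * b) n : ℝ) : ℂ) * F n := by
    rw [← Finset.sum_add_distrib, ← Finset.sum_sub_distrib, ← Finset.sum_add_distrib]
    refine Finset.sum_congr rfl fun n _ => ?_
    rw [← add_mul, ← sub_mul, ← add_mul]
    congr 1
    conv_lhs => rw [vaughan_identity U U]
    rw [ArithmeticFunction.add_apply, sub_eq_add_neg, ArithmeticFunction.add_apply,
      ArithmeticFunction.neg_apply, ArithmeticFunction.add_apply]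
    push_cast
    ring
  have hT0 : ‖∑ n ∈ Finset.Ioc 0 N, ((truncLE Λ U n : ℝ) : ℂ) * F n‖ ≤
      U * (1 + Real.log x) := by
    have h1 : ∀ n ∈ Finset.Ioc 0 N, ‖((truncLE Λ U n : ℝ) : ℂ) * F n‖ ≤
        if (n : ℝ) ≤ U then 1 + Real.log x else 0 := fun n hn => by
      rw [norm_mul, Complex.norm_real, Real.norm_eq_abs, truncLE_apply]
      split_ifs
      · rw [abs_of_nonneg vonMangoldt_nonneg]
        have h2 := norm_dyadicExp_le (psPhase κ β γ θ) x n
        have h3 : Λ n ≤ 1 + Real.log x := by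
          linarith [vonMangoldt_le_log (n := n), log_natCast_le_log hn]
        calc Λ n * ‖F n‖ ≤ (1 + Real.log x) * 1 := by gcongr
          _ = _ := mul_one _
      · simp
    refine (norm_sum_le_of_le _ h1).trans ?_
    rw [← Finset.sum_filter, Finset.sum_const, nsmul_eq_mul]
    gcongr
    have : (Finset.Ioc 0 N).filter (fun d : ℕ => (d : ℝ) ≤ U) ⊆ Finset.Ioc 0 ⌊U⌋₊ := by
      intro d hd
      rw [Finset.mem_filter, Finset.mem_Ioc] at hd
      rw [Finset.mem_Ioc]
      exact ⟨hd.1.1, Nat.le_floor hd.2⟩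
    have h1 := Finset.card_le_card this
    rw [Nat.card_Ioc, Nat.sub_zero] at h1
    calc _ ≤ (⌊U⌋₊ : ℝ) := by exact_mod_cast h1
      _ ≤ U := Nat.floor_le hU0
  have hT1 : ‖∑ n ∈ Finset.Ioc 0 N, (((truncLE moebiusReal U * log) n : ℝ) : ℂ) * F n‖ ≤
      U * (1 + Real.log x) * R := by
    refine (norm_sum_convolution_typeI_le (by linarith) hγ1 hκ hx0 hβ (truncLE moebiusReal U) log
      ?_ (D := U) (L := 1) (W := 1 + Real.log x) hU0 zero_le_one ?_
      (fun d _ => abs_truncLE_moebius_le_one U d) ?_).trans_eq ?_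
    · intro m n hmn
      rw [log_apply, log_apply]
      rcases Nat.eq_zero_or_pos m with rfl | hm
      · simpa using Real.log_natCast_nonneg n
      · exact Real.log_le_log (by exact_mod_cast hm) (by exact_mod_cast hmn)
    · intro d hd
      rw [truncLE_apply, if_neg (not_le.2 hd)]
    · rw [log_apply]
      have : Real.log (⌊x⌋₊ : ℕ) ≤ Real.log x := log_natCast_le_log
        (Finset.mem_Ioc.2 ⟨Nat.floor_pos.2 hx, le_rfl⟩)
      linarith
    · rw [mul_one]
  have hT2 : ‖∑ n ∈ Finset.Ioc 0 N,
      (((truncLE moebiusReal U * truncLE Λ U * zetaReal) n : ℝ) : ℂ) * F n‖ ≤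
      U ^ 2 * (1 + Real.log x) * R := by
    refine (norm_sum_convolution_typeI_le (by linarith) hγ1 hκ hx0 hβ
      (truncLE moebiusReal U * truncLE Λ U) zetaReal ?_ (D := U ^ 2) (L := 1 + Real.log x) (W := 1) (by positivity)
      (by positivity) ?_ ?_ ?_).trans_eq ?_
    · intro m n hmn
      rw [zetaReal, natCoe_apply, natCoe_apply, zeta_apply, zeta_apply]
      split_ifs <;> simp
      omega
    · intro d hd
      exact moebius_mul_vonMangoldt_eq_zero (by nlinarith)
    · intro d hd
      linarith [abs_moebius_mul_vonMangoldt_le U U d, log_natCast_le_log hd]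
    · rw [zetaReal, natCoe_apply, zeta_apply]
      split_ifs <;> simp
    · rw [mul_one]
  have hT3 : ‖∑ n ∈ Finset.Ioc 0 N, (((Λ₂ * b) n : ℝ) : ℂ) * F n‖ ≤
      2 * (Bd * (1 + Real.log x) ^ 2 * Z) := by
    rw [sum_mul_weight_eq _ _ N F hF0]
    -- Either `l ≤ √x`, or `l > √x` and `m ≤ √x`; if both exceed `√x` the product exceeds `x` and
    -- the weight vanishes. In each half the variable bounded by `√x` is put first, to be cut into
    -- blocks.
    have e : ∑ l ∈ Finset.Ioc 0 N, ∑ m ∈ Finset.Ioc 0 N,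
          ((Λ₂ l : ℝ) : ℂ) * ((b m : ℝ) : ℂ) * F (l * m) =
        ∑ l ∈ Finset.Ioc 0 N, ∑ m ∈ Finset.Ioc 0 N,
          (if (l : ℝ) ≤ √x then ((Λ₂ l : ℝ) : ℂ) else 0) * ((b m : ℝ) : ℂ) * F (l * m) +
        ∑ m ∈ Finset.Ioc 0 N, ∑ l ∈ Finset.Ioc 0 N,
          (if (m : ℝ) ≤ √x then ((b m : ℝ) : ℂ) else 0) *
            (if (l : ℝ) ≤ √x then 0 else ((Λ₂ l : ℝ) : ℂ)) * F (m * l) := by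
      rw [Finset.sum_comm (s := Finset.Ioc 0 N) (t := Finset.Ioc 0 N)
        (f := fun m l => (if (m : ℝ) ≤ √x then ((b m : ℝ) : ℂ) else 0) *
            (if (l : ℝ) ≤ √x then 0 else ((Λ₂ l : ℝ) : ℂ)) * F (m * l)),
        ← Finset.sum_add_distrib]
      refine Finset.sum_congr rfl fun l _ => ?_
      rw [← Finset.sum_add_distrib]
      refine Finset.sum_congr rfl fun m _ => ?_
      by_cases h1 : (l : ℝ) ≤ √x
      · rw [if_pos h1, if_pos h1]; ring
      · rw [if_neg h1, if_neg h1]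
        by_cases h2 : (m : ℝ) ≤ √x
        · rw [if_pos h2, mul_comm m l]; ring
        · rw [if_neg h2]
          have : F (l * m) = 0 := by
            refine dyadicExp_eq_zero _ ?_
            push_cast
            push Not at h1 h2
            have := Real.mul_self_sqrt hx0.le
            have := Real.sqrt_nonneg x
            nlinarith
          rw [this]; ring
    rw [e]
    have hlt : ∀ l : ℕ, l < Q → (l : ℝ) ≤ U := fun l hl => by
      have : (l : ℝ) ≤ Q := by exact_mod_cast hl.le
      linarith
    have hp1 := norm_typeII_le (θ := θ) (T := √x) hγ0 hγ1 hκ hx hβ hQ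
      (fun l : ℕ => if (l : ℝ) ≤ √x then ((Λ₂ l : ℝ) : ℂ) else 0) (fun m => ((b m : ℝ) : ℂ))
      (A := 1 + Real.log x) (B := Bd) (by positivity) hBd0
      (fun l hl => by
        have := hΛ₂le l hl
        split_ifs
        · rwa [Complex.norm_real]
        · rw [norm_zero]; positivity)
      (fun m hm => by
        rw [Complex.norm_real]; exact hble m hm)
      (fun l hl => by simp [hΛ₂0 l (hlt l hl)])
      (fun l hl => if_neg (not_le.2 hl))
    have hp2 := norm_typeII_le (θ := θ) (T := √x) hγ0 hγ1 hκ hx hβ hQ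
      (fun m : ℕ => if (m : ℝ) ≤ √x then ((b m : ℝ) : ℂ) else 0)
      (fun l : ℕ => if (l : ℝ) ≤ √x then 0 else ((Λ₂ l : ℝ) : ℂ))
      (A := Bd) (B := 1 + Real.log x) hBd0 (by positivity)
      (fun m hm => by
        have := hble m hm
        split_ifs
        · rwa [Complex.norm_real]
        · rwa [norm_zero])
      (fun l hl => by
        have := hΛ₂le l hl
        split_ifs
        · rw [norm_zero]; positivity
        · rwa [Complex.norm_real])
      (fun l hl => by simp [hb0 l (hlt l hl)])
      (fun l hl => if_neg (not_le.2 hl))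
    refine (norm_add_le _ _).trans ((add_le_add hp1 hp2).trans_eq ?_)
    ring
  rw [hsplit]
  refine (norm_add_le _ _).trans ?_
  refine (add_le_add (norm_sub_le _ _) hT3).trans ?_
  refine (add_le_add (add_le_add ((norm_add_le _ _).trans (add_le_add hT0 hT1)) hT2) le_rfl).trans ?_
  exact le_of_eq (by ring)

end Vaughan

set_option maxHeartbeats 2000000 in
open ArithmeticFunction in
/-- The von Mangoldt exponential sum with all exponents evaluated. -/
theorem exists_norm_sum_vonMangoldt_le {γ δ β k₀ ε : ℝ} (hγ0 : 11 / 12 < γ) (hγ1 : γ < 1)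
    (hδ : δ = (15 - 14 * γ) / 26) (hk₀ : 0 < k₀) (hε : 0 < ε) :
    ∃ C : ℝ, 0 < C ∧ ∀ (x θ : ℝ) (h : ℕ), 1 ≤ x → 8 * |β| ≤ x → 1 ≤ h →
      ‖∑ n ∈ Finset.Ioc 0 ⌊x⌋₊,
          ((Λ n : ℝ) : ℂ) * dyadicExp (psPhase (h * k₀) β γ θ) x n‖ ≤
        C * x ^ (1 - δ + ε) * (1 + ((h : ℝ) / x ^ δ) ^ (1 / 2 : ℝ)) := by
  have hε3 : 0 < ε / 3 := by linarith
  obtain ⟨Cd, hCd1, hCd⟩ := exists_card_divisors_le_rpow hε3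
  have hc0 : 0 < γ * (1 - γ) := mul_pos (by linarith) (by linarith)
  have hsc := Real.sqrt_pos.2 hc0
  have hsk := Real.sqrt_pos.2 hk₀
  set c := √(γ * (1 - γ)) with hc
  set Lε := 1 + 1 / (ε / 3) with hLε
  have hLε1 : 1 ≤ Lε := by
    have : 0 ≤ 1 / (ε / 3) := by positivity
    linarith
  set k₁ := √k₀ + 1 / √k₀ with hk₁
  have hk₁0 : 0 < k₁ := by positivity
  set K := 2 + 30000 / c * k₁ * 2 with hK
  have hK0 : 0 < K := by positivity
  refine ⟨Lε + 2 * Lε * (1200 / c * k₁ * 2) + 2 * (Cd * Lε ^ 2 * √K), by positivity, ?_⟩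
  intro x θ h hx hβ hh
  have hx0 : 0 < x := by linarith
  have hh1 : (1 : ℝ) ≤ h := by exact_mod_cast hh
  have hh0 : (0 : ℝ) < h := by linarith
  have hδ0 : 0 < δ := by rw [hδ]; linarith
  have hδ1 : δ < 1 / 12 := by rw [hδ]; linarith
  set r := (h : ℝ) / x ^ δ with hr
  have hr0 : 0 < r := by positivity
  rw [← Real.sqrt_eq_rpow]
  have hsr := Real.sqrt_pos.2 hr0
  have mono : ∀ {s t : ℝ}, s ≤ t → x ^ s ≤ x ^ t := fun hst =>
    Real.rpow_le_rpow_of_exponent_le hx hst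
  have hsh : √(h : ℝ) = √r * x ^ (δ / 2) := by
    have : (h : ℝ) = r * x ^ δ := by rw [hr]; field_simp
    rw [this, Real.sqrt_mul hr0.le, Real.sqrt_eq_rpow (x ^ δ), ← Real.rpow_mul hx0.le]
    ring_nf
  have hsh1 : 1 ≤ √(h : ℝ) := Real.one_le_sqrt.2 hh1
  -- the block length
  set Q := ⌊x ^ (2 * δ)⌋₊ with hQ
  have hx2δ : 1 ≤ x ^ (2 * δ) := Real.one_le_rpow hx (by linarith)
  have hQ1 : 1 ≤ Q := Nat.floor_pos.2 hx2δ
  have hQle : (Q : ℝ) ≤ x ^ (2 * δ) := Nat.floor_le (by positivity)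
  have hQge : x ^ (2 * δ) / 2 ≤ Q := by
    have h1 := Nat.lt_floor_add_one (x ^ (2 * δ))
    have h2 : (1 : ℝ) ≤ Q := by exact_mod_cast hQ1
    rw [← hQ] at h1
    linarith
  have hQ0 : (0 : ℝ) < Q := by exact_mod_cast hQ1
  have hsQ : √(Q : ℝ) ≤ x ^ δ := by
    calc √(Q : ℝ) ≤ √(x ^ (2 * δ)) := Real.sqrt_le_sqrt hQle
      _ = x ^ δ := by rw [Real.sqrt_eq_rpow, ← Real.rpow_mul hx0.le]; ring_nf
  -- With `U = x ^ (1/6)` the requirement `Q ≤ U` becomes `2δ ≤ 1/6`, which holds because `γ >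
  -- 11/12`.
  set U := x ^ (1 / 6 : ℝ) with hU
  have hQU : (Q : ℝ) ≤ U := hQle.trans (mono (by linarith))
  have hU1 : 1 ≤ U := Real.one_le_rpow hx (by norm_num)
  have hUsq : U ^ 2 = x ^ (1 / 3 : ℝ) := by
    rw [hU, ← Real.rpow_natCast, ← Real.rpow_mul hx0.le]; norm_num
  have hUU : U ≤ U ^ 2 := le_self_pow₀ hU1 (by norm_num)
  have hlog := one_add_log_le_rpow hx hε3
  rw [← hLε] at hlog
  set E := x ^ (ε / 3) with hE
  have hE1 : 1 ≤ E := Real.one_le_rpow hx hε3.le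
  have hlog0 : 0 ≤ 1 + Real.log x := by linarith [Real.log_nonneg hx]
  have hBd : ∀ m ∈ Finset.Ioc 0 ⌊x⌋₊, (m.divisors.card : ℝ) ≤ Cd * E := fun m hm => by
    rw [Finset.mem_Ioc] at hm
    refine (hCd m (by omega)).trans ?_
    have : (m : ℝ) ≤ x := (Nat.le_floor_iff hx0.le).1 hm.2
    rw [hE]
    gcongr
  have hκ : 0 < h * k₀ := by positivity
  have hsκ : √(h * k₀) = √(h : ℝ) * √k₀ := Real.sqrt_mul hh0.le k₀
  -- The dependence on the constant `k₀` is moved into `k₁`, and the decay in `h` of the second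
  -- summand is given up.
  have hcomb : ∀ a b : ℝ, 0 ≤ a → 0 ≤ b →
      √(h * k₀) * a + b / √(h * k₀) ≤ k₁ * (√(h : ℝ) * a + b) := by
    intro a b ha hb
    rw [hsκ, hk₁]
    have h1 : b / (√(h : ℝ) * √k₀) ≤ b / √k₀ := by
      gcongr
      exact le_mul_of_one_le_left hsk.le hsh1
    have h2 : 0 ≤ √k₀ * b + 1 / √k₀ * (√(h : ℝ) * a) := by positivity
    calc _ ≤ √(h : ℝ) * √k₀ * a + b / √k₀ := by linarith
      _ ≤ √(h : ℝ) * √k₀ * a + b / √k₀ + (√k₀ * b + 1 / √k₀ * (√(h : ℝ) * a)) := by linarith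
      _ = _ := by ring
  have main := norm_sum_vonMangoldt_le (θ := θ) hγ0.le hγ1 hκ hx hβ hQ1 hQU hBd (by positivity)
  refine main.trans ?_
  rw [← hc]
  set Y := x ^ (1 - δ) * (1 + √r) with hY
  have hX1 : 1 ≤ x ^ (1 - δ) := Real.one_le_rpow hx (by linarith)
  have hY0 : 0 < Y := by positivity
  have hsum1 : x ^ (1 - δ) ≤ Y := by
    exact le_mul_of_one_le_right (by positivity) (by linarith)
  -- type I size
  have hI : U ^ 2 * (1200 / c * (√(h * k₀) * x ^ (γ / 2) + x ^ (1 - γ / 2) / √(h * k₀))) ≤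
      1200 / c * k₁ * 2 * Y := by
    have h1 := hcomb (x ^ (γ / 2)) (x ^ (1 - γ / 2)) (by positivity) (by positivity)
    have h2 : U ^ 2 * (√(h : ℝ) * x ^ (γ / 2)) ≤ Y := by
      rw [hUsq, hsh]
      calc _ = √r * (x ^ (1 / 3 : ℝ) * x ^ (δ / 2) * x ^ (γ / 2)) := by ring
        _ = √r * x ^ (1 / 3 + δ / 2 + γ / 2) := by
          rw [Real.rpow_add hx0, Real.rpow_add hx0]
        _ ≤ √r * x ^ (1 - δ) := by
          gcongr √r * ?_
          exact mono (by linarith)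
        _ ≤ Y := by rw [hY]; linarith
    have h3 : U ^ 2 * x ^ (1 - γ / 2) ≤ Y := by
      rw [hUsq, ← Real.rpow_add hx0]
      exact (mono (by linarith)).trans hsum1
    calc _ ≤ U ^ 2 * (1200 / c * (k₁ * (√(h : ℝ) * x ^ (γ / 2) + x ^ (1 - γ / 2)))) := by gcongr
      _ = 1200 / c * k₁ * (U ^ 2 * (√(h : ℝ) * x ^ (γ / 2)) + U ^ 2 * x ^ (1 - γ / 2)) := by ring
      _ ≤ 1200 / c * k₁ * (Y + Y) := by gcongr
      _ = _ := by ring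
  -- type II size
  have hZ : √(x ^ 2 / Q + x * (30000 / c *
        (√(h * k₀) * √Q * x ^ (γ / 2) + x ^ (1 - γ / 2) / √(h * k₀))) * √√x) ≤ √K * Y := by
    have hY2 : x ^ (2 - 2 * δ) * (1 + r) ≤ Y ^ 2 := by
      have e : (x ^ (1 - δ)) ^ 2 = x ^ (2 - 2 * δ) := by
        rw [← Real.rpow_natCast, ← Real.rpow_mul hx0.le]; push_cast; ring_nf
      rw [hY, mul_pow, e]
      gcongr
      have := Real.sq_sqrt hr0.le
      rw [add_sq, this]
      linarith
    have hY2' : x ^ (2 - 2 * δ) ≤ Y ^ 2 := by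
      refine le_trans ?_ hY2
      exact le_mul_of_one_le_right (by positivity) (by linarith)
    have hY2'' : x ^ (2 - 2 * δ) * √r ≤ Y ^ 2 := by
      refine le_trans ?_ hY2
      gcongr
      rcases le_total r 1 with h1 | h1
      · linarith [Real.sqrt_le_one.2 h1]
      · linarith [Real.sqrt_le_self_iff.2 (Or.inr h1)]
    have hq4 : √√x = x ^ (1 / 4 : ℝ) := by
      rw [Real.sqrt_eq_rpow, Real.sqrt_eq_rpow, ← Real.rpow_mul hx0.le]; norm_num
    have t1 : x ^ 2 / Q ≤ 2 * Y ^ 2 := by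
      calc x ^ 2 / Q ≤ x ^ 2 / (x ^ (2 * δ) / 2) := by gcongr
        _ = 2 * x ^ (2 - 2 * δ) := by
          rw [Real.rpow_sub hx0, Real.rpow_two]; field_simp
        _ ≤ _ := by gcongr
    have t2 : x * (√(h : ℝ) * (√Q * x ^ (γ / 2))) * √√x ≤ Y ^ 2 := by
      rw [hsh, hq4]
      calc _ ≤ x * (√r * x ^ (δ / 2) * (x ^ δ * x ^ (γ / 2))) * x ^ (1 / 4 : ℝ) := by gcongr
        _ = √r * (x ^ (1 : ℝ) * x ^ (δ / 2) * x ^ δ * x ^ (γ / 2) * x ^ (1 / 4 : ℝ)) := by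
          rw [Real.rpow_one]; ring
        _ = √r * x ^ (1 + δ / 2 + δ + γ / 2 + 1 / 4) := by
          rw [Real.rpow_add hx0, Real.rpow_add hx0, Real.rpow_add hx0, Real.rpow_add hx0]
        _ ≤ √r * x ^ (2 - 2 * δ) := by
          gcongr √r * ?_
          -- The inequality amounts to `7δ/2 ≤ 3/4 - γ/2`, which for this `δ` is equivalent to `γ ≥
          -- 11/12`.
          exact mono (by rw [hδ]; linarith)
        _ ≤ _ := by linarith
    have t3 : x * x ^ (1 - γ / 2) * √√x ≤ Y ^ 2 := by
      rw [hq4]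
      calc _ = x ^ (1 : ℝ) * x ^ (1 - γ / 2) * x ^ (1 / 4 : ℝ) := by rw [Real.rpow_one]
        _ = x ^ (1 + (1 - γ / 2) + 1 / 4) := by
          rw [Real.rpow_add hx0, Real.rpow_add hx0]
        _ ≤ x ^ (2 - 2 * δ) := mono (by linarith)
        _ ≤ _ := hY2'
    have h1 := hcomb (√Q * x ^ (γ / 2)) (x ^ (1 - γ / 2)) (by positivity) (by positivity)
    rw [← mul_assoc] at h1
    calc _ ≤ √(x ^ 2 / Q + x * (30000 / c *
            (k₁ * (√(h : ℝ) * (√Q * x ^ (γ / 2)) + x ^ (1 - γ / 2)))) * √√x) := by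
          gcongr
      _ = √(x ^ 2 / Q + 30000 / c * k₁ * (x * (√(h : ℝ) * (√Q * x ^ (γ / 2))) * √√x +
            x * x ^ (1 - γ / 2) * √√x)) := by ring_nf
      _ ≤ √(2 * Y ^ 2 + 30000 / c * k₁ * (Y ^ 2 + Y ^ 2)) := by gcongr
      _ = √(K * Y ^ 2) := by rw [hK]; ring_nf
      _ = √K * Y := by rw [Real.sqrt_mul hK0.le, Real.sqrt_sq hY0.le]
  have hE3 : x ^ (1 - δ + ε) = x ^ (1 - δ) * E ^ 3 := by
    rw [Real.rpow_add hx0, hE, ← Real.rpow_natCast (x ^ (ε / 3)), ← Real.rpow_mul hx0.le]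
    push_cast; ring_nf
  have hEE : E ≤ E ^ 3 := by
    calc E = E ^ 1 := (pow_one E).symm
      _ ≤ E ^ 3 := pow_le_pow_right₀ hE1 (by norm_num)
  have hUY : U ≤ Y := (mono (by linarith)).trans hsum1
  set R := 1200 / c * (√(h * k₀) * x ^ (γ / 2) + x ^ (1 - γ / 2) / √(h * k₀)) with hR
  have hR0 : 0 ≤ R := by positivity
  set Z := √(x ^ 2 / Q + x * (30000 / c *
        (√(h * k₀) * √Q * x ^ (γ / 2) + x ^ (1 - γ / 2) / √(h * k₀))) * √√x) with hZdef
  have p1 : U * (1 + Real.log x) ≤ Lε * (Y * E ^ 3) := by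
    calc _ ≤ Y * (Lε * E ^ 3) := by
          gcongr
          exact hlog.trans (by gcongr)
      _ = _ := by ring
  have p2 : (U + U ^ 2) * (1 + Real.log x) * R ≤ 2 * Lε * (1200 / c * k₁ * 2) * (Y * E ^ 3) := by
    calc (U + U ^ 2) * (1 + Real.log x) * R ≤ (U ^ 2 + U ^ 2) * (Lε * E ^ 3) * R := by
          gcongr
          exact hlog.trans (by gcongr)
      _ = 2 * (Lε * E ^ 3) * (U ^ 2 * R) := by ring
      _ ≤ 2 * (Lε * E ^ 3) * (1200 / c * k₁ * 2 * Y) := by gcongr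
      _ = _ := by ring
  have p3 : 2 * (Cd * E * (1 + Real.log x) ^ 2 * Z) ≤ 2 * (Cd * Lε ^ 2 * √K) * (Y * E ^ 3) := by
    calc 2 * (Cd * E * (1 + Real.log x) ^ 2 * Z) ≤ 2 * (Cd * E * (Lε * E) ^ 2 * (√K * Y)) := by
          gcongr
      _ = _ := by ring
  rw [hE3]
  calc _ ≤ Lε * (Y * E ^ 3) + 2 * Lε * (1200 / c * k₁ * 2) * (Y * E ^ 3) +
        2 * (Cd * Lε ^ 2 * √K) * (Y * E ^ 3) := add_le_add (add_le_add p1 p2) p3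
    _ = _ := by rw [hY]; ring

/-! ### Residue classes and the passage to primes -/

theorem unitExp_natCast_mul (k : ℕ) (t : ℝ) : unitExp (k * t) = unitExp t ^ k := by
  unfold unitExp
  rw [← Complex.exp_nat_mul]
  push_cast
  ring_nf

theorem unitExp_eq_one_iff (t : ℝ) : unitExp t = 1 ↔ ∃ k : ℤ, t = k := by
  constructor
  · intro h
    unfold unitExp at h
    rw [Complex.exp_eq_one_iff] at h
    obtain ⟨k, hk⟩ := h
    refine ⟨k, ?_⟩
    have h1 : ((2 * Real.pi * t : ℝ) : ℂ) = ((k * (2 * Real.pi) : ℝ) : ℂ) := by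
      refine mul_right_cancel₀ Complex.I_ne_zero ?_
      rw [hk]; push_cast; ring
    have h2 := Complex.ofReal_injective h1
    have := Real.pi_pos
    refine mul_left_cancel₀ (a := 2 * Real.pi) (by positivity) ?_
    linarith
  · rintro ⟨k, rfl⟩
    exact unitExp_int k

/-- Detection of a residue class by additive characters. -/
theorem sum_unitExp_residue (q : ℕ) (hq : 1 ≤ q) (a n : ℤ) :
    ∑ k ∈ Finset.range q, unitExp (k * (((n : ℝ) - a) / q)) =
      if n ≡ a [ZMOD (q : ℤ)] then (q : ℂ) else 0 := by
  have hq0 : (q : ℝ) ≠ 0 := by positivity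
  set ζ := unitExp (((n : ℝ) - a) / q) with hζ
  simp_rw [unitExp_natCast_mul]
  rw [← hζ]
  have hiff : ζ = 1 ↔ n ≡ a [ZMOD (q : ℤ)] := by
    rw [hζ, unitExp_eq_one_iff, Int.modEq_comm, Int.modEq_iff_dvd]
    constructor
    · rintro ⟨k, hk⟩
      rw [div_eq_iff hq0] at hk
      refine ⟨k, ?_⟩
      have : ((n - a : ℤ) : ℝ) = ((q * k : ℤ) : ℝ) := by push_cast; linarith
      exact_mod_cast this
    · rintro ⟨k, hk⟩
      refine ⟨k, ?_⟩
      rw [div_eq_iff hq0]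
      have : ((n - a : ℤ) : ℝ) = ((q * k : ℤ) : ℝ) := by rw [hk]
      push_cast at this
      linarith
  split_ifs with h
  · rw [hiff.2 h]; simp
  · have h1 : ζ ≠ 1 := fun h' => h (hiff.1 h')
    rw [geom_sum_eq h1]
    have h2 : ζ ^ q = 1 := by
      rw [hζ, ← unitExp_natCast_mul, mul_div_cancel₀ _ hq0, unitExp_eq_one_iff]
      exact ⟨n - a, by push_cast; rfl⟩
    rw [h2, sub_self, zero_div]

/-- A sum over a residue class is at most the largest twisted sum. -/
theorem norm_sum_residue_le (s : Finset ℕ) (z : ℕ → ℂ) (q : ℕ) (hq : 1 ≤ q) (a : ℤ) {R : ℝ}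
    (h : ∀ θ : ℝ, ‖∑ n ∈ s, z n * unitExp (θ * n)‖ ≤ R) :
    ‖∑ n ∈ s with (n : ℕ) ≡ a [ZMOD (q : ℤ)], z n‖ ≤ R := by
  have hq0 : (0 : ℝ) < q := by exact_mod_cast hq
  have hqc : (q : ℂ) ≠ 0 := by exact_mod_cast hq0.ne'
  -- There are `q` characters, each with weight `1 / q`, so nothing is lost in `q`.
  have e : ∑ n ∈ s with (n : ℕ) ≡ a [ZMOD (q : ℤ)], z n = (q : ℂ)⁻¹ *
      ∑ k ∈ Finset.range q, unitExp (-(k * (a / q))) *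
        ∑ n ∈ s, z n * unitExp ((k / q : ℝ) * n) := by
    simp_rw [Finset.mul_sum]
    rw [Finset.sum_comm, Finset.sum_filter]
    refine Finset.sum_congr rfl fun n _ => ?_
    have h1 := sum_unitExp_residue q hq a n
    have h2 : ∑ k ∈ Finset.range q, (q : ℂ)⁻¹ * (unitExp (-(k * (a / q))) *
        (z n * unitExp ((k / q : ℝ) * n))) =
        (q : ℂ)⁻¹ * z n * ∑ k ∈ Finset.range q, unitExp (k * ((((n : ℤ) : ℝ) - a) / q)) := by
      rw [Finset.mul_sum]
      refine Finset.sum_congr rfl fun k _ => ?_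
      have : (k : ℝ) * ((((n : ℤ) : ℝ) - a) / q) = -(k * (a / q)) + (k / q : ℝ) * n := by
        push_cast; ring
      rw [this, unitExp_add]; ring
    rw [h2, h1]
    split_ifs
    · field_simp
    · simp
  rw [e, norm_mul, norm_inv, Complex.norm_natCast]
  have h3 : ‖∑ k ∈ Finset.range q, unitExp (-(k * (a / q))) *
        ∑ n ∈ s, z n * unitExp ((k / q : ℝ) * n)‖ ≤ q * R := by
    refine (norm_sum_le_of_le (n := fun _ => R) _ fun k _ => ?_).trans_eq (by simp)
    rw [norm_mul, norm_unitExp, one_mul]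
    exact h _
  calc _ ≤ (q : ℝ)⁻¹ * (q * R) := by gcongr
    _ = R := by field_simp

open ArithmeticFunction in
/-- Exponential sums over primes. -/
theorem exists_norm_sum_log_prime_le {γ δ β k₀ ε : ℝ} (hγ0 : 11 / 12 < γ) (hγ1 : γ < 1)
    (hδ : δ = (15 - 14 * γ) / 26) (hk₀ : 0 < k₀) (hε : 0 < ε) :
    ∃ C : ℝ, 0 < C ∧ ∀ (x θ : ℝ) (h : ℕ), 1 ≤ x → 8 * |β| ≤ x → 1 ≤ h →
      ‖∑ p ∈ Finset.Ioc 0 ⌊x⌋₊ with p.Prime,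
          ((Real.log p : ℝ) : ℂ) * dyadicExp (psPhase (h * k₀) β γ θ) x p‖ ≤
        C * x ^ (1 - δ + ε) * (1 + ((h : ℝ) / x ^ δ) ^ (1 / 2 : ℝ)) := by
  obtain ⟨C, hC, hCb⟩ := exists_norm_sum_vonMangoldt_le (β := β) hγ0 hγ1 hδ hk₀ hε
  refine ⟨C + 8, by positivity, fun x θ h hx hβ hh => ?_⟩
  have hx0 : 0 < x := by linarith
  have h1 := hCb x θ h hx hβ hh
  set F := dyadicExp (psPhase (h * k₀) β γ θ) x with hF
  have hsplit : ∑ n ∈ Finset.Ioc 0 ⌊x⌋₊, ((Λ n : ℝ) : ℂ) * F n =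
      ∑ p ∈ Finset.Ioc 0 ⌊x⌋₊ with p.Prime, ((Real.log p : ℝ) : ℂ) * F p +
      ∑ n ∈ Finset.Ioc 0 ⌊x⌋₊ with ¬ n.Prime, ((Λ n : ℝ) : ℂ) * F n := by
    rw [← Finset.sum_filter_add_sum_filter_not (Finset.Ioc 0 ⌊x⌋₊) Nat.Prime]
    congr 1
    refine Finset.sum_congr rfl fun p hp => ?_
    rw [vonMangoldt_apply_prime (Finset.mem_filter.1 hp).2]
  have h2 : ‖∑ n ∈ Finset.Ioc 0 ⌊x⌋₊ with ¬ n.Prime, ((Λ n : ℝ) : ℂ) * F n‖ ≤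
      8 * x ^ (1 - δ + ε) := by
    have h3 : ‖∑ n ∈ Finset.Ioc 0 ⌊x⌋₊ with ¬ n.Prime, ((Λ n : ℝ) : ℂ) * F n‖ ≤
        ∑ n ∈ Finset.Ioc 0 ⌊x⌋₊ with ¬ n.Prime, Λ n := by
      refine norm_sum_le_of_le _ fun n _ => ?_
      rw [norm_mul, Complex.norm_real, Real.norm_eq_abs, abs_of_nonneg vonMangoldt_nonneg]
      exact mul_le_of_le_one_right vonMangoldt_nonneg (norm_dyadicExp_le _ _ _)
    -- The non-primes contribute at most `ψ - θ`, of order `√x * log x`, well below `x ^ (1 - δ)`.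
    rw [← Chebyshev.psi_sub_theta_eq_sum_not_prime] at h3
    have h4 := Chebyshev.psi_sub_theta_le hx
    have h5 := Real.log_le_rpow_div hx0.le (ε := 1 / 4) (by norm_num)
    calc _ ≤ 2 * √x * Real.log x := h3.trans h4
      _ ≤ 2 * x ^ (1 / 2 : ℝ) * (x ^ (1 / 4 : ℝ) / (1 / 4)) := by
        rw [Real.sqrt_eq_rpow]; gcongr
      _ = 8 * (x ^ (1 / 2 : ℝ) * x ^ (1 / 4 : ℝ)) := by ring
      _ = 8 * x ^ (1 / 2 + 1 / 4 : ℝ) := by rw [Real.rpow_add hx0]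
      _ ≤ _ := by
        gcongr 8 * ?_
        exact Real.rpow_le_rpow_of_exponent_le hx (by rw [hδ]; linarith)
  have h3 : ∑ p ∈ Finset.Ioc 0 ⌊x⌋₊ with p.Prime, ((Real.log p : ℝ) : ℂ) * F p =
      ∑ n ∈ Finset.Ioc 0 ⌊x⌋₊, ((Λ n : ℝ) : ℂ) * F n -
      ∑ n ∈ Finset.Ioc 0 ⌊x⌋₊ with ¬ n.Prime, ((Λ n : ℝ) : ℂ) * F n := by
    rw [hsplit]; ring
  rw [h3]
  refine (norm_sub_le _ _).trans ((add_le_add h1 h2).trans ?_)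
  have h4 : 0 ≤ 8 * x ^ (1 - δ + ε) * ((h : ℝ) / x ^ δ) ^ (1 / 2 : ℝ) := by positivity
  linarith

/-! ### Sawtooth sums over primes in a residue class -/

/-- The primes `p ≤ x` with `p ≡ a (mod q)`. -/
noncomputable def primesAP (x : ℝ) (q : ℕ) (a : ℤ) : Finset ℕ :=
  (Finset.Icc 1 ⌊x⌋₊).filter (fun p : ℕ => p.Prime ∧ (p : ℤ) ≡ a [ZMOD (q : ℤ)])

theorem mem_primesAP {x : ℝ} {q : ℕ} {a : ℤ} {p : ℕ} :
    p ∈ primesAP x q a ↔ (1 ≤ p ∧ p ≤ ⌊x⌋₊) ∧ p.Prime ∧ (p : ℤ) ≡ a [ZMOD (q : ℤ)] := by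
  rw [primesAP, Finset.mem_filter, Finset.mem_Icc]

theorem le_of_mem_primesAP {x : ℝ} {q : ℕ} {a : ℤ} {p : ℕ} (hp : p ∈ primesAP x q a) :
    (p : ℝ) ≤ x := by
  have h := mem_primesAP.1 hp
  exact (Nat.le_floor_iff' (by omega)).1 h.1.2

theorem one_le_of_mem_primesAP {x : ℝ} {q : ℕ} {a : ℤ} {p : ℕ} (hp : p ∈ primesAP x q a) :
    (1 : ℝ) ≤ p := by
  exact_mod_cast (mem_primesAP.1 hp).1.1

/-- The sum of `log p` times the sawtooth function at `-((p - β) / α) ^ γ` over the primes in a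
residue class. -/
noncomputable def sawtoothSum (α β γ : ℝ) (q : ℕ) (a : ℤ) (x : ℝ) : ℝ :=
  ∑ p ∈ primesAP x q a, Real.log p * sawtooth (-(((p : ℝ) - β) / α) ^ γ)

theorem sum_log_filter_primesAP_le {x : ℝ} (hx : 1 ≤ x) (q : ℕ) (a : ℤ) (P : ℕ → Prop)
    [DecidablePred P] :
    ∑ p ∈ (primesAP x q a).filter P, Real.log p ≤ x * Real.log x := by
  have hlog := Real.log_nonneg hx
  have h1 : ∀ p ∈ (primesAP x q a).filter P, Real.log p ≤ Real.log x := fun p hp => by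
    have h2 := (Finset.mem_filter.1 hp).1
    exact Real.log_le_log (by linarith [one_le_of_mem_primesAP h2]) (le_of_mem_primesAP h2)
  refine (Finset.sum_le_sum h1).trans ?_
  rw [Finset.sum_const, nsmul_eq_mul]
  gcongr
  have h3 : (primesAP x q a).filter P ⊆ Finset.Icc 1 ⌊x⌋₊ :=
    (Finset.filter_subset _ _).trans (Finset.filter_subset _ _)
  have h4 := Finset.card_le_card h3
  rw [Nat.card_Icc, Nat.add_sub_cancel] at h4
  calc _ ≤ (⌊x⌋₊ : ℝ) := by exact_mod_cast h4
    _ ≤ x := Nat.floor_le (by linarith)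

theorem sawtoothSum_eq_add (α β γ : ℝ) (q : ℕ) (a : ℤ) {x : ℝ} (hx : 0 ≤ x) :
    sawtoothSum α β γ q a x = sawtoothSum α β γ q a (x / 2) +
      ∑ p ∈ (primesAP x q a).filter (fun p : ℕ => x / 2 < p),
        Real.log p * sawtooth (-(((p : ℝ) - β) / α) ^ γ) := by
  unfold sawtoothSum
  rw [← Finset.sum_filter_add_sum_filter_not (primesAP x q a) (fun p : ℕ => (p : ℝ) ≤ x / 2)]
  congr 1
  · refine Finset.sum_congr ?_ fun _ _ => rfl
    ext p
    rw [Finset.mem_filter, mem_primesAP, mem_primesAP, Nat.le_floor_iff hx,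
      Nat.le_floor_iff (by linarith : 0 ≤ x / 2)]
    constructor
    · rintro ⟨⟨⟨h1, _⟩, h3⟩, h4⟩
      exact ⟨⟨h1, h4⟩, h3⟩
    · rintro ⟨⟨h1, h2⟩, h3⟩
      exact ⟨⟨⟨h1, by linarith⟩, h3⟩, h2⟩
  · simp only [not_le]

/-- The exponential sums over a dyadic range of a residue class. -/
theorem exists_norm_sum_residue_le {α β γ δ ε : ℝ} (hα : 0 < α) (hγ0 : 11 / 12 < γ) (hγ1 : γ < 1)
    (hδ : δ = (15 - 14 * γ) / 26) (hε : 0 < ε) :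
    ∃ C : ℝ, 0 < C ∧ ∀ (q : ℕ) (a : ℤ) (x : ℝ) (h : ℕ), 1 ≤ q → 1 ≤ x → 8 * |β| ≤ x → 1 ≤ h →
      ‖∑ p ∈ (primesAP x q a).filter (fun p : ℕ => x / 2 < p),
          ((Real.log p : ℝ) : ℂ) * unitExp (h * (-(((p : ℝ) - β) / α) ^ γ))‖ ≤
        C * x ^ (1 - δ + ε) * (1 + ((h : ℝ) / x ^ δ) ^ (1 / 2 : ℝ)) := by
  obtain ⟨C, hC, hCb⟩ := exists_norm_sum_log_prime_le (β := β) (k₀ := α ^ (-γ)) hγ0 hγ1 hδ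
    (by positivity) hε
  refine ⟨C, hC, fun q a x h hq hx hβ hh => ?_⟩
  have hx0 : 0 < x := by linarith
  set s := (Finset.Icc 1 ⌊x⌋₊).filter (fun p : ℕ => p.Prime ∧ x / 2 < p) with hs
  have e : (primesAP x q a).filter (fun p : ℕ => x / 2 < p) =
      s.filter (fun n : ℕ => (n : ℤ) ≡ a [ZMOD (q : ℤ)]) := by
    ext p
    rw [Finset.mem_filter, mem_primesAP, hs, Finset.mem_filter, Finset.mem_filter, Finset.mem_Icc]
    tauto
  rw [e]
  refine norm_sum_residue_le s _ q hq a fun θ => ?_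
  refine le_trans (le_of_eq ?_) (hCb x θ h hx hβ hh)
  congr 1
  have hb := abs_le.1 (show |β| ≤ x / 8 by linarith)
  have e2 : s = ((Finset.Ioc 0 ⌊x⌋₊).filter Nat.Prime).filter (fun p : ℕ => x / 2 < p) := by
    ext p
    simp only [hs, Finset.mem_filter, Finset.mem_Icc, Finset.mem_Ioc]
    constructor <;> rintro h <;> refine ⟨?_, ?_⟩ <;> tauto
  rw [e2, Finset.sum_filter]
  refine Finset.sum_congr rfl fun p hp => ?_
  rw [Finset.mem_filter, Finset.mem_Ioc, Nat.le_floor_iff hx0.le] at hp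
  unfold dyadicExp
  split_ifs with h1 h2 h2
  · rw [mul_assoc, ← unitExp_add, psPhase]
    have h3 : (0 : ℝ) ≤ p - β := by linarith
    rw [Real.div_rpow h3 hα.le, Real.rpow_neg hα.le]
    congr 2
    ring
  · exact absurd ⟨h1, hp.1.2⟩ h2
  · exact absurd h2.1 h1
  · simp

/-- The sawtooth sum over a dyadic range. -/
theorem exists_abs_sum_sawtooth_dyadic_le {α β γ ε : ℝ} (hα : 0 < α) (hγ0 : 11 / 12 < γ)
    (hγ1 : γ < 1) (hε : 0 < ε) :
    ∃ C : ℝ, 0 < C ∧ ∀ (q : ℕ) (a : ℤ) (x : ℝ), 1 ≤ q → 1 ≤ x →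
      |∑ p ∈ (primesAP x q a).filter (fun p : ℕ => x / 2 < p),
          Real.log p * sawtooth (-(((p : ℝ) - β) / α) ^ γ)| ≤
        C * x ^ (7 * γ / 13 + 11 / 26 + ε) := by
  set δ := (15 - 14 * γ) / 26 with hδ
  have hδ0 : 0 < δ := by rw [hδ]; linarith
  have hδ1 : δ < 1 / 12 := by rw [hδ]; linarith
  have hE : 7 * γ / 13 + 11 / 26 = 1 - δ := by rw [hδ]; ring
  rw [hE]
  set η := min (ε / 2) (1 / 2) with hη
  have hη0 : 0 < η := by positivity
  have hη1 : η ≤ ε / 2 := min_le_left _ _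
  obtain ⟨C₁, hC₁, hb₁⟩ := exists_norm_sum_residue_le (β := β) hα hγ0 hγ1 hδ (half_pos hε)
  obtain ⟨C₂, hC₂, hb₂⟩ := abs_sum_sawtooth_le_of_forall hη0 (min_le_right _ _)
  refine ⟨1 / ε + C₂ * C₁ + (8 * |β|) ^ 2, by positivity, fun q a x hq hx => ?_⟩
  have hx0 : 0 < x := by linarith
  set s := (primesAP x q a).filter (fun p : ℕ => x / 2 < p) with hs
  have hw : ∀ p ∈ s, 0 ≤ Real.log (p : ℝ) := fun p hp =>
    Real.log_nonneg (one_le_of_mem_primesAP (Finset.mem_filter.1 hp).1)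
  have hW : ∑ p ∈ s, Real.log (p : ℝ) ≤ x * Real.log x := sum_log_filter_primesAP_le hx q a _
  have hxE : 1 ≤ x ^ (1 - δ + ε) := Real.one_le_rpow hx (by linarith)
  -- Below `8 * |β|` the phase is not controlled; the sum is then bounded in terms of `β` alone.
  rcases lt_or_ge x (8 * |β|) with hsmall | hbig
  · calc |∑ p ∈ s, Real.log p * sawtooth (-(((p : ℝ) - β) / α) ^ γ)| ≤
        ∑ p ∈ s, Real.log (p : ℝ) := by
          refine (Finset.abs_sum_le_sum_abs _ _).trans (Finset.sum_le_sum fun p hp => ?_)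
          rw [abs_mul, abs_of_nonneg (hw p hp)]
          refine mul_le_of_le_one_right (hw p hp) ?_
          linarith [abs_sawtooth_le (-(((p : ℝ) - β) / α) ^ γ)]
      _ ≤ x * Real.log x := hW
      _ ≤ x * x := by
        gcongr
        linarith [Real.log_le_sub_one_of_pos hx0]
      _ ≤ (8 * |β|) ^ 2 * 1 := by rw [mul_one, sq]; gcongr
      _ ≤ (1 / ε + C₂ * C₁ + (8 * |β|) ^ 2) * x ^ (1 - δ + ε) := by
        gcongr
        have : 0 ≤ 1 / ε + C₂ * C₁ := by positivity
        linarith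
  · have hH : 1 ≤ x ^ δ := Real.one_le_rpow hx hδ0.le
    -- With `H = x ^ δ` the smoothing error is `x ^ (1 - δ) * log x`, matching the exponential sums.
    have h1 := hb₂ s (fun p => Real.log p) (fun p => -(((p : ℝ) - β) / α) ^ γ) (x ^ δ)
      (C₁ * x ^ (1 - δ + ε / 2)) hw hH (by positivity)
      (fun h hh => hb₁ q a x h hq hx hbig hh)
    refine h1.trans ?_
    have p1 : (x ^ δ)⁻¹ * ∑ p ∈ s, Real.log (p : ℝ) ≤ 1 / ε * x ^ (1 - δ + ε) := by
      have h2 := Real.log_le_rpow_div hx0.le hε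
      calc (x ^ δ)⁻¹ * ∑ p ∈ s, Real.log (p : ℝ) ≤ (x ^ δ)⁻¹ * (x * (x ^ ε / ε)) := by
            gcongr
            exact hW.trans (by gcongr)
        _ = _ := by
          rw [Real.rpow_add hx0, Real.rpow_sub hx0, Real.rpow_one]
          field_simp
    have p2 : C₂ * (C₁ * x ^ (1 - δ + ε / 2)) * (x ^ δ) ^ η ≤ C₂ * C₁ * x ^ (1 - δ + ε) := by
      calc C₂ * (C₁ * x ^ (1 - δ + ε / 2)) * (x ^ δ) ^ η =
          C₂ * C₁ * (x ^ (1 - δ + ε / 2) * x ^ (δ * η)) := by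
            rw [← Real.rpow_mul hx0.le]; ring
        _ = C₂ * C₁ * x ^ (1 - δ + ε / 2 + δ * η) := by rw [← Real.rpow_add hx0]
        _ ≤ _ := by
          gcongr C₂ * C₁ * ?_
          refine Real.rpow_le_rpow_of_exponent_le hx ?_
          have : δ * η ≤ 1 * η := by gcongr; linarith
          linarith
    have p3 : 0 ≤ (8 * |β|) ^ 2 * x ^ (1 - δ + ε) := by positivity
    linarith

/-- The dyadic bounds form a geometric series of ratio `ρ = 2 ^ (-E)`, and `C / (1 - ρ)` is the
constant reproduced by one halving of `x`. The induction ends at `x < 1`, where the sum is empty. -/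
theorem exists_abs_sawtoothSum_le {α β γ ε : ℝ} (hα : 0 < α) (hγ0 : 11 / 12 < γ)
    (hγ1 : γ < 1) (hε : 0 < ε) :
    ∃ C : ℝ, 0 < C ∧ ∀ (q : ℕ) (a : ℤ) (x : ℝ), 1 ≤ q → 0 ≤ x →
      |sawtoothSum α β γ q a x| ≤ C * x ^ (7 * γ / 13 + 11 / 26 + ε) := by
  obtain ⟨C, hC, hb⟩ := exists_abs_sum_sawtooth_dyadic_le (β := β) hα hγ0 hγ1 hε
  set E := 7 * γ / 13 + 11 / 26 + ε with hE
  have hE0 : 0 < E := by rw [hE]; linarith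
  set ρ : ℝ := (1 / 2) ^ E with hρ
  have hρ0 : 0 < ρ := by positivity
  have hρ1 : ρ < 1 := Real.rpow_lt_one (by norm_num) (by norm_num) hE0
  have hden : 0 < 1 - ρ := by linarith
  have hC' : 0 < C / (1 - ρ) := by positivity
  refine ⟨C / (1 - ρ), hC', fun q a x hq hx => ?_⟩
  have key : ∀ n : ℕ, ∀ x : ℝ, 0 ≤ x → x < 2 ^ n →
      |sawtoothSum α β γ q a x| ≤ C / (1 - ρ) * x ^ E := by
    have hsmall : ∀ x : ℝ, 0 ≤ x → x < 1 →
        |sawtoothSum α β γ q a x| ≤ C / (1 - ρ) * x ^ E := by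
      intro x hx hx1
      have h1 : ⌊x⌋₊ = 0 := Nat.floor_eq_zero.2 hx1
      have h2 : sawtoothSum α β γ q a x = 0 := by
        unfold sawtoothSum primesAP
        rw [h1]; simp
      rw [h2, abs_zero]
      positivity
    intro n
    induction n with
    | zero => intro x hx hx1; exact hsmall x hx (by simpa using hx1)
    | succ n ih =>
      intro x hx hxn
      rcases lt_or_ge x 1 with h | h
      · exact hsmall x hx h
      · have h1 := ih (x / 2) (by linarith) (by rw [pow_succ] at hxn; linarith)
        have h2 := hb q a x hq h
        rw [sawtoothSum_eq_add α β γ q a hx]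
        refine (abs_add_le _ _).trans ((add_le_add h1 h2).trans_eq ?_)
        rw [show x / 2 = 1 / 2 * x by ring, Real.mul_rpow (by norm_num) hx, ← hρ]
        field_simp
        ring
  obtain ⟨n, hn⟩ := pow_unbounded_of_one_lt x (by norm_num : (1 : ℝ) < 2)
  exact key n x hx hn

/-! ### The indicator of the sequence -/

/-- Whether a half-open interval of length at most `1` contains a positive integer, in terms of
the sawtooth function. -/
theorem indicator_eq_sawtooth {u v : ℝ} (hu : 0 < u) (huv : u ≤ v) (hv : v ≤ u + 1)
    (P : Prop) [Decidable P] (hP : P ↔ ∃ n : ℕ, 1 ≤ n ∧ u ≤ n ∧ (n : ℝ) < v) :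
    (if P then (1 : ℝ) else 0) = (v - u) + sawtooth (-v) - sawtooth (-u) := by
  -- The number of integers in the half-open interval is `⌈v⌉ - ⌈u⌉`, and `⌈t⌉ = -⌊-t⌋`.
  have e : (v - u) + sawtooth (-v) - sawtooth (-u) = ((⌈v⌉ - ⌈u⌉ : ℤ) : ℝ) := by
    unfold sawtooth
    rw [← Int.self_sub_floor, ← Int.self_sub_floor, Int.floor_neg, Int.floor_neg]
    push_cast
    ring
  rw [e]
  split_ifs with h
  · obtain ⟨n, _, h2, h3⟩ := hP.1 h
    have a1 : ⌈u⌉ = n := by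
      rw [Int.ceil_eq_iff]; push_cast; exact ⟨by linarith, h2⟩
    have a2 : ⌈v⌉ = n + 1 := by
      rw [Int.ceil_eq_iff]; push_cast; exact ⟨by linarith, by linarith⟩
    rw [a1, a2]; push_cast; ring
  · have h1 : 0 < ⌈u⌉ := Int.ceil_pos.2 hu
    have h2 : ¬ ((⌈u⌉ : ℝ) < v) := fun h3 => h (hP.2 ⟨⌈u⌉.toNat, by omega, by
      have : ((⌈u⌉.toNat : ℤ) : ℝ) = ⌈u⌉ := by rw [Int.toNat_of_nonneg h1.le]
      rw [Int.cast_natCast] at this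
      rw [this]
      exact ⟨Int.le_ceil u, h3⟩⟩)
    have h3 : ⌈v⌉ ≤ ⌈u⌉ := Int.ceil_le.2 (not_lt.1 h2)
    have h4 : ⌈u⌉ ≤ ⌈v⌉ := Int.ceil_mono huv
    have h5 : ⌈v⌉ - ⌈u⌉ = 0 := by omega
    rw [h5]; simp

/-- Writing `p + 1 - β` as `p - (β - 1)` gives both endpoints the same shape, so one estimate, used
with `β` and with `β - 1`, serves both sawtooth sums. -/
theorem mem_genPiatetskiShapiro_iff {α β c γ : ℝ} (hα : 0 < α) (hc : 0 < c) (hγ : γ = c⁻¹)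
    {p : ℕ} (hp : 0 < (p : ℝ) - β) :
    (p : ℤ) ∈ genPiatetskiShapiro α β c ↔ ∃ n : ℕ, 1 ≤ n ∧ (((p : ℝ) - β) / α) ^ γ ≤ n ∧
      (n : ℝ) < (((p : ℝ) - (β - 1)) / α) ^ γ := by
  have hγ0 : 0 < γ := by rw [hγ]; positivity
  unfold genPiatetskiShapiro
  rw [Set.mem_ofPred_eq]
  refine exists_congr fun n => and_congr_right fun _ => ?_
  have hn : (0 : ℝ) ≤ n := Nat.cast_nonneg n
  have hnc : 0 ≤ (n : ℝ) ^ c := by positivity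
  have e : (n : ℝ) = ((n : ℝ) ^ c) ^ γ := by
    rw [← Real.rpow_mul hn, hγ, mul_inv_cancel₀ hc.ne', Real.rpow_one]
  have h1 : (((p : ℝ) - β) / α) ^ γ ≤ n ↔ ((p : ℝ) - β) / α ≤ (n : ℝ) ^ c := by
    conv_lhs => rw [e]
    exact Real.rpow_le_rpow_iff (by positivity) hnc hγ0
  have h2 : (n : ℝ) < (((p : ℝ) - (β - 1)) / α) ^ γ ↔ (n : ℝ) ^ c < ((p : ℝ) - (β - 1)) / α := by
    conv_lhs => rw [e]
    exact Real.rpow_lt_rpow_iff hnc (div_nonneg (by linarith) hα.le) hγ0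
  rw [h1, h2, eq_comm, Int.floor_eq_iff, div_le_iff₀ hα, lt_div_iff₀ hα]
  push_cast
  constructor <;> rintro ⟨h3, h4⟩ <;> constructor <;> linarith

/-- The gap `(p + 1 - β) ^ γ - (p - β) ^ γ` compared with `γ p ^ (γ - 1)`. -/
theorem rpow_gap_approx {β γ p : ℝ} (hγ0 : 0 < γ) (hγ1 : γ < 1) (hp : 2 * |β| + 2 ≤ p) :
    0 ≤ (p - (β - 1)) ^ γ - (p - β) ^ γ ∧ (p - (β - 1)) ^ γ - (p - β) ^ γ ≤ 1 ∧
      |(p - (β - 1)) ^ γ - (p - β) ^ γ - γ * p ^ (γ - 1)| ≤ 4 * (|β| + 1) / p := by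
  have hb := abs_le.1 (le_refl |β|)
  have hab := abs_nonneg β
  have hp0 : 0 < p := by linarith
  -- The gap is `γ * ξ ^ (γ - 1)` with `ξ` within `|β| + 1` of `p`; a second use of the mean value
  -- inequality replaces `ξ` by `p`.
  obtain ⟨ξ, hξ, hξe⟩ := exists_hasDerivAt_eq_slope (fun t : ℝ => t ^ γ)
    (fun t => γ * t ^ (γ - 1)) (a := p - β) (b := p - (β - 1)) (by linarith)
    (fun t ht => (Real.hasDerivAt_rpow_const
      (Or.inl (by linarith [ht.1] : 0 < t).ne')).continuousAt.continuousWithinAt)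
    (fun t ht => Real.hasDerivAt_rpow_const (Or.inl (by linarith [ht.1] : 0 < t).ne'))
  rw [show p - (β - 1) - (p - β) = 1 by ring, div_one] at hξe
  have hξ1 : 1 ≤ ξ := by linarith [hξ.1]
  have hξp : p / 2 ≤ ξ := by linarith [hξ.1]
  rw [← hξe]
  have h1 : ξ ^ (γ - 1) ≤ 1 := Real.rpow_le_one_of_one_le_of_nonpos hξ1 (by linarith)
  have h0 : 0 ≤ ξ ^ (γ - 1) := by positivity
  refine ⟨by positivity, by nlinarith, ?_⟩
  have hder : ∀ t ∈ Set.Ici (p / 2), HasDerivWithinAt (fun t : ℝ => t ^ (γ - 1))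
      ((γ - 1) * t ^ (γ - 1 - 1)) (Set.Ici (p / 2)) t := fun t ht =>
    (Real.hasDerivAt_rpow_const
      (Or.inl (lt_of_lt_of_le (by linarith) ht : 0 < t).ne')).hasDerivWithinAt
  have hbound : ∀ t ∈ Set.Ici (p / 2), ‖(γ - 1) * t ^ (γ - 1 - 1)‖ ≤ 4 / p := by
    intro t ht
    have ht' : p / 2 ≤ t := ht
    have ht1 : 1 ≤ t := by linarith
    have h2 : t ^ (γ - 1 - 1) ≤ t ^ (-1 : ℝ) :=
      Real.rpow_le_rpow_of_exponent_le ht1 (by linarith)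
    have h3 : 0 ≤ t ^ (γ - 1 - 1) := by positivity
    rw [Real.rpow_neg_one] at h2
    have h4 : t⁻¹ ≤ 2 / p := by
      rw [inv_le_comm₀ (by linarith) (by positivity), inv_div]; exact ht'
    rw [norm_mul, Real.norm_eq_abs, Real.norm_eq_abs, abs_of_nonneg h3]
    calc |γ - 1| * t ^ (γ - 1 - 1) ≤ 1 * (2 / p) := by
          gcongr
          · rw [abs_le]; constructor <;> linarith
          · linarith
      _ ≤ 4 / p := by rw [one_mul]; gcongr; norm_num
  have h5 := (convex_Ici (p / 2)).norm_image_sub_le_of_norm_hasDerivWithin_le hder hbound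
    (x := p) (y := ξ) (by rw [Set.mem_Ici]; linarith) hξp
  rw [← mul_sub, abs_mul, abs_of_pos hγ0]
  rw [Real.norm_eq_abs, Real.norm_eq_abs] at h5
  have h6 : |ξ - p| ≤ |β| + 1 := by
    rw [abs_le]; constructor <;> linarith [hξ.1, hξ.2]
  calc γ * |ξ ^ (γ - 1) - p ^ (γ - 1)| ≤ 1 * (4 / p * (|β| + 1)) := by
        gcongr
        exact h5.trans (by gcongr)
    _ = _ := by ring

open scoped Classical in
/-- The indicator of the Piatetski--Shapiro sequence up to an error `O(1 / p)`. -/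
theorem exists_abs_indicator_sub_le {α β c γ : ℝ} (hα : 1 ≤ α) (hc : 1 < c) (hγ : γ = c⁻¹) :
    ∃ K : ℝ, 0 < K ∧ ∀ p : ℕ, 1 ≤ p →
      |(if (p : ℤ) ∈ genPiatetskiShapiro α β c then (1 : ℝ) else 0) -
        (α ^ (-γ) * γ * (p : ℝ) ^ (γ - 1) +
          (sawtooth (-(((p : ℝ) - (β - 1)) / α) ^ γ) - sawtooth (-(((p : ℝ) - β) / α) ^ γ)))| ≤
        K / p := by
  have hγ0 : 0 < γ := by rw [hγ]; positivity
  have hγ1 : γ < 1 := by rw [hγ]; exact inv_lt_one_of_one_lt₀ hc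
  have hα0 : 0 < α := by linarith
  have hA0 : 0 < α ^ (-γ) := by positivity
  have hA1 : α ^ (-γ) ≤ 1 := Real.rpow_le_one_of_one_le_of_nonpos hα (by linarith)
  have hab := abs_nonneg β
  have hb := abs_le.1 (le_refl |β|)
  refine ⟨4 * (|β| + 1) + 3 * (2 * |β| + 2), by positivity, fun p hp => ?_⟩
  have hp1 : (1 : ℝ) ≤ p := by exact_mod_cast hp
  have hp0 : (0 : ℝ) < p := by linarith
  rcases lt_or_ge (p : ℝ) (2 * |β| + 2) with hsmall | hbig
  · have s1 := abs_le.1 (abs_sawtooth_le (-(((p : ℝ) - (β - 1)) / α) ^ γ))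
    have s2 := abs_le.1 (abs_sawtooth_le (-(((p : ℝ) - β) / α) ^ γ))
    have h1 : (p : ℝ) ^ (γ - 1) ≤ 1 := Real.rpow_le_one_of_one_le_of_nonpos hp1 (by linarith)
    have h2 : 0 ≤ α ^ (-γ) * γ * (p : ℝ) ^ (γ - 1) := by positivity
    have h3 : α ^ (-γ) * γ * (p : ℝ) ^ (γ - 1) ≤ 1 * 1 * 1 := by gcongr
    -- For small `p` the indicator, the main term and the two sawtooth values together contribute at
    -- most 3.
    have h4 : (3 : ℝ) ≤ (4 * (|β| + 1) + 3 * (2 * |β| + 2)) / p := by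
      rw [le_div_iff₀ hp0]; linarith
    refine le_trans ?_ h4
    rw [abs_le]
    split_ifs <;> constructor <;> linarith
  · obtain ⟨g0, g1, g2⟩ := rpow_gap_approx (β := β) hγ0 hγ1 hbig
    have hu0 : 0 < (p : ℝ) - β := by linarith
    have hv0 : 0 < (p : ℝ) - (β - 1) := by linarith
    have eu : (((p : ℝ) - β) / α) ^ γ = α ^ (-γ) * ((p : ℝ) - β) ^ γ := by
      rw [Real.div_rpow hu0.le hα0.le, Real.rpow_neg hα0.le]; ring
    have ev : (((p : ℝ) - (β - 1)) / α) ^ γ = α ^ (-γ) * ((p : ℝ) - (β - 1)) ^ γ := by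
      rw [Real.div_rpow hv0.le hα0.le, Real.rpow_neg hα0.le]; ring
    set u := (((p : ℝ) - β) / α) ^ γ with hu
    set v := (((p : ℝ) - (β - 1)) / α) ^ γ with hv
    have evu : v - u = α ^ (-γ) * (((p : ℝ) - (β - 1)) ^ γ - ((p : ℝ) - β) ^ γ) := by
      rw [eu, ev]; ring
    have hvu0 : 0 ≤ v - u := by rw [evu]; positivity
    -- This is where `α ≥ 1` enters: the interval cannot contain two integers.
    have hvu1 : v - u ≤ 1 := by
      rw [evu]; exact mul_le_one₀ hA1 g0 g1
    have hupos : 0 < u := by rw [hu]; positivity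
    have hind := indicator_eq_sawtooth hupos (by linarith) (by linarith)
      ((p : ℤ) ∈ genPiatetskiShapiro α β c)
      (mem_genPiatetskiShapiro_iff hα0 (by linarith) hγ hu0)
    rw [hind]
    have e2 : v - u + sawtooth (-v) - sawtooth (-u) -
        (α ^ (-γ) * γ * (p : ℝ) ^ (γ - 1) + (sawtooth (-v) - sawtooth (-u))) =
        α ^ (-γ) * (((p : ℝ) - (β - 1)) ^ γ - ((p : ℝ) - β) ^ γ - γ * (p : ℝ) ^ (γ - 1)) := by
      rw [evu]; ring
    rw [e2, abs_mul, abs_of_pos hA0]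
    calc _ ≤ 1 * (4 * (|β| + 1) / p) := by gcongr
      _ ≤ _ := by
        rw [one_mul]
        gcongr
        linarith

/-! ### Main term and conclusion -/

/-- Partial summation for the main term. -/
theorem sum_log_mul_rpow_eq {γ : ℝ} (q : ℕ) (a : ℤ) {x : ℝ} (hx : 2 ≤ x) :
    ∑ p ∈ primesAP x q a, Real.log p * (p : ℝ) ^ (γ - 1) =
      x ^ (γ - 1) * thetaAP x q a +
        (1 - γ) * ∫ u in (2 : ℝ)..x, u ^ (γ - 2) * thetaAP u q a := by
  set d : ℕ → ℝ := fun n =>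
    if n.Prime ∧ (n : ℤ) ≡ a [ZMOD (q : ℤ)] then Real.log n else 0 with hd
  have hd0 : d 0 = 0 := by simp [hd]
  -- With the coefficients at 0 and 1 equal to zero, Abel summation may start its integral at 2.
  have hd1 : d 1 = 0 := by simp [hd]
  have hIcc : ∀ (t : ℝ) (g : ℕ → ℝ), ∑ k ∈ Finset.Icc 0 ⌊t⌋₊, g k * d k =
      ∑ p ∈ primesAP t q a, Real.log p * g p := by
    intro t g
    rw [primesAP, Finset.sum_filter, ← Finset.sum_subset (s₁ := Finset.Icc 1 ⌊t⌋₊)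
      (Finset.Icc_subset_Icc_left (Nat.zero_le 1))]
    · refine Finset.sum_congr rfl fun k _ => ?_
      simp only [hd]
      split_ifs
      · ring
      · ring
    · intro k hk hk'
      rw [Finset.mem_Icc] at hk hk'
      have : k = 0 := by omega
      rw [this, hd0, mul_zero]
  have hθ : ∀ t : ℝ, ∑ k ∈ Finset.Icc 0 ⌊t⌋₊, d k = thetaAP t q a := fun t => by
    have := hIcc t (fun _ => 1)
    simp only [one_mul, mul_one] at this
    rw [this]; rfl
  have hder : ∀ t : ℝ, 0 < t → HasDerivAt (fun t : ℝ => t ^ (γ - 1)) ((γ - 1) * t ^ (γ - 2)) t :=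
    fun t ht => by
      have := Real.hasDerivAt_rpow_const (x := t) (p := γ - 1) (Or.inl ht.ne')
      rwa [show γ - 1 - 1 = γ - 2 by ring] at this
  have hderiv : ∀ t ∈ Set.Icc (2 : ℝ) x,
      (γ - 1) * t ^ (γ - 2) = deriv (fun t : ℝ => t ^ (γ - 1)) t := fun t ht =>
    ((hder t (by linarith [ht.1])).deriv).symm
  have hcont : ContinuousOn (fun t : ℝ => (γ - 1) * t ^ (γ - 2)) (Set.Icc 2 x) := by
    refine continuousOn_const.mul (ContinuousOn.rpow_const continuousOn_id fun t ht => ?_)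
    exact Or.inl (by linarith [ht.1] : (0 : ℝ) < t).ne'
  have habel := sum_mul_eq_sub_integral_mul₁ (f := fun t : ℝ => t ^ (γ - 1)) d hd0 hd1 x
    (fun t ht => (hder t (by linarith [ht.1])).differentiableAt)
    ((hcont.integrableOn_Icc).congr_fun hderiv measurableSet_Icc)
  rw [hIcc x (fun k => (k : ℝ) ^ (γ - 1)), hθ x] at habel
  simp_rw [hθ] at habel
  rw [habel, intervalIntegral.integral_of_le hx, ← MeasureTheory.integral_const_mul,
    sub_eq_add_neg, ← MeasureTheory.integral_neg]
  congr 1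
  refine MeasureTheory.setIntegral_congr_fun measurableSet_Ioc fun t ht => ?_
  have h1 := hderiv t ⟨ht.1.le, ht.2⟩
  rw [← h1]
  ring

theorem sum_log_div_primesAP_le (q : ℕ) (a : ℤ) {x : ℝ} (hx : 1 ≤ x) :
    ∑ p ∈ primesAP x q a, Real.log p * (1 / (p : ℝ)) ≤ (1 + Real.log x) ^ 2 := by
  have hlog := Real.log_nonneg hx
  have h1 : ∑ p ∈ primesAP x q a, Real.log p * (1 / (p : ℝ)) ≤
      ∑ n ∈ Finset.Icc 1 ⌊x⌋₊, (1 + Real.log x) * ((n : ℝ))⁻¹ := by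
    refine (Finset.sum_le_sum (g := fun n : ℕ => (1 + Real.log x) * ((n : ℝ))⁻¹)
      fun p hp => ?_).trans ?_
    · rw [one_div]
      gcongr
      have := Real.log_le_log (by linarith [one_le_of_mem_primesAP hp]) (le_of_mem_primesAP hp)
      linarith
    · exact Finset.sum_le_sum_of_subset_of_nonneg (Finset.filter_subset _ _)
        fun n _ _ => by positivity
  refine h1.trans ?_
  rw [← Finset.mul_sum, sq]
  gcongr
  have h2 := harmonic_le_one_add_log ⌊x⌋₊
  rw [harmonic_eq_sum_Icc] at h2
  push_cast at h2
  refine h2.trans ?_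
  gcongr
  · exact_mod_cast Nat.floor_pos.2 hx
  · exact Nat.floor_le (by linarith)

theorem theorem3 (α β c γ ε : ℝ) (hα : 1 ≤ α) (hc₁ : 1 < c) (hc₂ : c < 12 / 11)
    (hγ : γ = c⁻¹) (hε : 0 < ε) :
    ∃ C : ℝ, 0 < C ∧ ∀ (q : ℕ) (a : ℤ) (x : ℝ), 1 ≤ q → 2 ≤ x →
      |thetaPS α β c x q a -
          (α ^ (-γ) * γ * x ^ (γ - 1) * thetaAP x q a +
            α ^ (-γ) * γ * (1 - γ) * ∫ u in (2 : ℝ)..x, u ^ (γ - 2) * thetaAP u q a)|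
        ≤ C * x ^ (7 * γ / 13 + 11 / 26 + ε) := by
  have hα0 : 0 < α := by linarith
  have hγ1 : γ < 1 := by rw [hγ]; exact inv_lt_one_of_one_lt₀ hc₁
  have hγ0 : 11 / 12 < γ := by
    rw [hγ, lt_inv_comm₀ (by norm_num) (by linarith)]
    norm_num
    exact hc₂
  obtain ⟨K, hK, hind⟩ := exists_abs_indicator_sub_le (β := β) hα hc₁ hγ
  obtain ⟨C₁, hC₁, hs₁⟩ := exists_abs_sawtoothSum_le (β := β) hα0 hγ0 hγ1 hε
  obtain ⟨C₂, hC₂, hs₂⟩ := exists_abs_sawtoothSum_le (β := β - 1) hα0 hγ0 hγ1 hε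
  refine ⟨K * 25 + (C₂ + C₁), by positivity, fun q a x hq hx => ?_⟩
  have hx0 : 0 < x := by linarith
  have hx1 : 1 ≤ x := by linarith
  classical
  have hPS : thetaPS α β c x q a = ∑ p ∈ primesAP x q a,
      Real.log p * (if (p : ℤ) ∈ genPiatetskiShapiro α β c then (1 : ℝ) else 0) := by
    unfold thetaPS primesAP
    simp_rw [mul_ite, mul_one, mul_zero]
    rw [← Finset.sum_filter, Finset.filter_filter]
    refine Finset.sum_congr ?_ fun _ _ => rfl
    ext p
    simp only [Finset.mem_filter]
    tauto
  have hmain := sum_log_mul_rpow_eq (γ := γ) q a hx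
  have hsplit : thetaPS α β c x q a -
          (α ^ (-γ) * γ * x ^ (γ - 1) * thetaAP x q a +
            α ^ (-γ) * γ * (1 - γ) * ∫ u in (2 : ℝ)..x, u ^ (γ - 2) * thetaAP u q a) =
      ∑ p ∈ primesAP x q a, Real.log p *
        ((if (p : ℤ) ∈ genPiatetskiShapiro α β c then (1 : ℝ) else 0) -
        (α ^ (-γ) * γ * (p : ℝ) ^ (γ - 1) +
          (sawtooth (-(((p : ℝ) - (β - 1)) / α) ^ γ) - sawtooth (-(((p : ℝ) - β) / α) ^ γ)))) +
      (sawtoothSum α (β - 1) γ q a x - sawtoothSum α β γ q a x) := by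
    have e : α ^ (-γ) * γ * x ^ (γ - 1) * thetaAP x q a +
            α ^ (-γ) * γ * (1 - γ) * ∫ u in (2 : ℝ)..x, u ^ (γ - 2) * thetaAP u q a =
        α ^ (-γ) * γ * ∑ p ∈ primesAP x q a, Real.log p * (p : ℝ) ^ (γ - 1) := by
      rw [hmain]; ring
    rw [e, hPS, sawtoothSum, sawtoothSum, Finset.mul_sum, ← Finset.sum_sub_distrib,
      ← Finset.sum_sub_distrib, ← Finset.sum_add_distrib]
    exact Finset.sum_congr rfl fun p _ => by ring
  have herr : |∑ p ∈ primesAP x q a, Real.log p *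
        ((if (p : ℤ) ∈ genPiatetskiShapiro α β c then (1 : ℝ) else 0) -
        (α ^ (-γ) * γ * (p : ℝ) ^ (γ - 1) +
          (sawtooth (-(((p : ℝ) - (β - 1)) / α) ^ γ) -
            sawtooth (-(((p : ℝ) - β) / α) ^ γ))))| ≤
      K * 25 * x ^ (7 * γ / 13 + 11 / 26 + ε) := by
    calc _ ≤ ∑ p ∈ primesAP x q a, K * (Real.log p * (1 / (p : ℝ))) := by
          refine (Finset.abs_sum_le_sum_abs _ _).trans (Finset.sum_le_sum fun p hp => ?_)
          have hl : 0 ≤ Real.log (p : ℝ) := Real.log_nonneg (one_le_of_mem_primesAP hp)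
          rw [abs_mul, abs_of_nonneg hl]
          calc _ ≤ Real.log p * (K / p) := by
                gcongr
                exact hind p (mem_primesAP.1 hp).1.1
            _ = _ := by ring
      _ = K * ∑ p ∈ primesAP x q a, Real.log p * (1 / (p : ℝ)) := by rw [Finset.mul_sum]
      -- The error `K / p` sums to `K * (1 + log x) ^ 2`; the constant `5 = 1 + 1 / (1/4)` bounds
      -- one logarithm by `5 * x ^ (1/4)`, and `x ^ (1/2)` is below the allowed error.
      _ ≤ K * (5 * x ^ (1 / 4 : ℝ)) ^ 2 := by
        gcongr
        refine (sum_log_div_primesAP_le q a hx1).trans ?_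
        have h1 := one_add_log_le_rpow hx1 (ε := 1 / 4) (by norm_num)
        have h2 := Real.log_nonneg hx1
        gcongr
        refine h1.trans_eq ?_
        norm_num
      _ = K * 25 * x ^ (1 / 2 : ℝ) := by
        rw [mul_pow, ← Real.rpow_natCast (x ^ (1 / 4 : ℝ)), ← Real.rpow_mul hx0.le]
        norm_num
        ring
      _ ≤ _ := by
        gcongr K * 25 * ?_
        exact Real.rpow_le_rpow_of_exponent_le hx1 (by linarith)
  rw [hsplit]
  have h1 := hs₁ q a x hq hx0.le
  have h2 := hs₂ q a x hq hx0.le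
  refine (abs_add_le _ _).trans ?_
  refine (add_le_add herr ((abs_sub _ _).trans (add_le_add h2 h1))).trans_eq ?_
  ring
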